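/- Let $p$ be a prime, $L$ a finite extension of $\mathbf{Q}_p$ with ring of integers $\mathcal{O}_L$, $G=\mathrm{GL}_n(\mathbf{Q}_p)$, $\kappa=2$ if $p=2$ and $\kappa=1$ otherwise, and $H=1+p^{\kappa}M_n(\mathbf{Z}_p)$. For $g\in G$ let $d(g,1)$ be the least $m\ge 0$ such that $H^{p^m}\subset gHg^{-1}$. Let $\Pi$ be an $L$-Banach space with a continuous $L$-linear action of $G$ having a central character, and admissible (the continuous dual $\Pi^*$ is a finitely generated module over the algebra $\Lambda(H)$ of $L$-valued measures on $H$); the action is not assumed to be unitary. Fix an ultrametric valuation $v_\Pi$ defining the topology of $\Pi$. Let $(h_{ij})_{1\le i,j\le n}$, $h_{ij}=1+p^{\kappa}E_{ij}$, be the standard minimal system of topological generators of $H$; for $\alpha\in\mathbf{N}^{n^2}$ put $b^{\alpha}=\prod_{i,j}(h_{ij}-1)^{\alpha_{ij}}$ (product in the lexicographic order), and for $h\ge 1$ put $r_h=\frac{1}{p^{h-1}(p-1)}$, $$\Pi^{(h)}=\{v\in\Pi:\ v_\Pi(b^{\alpha}v)-r_h|\alpha|\to\infty \text{ as } |\alpha|\to\infty\},\qquad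 v^{(h)}(v)=\inf_{\alpha}\bigl(v_\Pi(b^{\alpha}v)-r_h|\alpha|\bigr),$$ and let $\Pi_0^{(h)}=\{v\in\Pi^{(h)}: v^{(h)}(v)\ge 0\}$ be the unit ball of the Banach space $\Pi^{(h)}$. Let $\Pi^{\mathrm{an}}$ be the space of locally analytic vectors of $\Pi$ (those $v$ for which $g\mapsto g\cdot v$ is locally analytic on $G$), with the locally convex inductive limit topology of the spaces $\Pi^{(h)}$. Assume that $\Pi$ is coherent: there is an integer $m(\Pi)\geq 1$ such that $\Pi^{(h+k)}=\sum_{d(g,1)\le k} g\cdot\Pi^{(h)}$ for all $h\ge m(\Pi)$ and $k\ge 0$. Then $\Pi^{\mathrm{an}}=\bigcup_{h\ge 1}\Pi^{(h)}$, and $\Pi^{\mathrm{an}}$ has a universal unitary completion, that is, a unitary $L$-Banach representation $\widehat{\Pi^{\mathrm{an}}}$ of $G$ with a continuous $L$-linear $G$-equivariant map $\iota:\Pi^{\mathrm{an}}\to\widehat{\Pi^{\mathrm{an}}}$ through which every continuous $L$-linear $G$-equivariant map from $\Pi^{\mathrm{an}}$ to a unitary $L$-Banach representation of $G$ factors uniquely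 by a continuous $L$-linear $G$-equivariant map. More precisely, for every integer $m(\Pi)$ as above and every $h\ge m(\Pi)$, the $\mathcal{O}_L$-module $M=\sum_{g\in G}g\cdot\Pi_0^{(h)}$ is an open lattice of $\Pi^{\mathrm{an}}$ (an open $\mathcal{O}_L$-submodule that spans $\Pi^{\mathrm{an}}$ over $L$; it need not be $p$-adically separated), and $\widehat{\Pi^{\mathrm{an}}}$ is the completion of $\Pi^{\mathrm{an}}$ with respect to $M$: the space $L\otimes_{\mathcal{O}_L}\varprojlim_k M/p^kM$, with the topology for which the $p^j\varprojlim_k M/p^kM$ ($j\geq 0$) form a basis of neighbourhoods of $0$, with the induced action of $G$ and with the map $\iota$ given on $M$ by the natural map $M\to\varprojlim_k M/p^kM$, is a universal unitary completion of $\Pi^{\mathrm{an}}$. -/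

import Mathlib

open Filter Topology
open scoped TensorProduct NNReal

universe u v w x y

namespace UnitaryCompletion

noncomputable section


/-! ### Unitary Banach representations and universal unitary completions -/

section General

variable {L : Type u} [NormedField L]
variable {G : Type x} [Group G] [TopologicalSpace G]

/-- A representation of a topological group on a topological `L`-vector space is a unitary Banach
representation if the action is (jointly) continuous and the topology is defined by a complete
ultrametric norm which is homogeneous for the absolute value of `L` and invariant under `G`. -/
structure IsUnitaryBanachRep {W : Type v} [AddCommGroup W] [Module L W] [TopologicalSpace W]
    (σ : Representation L G W) : Prop where
  continuous_action : Continuous fun z : G × W => σ z.1 z.2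
  exists_norm : ∃ N : Seminorm L W,
    (∀ a b : W, N (a + b) ≤ max (N a) (N b)) ∧
    (∀ a : W, N a = 0 → a = 0) ∧
    (∀ U : Set W, IsOpen U ↔ ∀ a ∈ U, ∃ ε : ℝ, 0 < ε ∧ ∀ b : W, N (b - a) < ε → b ∈ U) ∧
    (∀ s : ℕ → W, (∀ ε : ℝ, 0 < ε → ∃ k : ℕ, ∀ i ≥ k, ∀ j ≥ k, N (s i - s j) < ε) →
      ∃ a : W, Tendsto (fun i => N (s i - a)) atTop (𝓝 0)) ∧
    (∀ (g : G) (a : W), N (σ g a) = N a)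

/-- `ι : V → W` exhibits the unitary Banach representation `σ` on `W` as the universal unitary
completion of the representation `τ` on `V`. -/
structure IsUniversalUnitaryCompletion
    {V : Type v} [AddCommGroup V] [Module L V] [TopologicalSpace V]
    {W : Type y} [AddCommGroup W] [Module L W] [TopologicalSpace W]
    (τ : Representation L G V) (σ : Representation L G W) (ι : V →L[L] W) : Prop where
  unitary : IsUnitaryBanachRep σ
  equivariant : ∀ (g : G) (a : V), ι (τ g a) = σ g (ι a)
  universal : ∀ (B : Type w) [AddCommGroup B] [Module L B] [TopologicalSpace B]
    (β : Representation L G B), IsUnitaryBanachRep β →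
    ∀ f : V →L[L] B, (∀ (g : G) (a : V), f (τ g a) = β g (f a)) →
    ∃! F : W →L[L] B, (∀ (g : G) (b : W), F (σ g b) = β g (F b)) ∧ ∀ a : V, F (ι a) = f a

/-- The representation `τ` has a universal unitary completion. -/
def HasUniversalUnitaryCompletion
    {V : Type v} [AddCommGroup V] [Module L V] [TopologicalSpace V]
    (τ : Representation L G V) : Prop :=
  ∃ (W : Type (max u v)) (_ : AddCommGroup W) (_ : Module L W) (_ : TopologicalSpace W)
    (σ : Representation L G W) (ι : V →L[L] W),
    IsUniversalUnitaryCompletion.{u, v, w, x, max u v} τ σ ι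

end General

/-! ### Completion of a vector space with respect to a lattice -/

section LatticeCompletion

variable (p : ℕ) {L : Type u} [NormedField L] [IsUltrametricDist L]

variable (L) in
/-- The ring of integers `𝒪_L = {a ∈ L : ‖a‖ ≤ 1}`. -/
abbrev OL : Subring L := (NormedField.valuation (K := L)).integer

variable (L) in
/-- The ideal `(p)` of `𝒪_L`. -/
def idealP : Ideal (OL L) := Ideal.span {(p : OL L)}

variable {V : Type v} [AddCommGroup V] [Module L V]

/-- `L ⊗_{𝒪_L} lim_k M / p^k M`: the completion of `V` with respect to a lattice `M ⊆ V`. -/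
def LatticeCompletion (M : Submodule (OL L) V) : Type (max u v) :=
  L ⊗[OL L] AdicCompletion (idealP p L) M

variable (M : Submodule (OL L) V)

instance : AddCommGroup (LatticeCompletion p M) :=
  inferInstanceAs (AddCommGroup (L ⊗[OL L] AdicCompletion (idealP p L) M))

instance : Module L (LatticeCompletion p M) :=
  inferInstanceAs (Module L (L ⊗[OL L] AdicCompletion (idealP p L) M))

/-- The map `z ↦ 1 ⊗ z` from `lim_k M / p^k M` to the completion. -/
def LatticeCompletion.ofInt :
    AdicCompletion (idealP p L) M →ₗ[OL L] L ⊗[OL L] AdicCompletion (idealP p L) M :=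
  TensorProduct.mk (OL L) L (AdicCompletion (idealP p L) M) 1

/-- The element `1 ⊗ z` of the completion. -/
def LatticeCompletion.int (z : AdicCompletion (idealP p L) M) : LatticeCompletion p M :=
  LatticeCompletion.ofInt p M z

lemma LatticeCompletion.int_pow_smul (k : ℕ) (z : AdicCompletion (idealP p L) M) :
    LatticeCompletion.int p M (((p : OL L) ^ k) • z)
      = ((p : L) ^ k) • LatticeCompletion.int p M z := by
  unfold LatticeCompletion.int
  rw [map_smul]
  change ((p : OL L) ^ k) • (LatticeCompletion.ofInt p M z)
    = ((p : L) ^ k) • (LatticeCompletion.ofInt p M z)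
  rw [← algebraMap_smul L ((p : OL L) ^ k)]
  simp

/-- The topology of the completion: the sets `p^k (lim_j M / p^j M)` form a basis of
neighbourhoods of `0`. -/
instance : TopologicalSpace (LatticeCompletion p M) where
  IsOpen U := ∀ a ∈ U, ∃ k : ℕ, ∀ z : AdicCompletion (idealP p L) M,
    a + ((p : L) ^ k) • LatticeCompletion.int p M z ∈ U
  isOpen_univ := fun _ _ => ⟨0, fun _ => Set.mem_univ _⟩
  isOpen_inter := by
    rintro U U' hU hU' a ⟨ha, ha'⟩
    obtain ⟨k, hk⟩ := hU a ha
    obtain ⟨k', hk'⟩ := hU' a ha'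
    refine ⟨k + k', fun z => ⟨?_, ?_⟩⟩
    · have := hk (((p : OL L) ^ k') • z)
      rwa [LatticeCompletion.int_pow_smul, smul_smul, ← pow_add] at this
    · have := hk' (((p : OL L) ^ k) • z)
      rwa [LatticeCompletion.int_pow_smul, smul_smul, ← pow_add, add_comm k' k] at this
  isOpen_sUnion := by
    rintro S hS a ⟨U, hU, ha⟩
    obtain ⟨k, hk⟩ := hS U hU a ha
    exact ⟨k, fun z => ⟨U, hU, hk z⟩⟩

variable {G : Type x} [Group G]

/-- The action of `g` on a `G`-stable lattice. -/
def latticeAction (τ : Representation L G V)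
    (hM : ∀ g : G, ∀ a ∈ M, τ g a ∈ M) (g : G) : M →ₗ[OL L] M :=
  ((τ g).restrictScalars (OL L)).restrict (hM g)

lemma latticeAction_one (τ : Representation L G V) (hM : ∀ g : G, ∀ a ∈ M, τ g a ∈ M) :
    latticeAction M τ hM 1 = LinearMap.id := by
  apply LinearMap.ext
  intro a
  apply Subtype.ext
  change τ 1 a = a
  rw [map_one]; rfl

lemma latticeAction_mul (τ : Representation L G V) (hM : ∀ g : G, ∀ a ∈ M, τ g a ∈ M)
    (g g' : G) :
    latticeAction M τ hM (g * g') = latticeAction M τ hM g ∘ₗ latticeAction M τ hM g' := by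
  apply LinearMap.ext
  intro a
  apply Subtype.ext
  change τ (g * g') a = τ g (τ g' a)
  rw [map_mul]; rfl

/-- The endomorphism of `L ⊗_{𝒪_L} lim_k M / p^k M` induced by an endomorphism of `M`. -/
def completionMap (f : M →ₗ[OL L] M) :
    L ⊗[OL L] AdicCompletion (idealP p L) M →ₗ[L] L ⊗[OL L] AdicCompletion (idealP p L) M :=
  ((AdicCompletion.map (idealP p L) f).restrictScalars (OL L)).baseChange L

lemma completionMap_id : completionMap p M LinearMap.id = LinearMap.id := by
  unfold completionMap
  rw [AdicCompletion.map_id]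
  exact LinearMap.baseChange_id

lemma completionMap_comp (f f' : M →ₗ[OL L] M) :
    completionMap p M (f ∘ₗ f') = completionMap p M f ∘ₗ completionMap p M f' := by
  unfold completionMap
  rw [← AdicCompletion.map_comp, ← LinearMap.baseChange_comp]
  rfl

/-- The action of `G` on the completion with respect to a `G`-stable lattice. -/
def latticeCompletionRep (τ : Representation L G V)
    (hM : ∀ g : G, ∀ a ∈ M, τ g a ∈ M) : Representation L G (LatticeCompletion p M) :=
  let φ : Representation L G (L ⊗[OL L] AdicCompletion (idealP p L) M) :=
    { toFun := fun g => completionMap p M (latticeAction M τ hM g)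
      map_one' := by rw [latticeAction_one, completionMap_id]; rfl
      map_mul' := fun g g' => by rw [latticeAction_mul, completionMap_comp]; rfl }
  φ

end LatticeCompletion

/-! ### Banach representations of `GL_n(ℚ_p)` -/

section GLn

variable {p : ℕ} [Fact p.Prime] {n : ℕ}

variable (p) in
/-- `κ = 2` if `p = 2` and `κ = 1` otherwise. -/
def kappa : ℕ := if p = 2 then 2 else 1

variable (p) in
/-- `r_h = 1 / (p^(h-1) (p-1))`, for `h ≥ 1`. -/
def radius (h : ℕ) : ℝ := 1 / ((p : ℝ) ^ (h - 1) * ((p : ℝ) - 1))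

variable (p n) in
/-- The uniform pro-`p` group `H = 1 + p^κ M_n(ℤ_p)`, as a subgroup of `GL_n(ℚ_p)`: the image of
the kernel of `GL_n(ℤ_p) → GL_n(ℤ/p^κ)`. -/
def H : Subgroup (GL (Fin n) ℚ_[p]) :=
  (Matrix.GeneralLinearGroup.map (n := Fin n)
    (PadicInt.toZModPow (p := p) (kappa p))).ker.map
  (Matrix.GeneralLinearGroup.map (n := Fin n) (algebraMap ℤ_[p] ℚ_[p]))

/-- `d(g,1)`: the least `m` such that `H^(p^m) ⊆ g H g⁻¹`. -/
def dist1 (g : GL (Fin n) ℚ_[p]) : ℕ :=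
  sInf {m : ℕ | ∀ a ∈ H p n, g⁻¹ * a ^ (p ^ m) * g ∈ H p n}

lemma one_add_kappa_ne_zero : (1 : ℚ_[p]) + (p : ℚ_[p]) ^ kappa p ≠ 0 := by
  have : ((1 + p ^ kappa p : ℕ) : ℚ_[p]) ≠ 0 := by
    rw [Nat.cast_ne_zero]; omega
  simpa using this

lemma det_generator_ne_zero (i j : Fin n) :
    ((1 : Matrix (Fin n) (Fin n) ℚ_[p])
      + Matrix.single i j ((p : ℚ_[p]) ^ kappa p)).det ≠ 0 := by
  by_cases hij : i = j
  · subst hij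
    have : ((1 : Matrix (Fin n) (Fin n) ℚ_[p]) + Matrix.single i i ((p : ℚ_[p]) ^ kappa p))
        = Matrix.diagonal (fun k => 1 + if k = i then (p : ℚ_[p]) ^ kappa p else 0) := by
      ext a b
      by_cases hab : a = b
      · subst hab
        by_cases hai : a = i
        · subst hai; simp
        · simp [hai, Ne.symm hai]
      · have : ¬ (i = a ∧ i = b) := fun h => hab (h.1.symm.trans h.2)
        simp [hab, this]
    rw [this, Matrix.det_diagonal, Finset.prod_ne_zero_iff]
    intro k _
    split_ifs
    · exact one_add_kappa_ne_zero
    · simp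
  · have := Matrix.det_transvection_of_ne i j hij ((p : ℚ_[p]) ^ kappa p)
    rw [Matrix.transvection] at this
    rw [this]
    exact one_ne_zero

variable (p) in
/-- The minimal system of topological generators `h_{ij} = 1 + p^κ E_{ij}` of `H`. -/
def generator (ij : Fin n × Fin n) : GL (Fin n) ℚ_[p] :=
  Matrix.GeneralLinearGroup.mkOfDetNeZero
    (1 + Matrix.single ij.1 ij.2 ((p : ℚ_[p]) ^ kappa p)) (det_generator_ne_zero ij.1 ij.2)

/-- The total degree `|α|`. -/
def degree (α : Fin n × Fin n → ℕ) : ℕ := ∑ ij, α ij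

section Algebraic

variable {L : Type u} [NormedField L] {E : Type v} [AddCommGroup E] [Module L E]

/-- `b^α = ∏ (h_{ij} - 1)^(α_{ij})`, the (noncommutative) product being taken in the
lexicographic order of the indices, acting on `E`. -/
def bOp (ρ : Representation L (GL (Fin n) ℚ_[p]) E) (α : Fin n × Fin n → ℕ) : Module.End L E :=
  ((List.finRange n ×ˢ List.finRange n).map
    fun ij => (ρ (generator p ij) - 1) ^ (α ij)).prod

/-- The restriction of `ρ` to the centre is given by a continuous character. -/
def HasCentralCharacter (ρ : Representation L (GL (Fin n) ℚ_[p]) E) : Prop :=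
  ∃ δ : ℚ_[p]ˣ →* Lˣ, Continuous δ ∧ ∀ (a : ℚ_[p]ˣ) (g : GL (Fin n) ℚ_[p]),
    (g : Matrix (Fin n) (Fin n) ℚ_[p]) = Matrix.scalar (Fin n) (a : ℚ_[p]) →
    ∀ e : E, ρ g e = (δ a : L) • e

end Algebraic

section Banach

variable {L : Type u} [NormedField L] [NormedAlgebra ℚ_[p] L]
variable {E : Type v} [NormedAddCommGroup E] [NormedSpace L E]

/-- `ρ` is a continuous action. -/
def IsContinuousRep (ρ : Representation L (GL (Fin n) ℚ_[p]) E) : Prop :=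
  Continuous fun z : GL (Fin n) ℚ_[p] × E => ρ z.1 z.2

/-- The continuous function `a ↦ l(a⁻¹ e)` on `H`. -/
def coefficient {ρ : Representation L (GL (Fin n) ℚ_[p]) E} (hρ : IsContinuousRep ρ)
    (l : E →L[L] L) (e : E) : C(H p n, L) where
  toFun a := l (ρ (a : GL (Fin n) ℚ_[p])⁻¹ e)
  continuous_toFun := by
    have h1 : Continuous fun a : H p n => ((a : GL (Fin n) ℚ_[p])⁻¹, e) := by fun_prop
    exact l.continuous.comp (hρ.comp h1)

/-- Admissibility: the dual `E*` is finitely generated over `Λ(H)`, the algebra of `L`-valued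
measures on `H` (the continuous dual of `C(H, L)`). A measure `μ` acts on `l ∈ E*` by
`(μ l)(e) = ∫ l(a⁻¹ e) dμ(a)`. -/
def IsAdmissible {ρ : Representation L (GL (Fin n) ℚ_[p]) E} (hρ : IsContinuousRep ρ) : Prop :=
  ∃ (r : ℕ) (l : Fin r → (E →L[L] L)), ∀ l' : E →L[L] L,
    ∃ μ : Fin r → (C(H p n, L) →L[L] L), ∀ e : E, l' e = ∑ i, μ i (coefficient hρ (l i) e)

/-- The norm `‖e‖_h = sup_α p^(r_h |α|) ‖b^α e‖`, that is, the exponential of minus the valuation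
`v^(h)(e) = inf_α (v(b^α e) - r_h |α|)`; it is meaningful on the space `Π^(h)` below. -/
def normH (ρ : Representation L (GL (Fin n) ℚ_[p]) E) (h : ℕ) (e : E) : ℝ :=
  ⨆ α : Fin n × Fin n → ℕ, (p : ℝ) ^ (radius p h * degree α) * ‖bOp ρ α e‖

/-- The space `Π^(h)` of the vectors `e` such that `v(b^α e) - r_h |α| → ∞` when `|α| → ∞`. -/
def PiH (ρ : Representation L (GL (Fin n) ℚ_[p]) E) (h : ℕ) : Submodule L E where
  carrier := {e | Tendsto (fun α : Fin n × Fin n → ℕ =>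
    (p : ℝ) ^ (radius p h * degree α) * ‖bOp ρ α e‖) cofinite (𝓝 0)}
  zero_mem' := by simp [tendsto_const_nhds]
  add_mem' := by
    intro a b ha hb
    have hab := Tendsto.add ha hb
    rw [add_zero] at hab
    refine squeeze_zero (fun α => by positivity) (fun α => ?_) hab
    rw [map_add, ← mul_add]
    exact mul_le_mul_of_nonneg_left (norm_add_le _ _) (by positivity)
  smul_mem' := by
    intro c a ha
    have hca := Tendsto.const_mul ‖c‖ ha
    rw [mul_zero] at hca
    refine hca.congr (fun α => ?_)
    rw [map_smul, norm_smul]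
    ring

/-- `ρ` is coherent from `m` on: for all `h ≥ m` and `k ≥ 0`, one has
`Π^(h+k) = ∑_{d(g,1) ≤ k} g Π^(h)`. -/
def IsCoherentFrom (ρ : Representation L (GL (Fin n) ℚ_[p]) E) (m : ℕ) : Prop :=
  1 ≤ m ∧ ∀ h ≥ m, ∀ k : ℕ,
    PiH ρ (h + k) = ⨆ (g : GL (Fin n) ℚ_[p]) (_ : dist1 g ≤ k), (PiH ρ h).map (ρ g)

/-- `ρ` is coherent. -/
def IsCoherent (ρ : Representation L (GL (Fin n) ℚ_[p]) E) : Prop :=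
  ∃ m, IsCoherentFrom ρ m

/-- A function on `GL_n(ℚ_p)` is locally analytic if, near each point, it is given by a convergent
power series in the matrix entries. -/
def IsLocallyAnalytic (L : Type u) [NormedField L] [NormedAlgebra ℚ_[p] L]
    {E : Type v} [NormedAddCommGroup E] [NormedSpace L E] (f : GL (Fin n) ℚ_[p] → E) : Prop :=
  letI : NormedSpace ℚ_[p] E := NormedSpace.restrictScalars ℚ_[p] L E
  ∀ g : GL (Fin n) ℚ_[p], ∃ F : (Fin n → Fin n → ℚ_[p]) → E,
    AnalyticAt ℚ_[p] F (fun i j => g i j) ∧ ∀ᶠ a in 𝓝 g, f a = F (fun i j => a i j)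

lemma IsLocallyAnalytic.add {f f' : GL (Fin n) ℚ_[p] → E} (hf : IsLocallyAnalytic L f)
    (hf' : IsLocallyAnalytic L f') : IsLocallyAnalytic L (fun a => f a + f' a) := by
  letI : NormedSpace ℚ_[p] E := NormedSpace.restrictScalars ℚ_[p] L E
  intro g
  obtain ⟨F, hF, h⟩ := hf g
  obtain ⟨F', hF', h'⟩ := hf' g
  refine ⟨F + F', hF.add hF', ?_⟩
  filter_upwards [h, h'] with a ha ha'
  simp [ha, ha']

lemma IsLocallyAnalytic.smul (c : L) {f : GL (Fin n) ℚ_[p] → E} (hf : IsLocallyAnalytic L f) :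
    IsLocallyAnalytic L (fun a => c • f a) := by
  letI : NormedSpace ℚ_[p] E := NormedSpace.restrictScalars ℚ_[p] L E
  haveI : IsScalarTower ℚ_[p] L E := IsScalarTower.restrictScalars ℚ_[p] L E
  intro g
  obtain ⟨F, hF, h⟩ := hf g
  let T : E →L[ℚ_[p]] E := (c • ContinuousLinearMap.id L E).restrictScalars ℚ_[p]
  refine ⟨fun a => T (F a), (T.analyticAt _).comp hF, ?_⟩
  filter_upwards [h] with a ha
  simp [ha, T]

lemma IsLocallyAnalytic.mul_right {f : GL (Fin n) ℚ_[p] → E} (hf : IsLocallyAnalytic L f)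
    (b : GL (Fin n) ℚ_[p]) : IsLocallyAnalytic L (fun a => f (a * b)) := by
  letI : NormedSpace ℚ_[p] E := NormedSpace.restrictScalars ℚ_[p] L E
  intro g
  obtain ⟨F, hF, h⟩ := hf (g * b)
  let T₀ : (Fin n → Fin n → ℚ_[p]) →ₗ[ℚ_[p]] (Fin n → Fin n → ℚ_[p]) :=
    { toFun := fun a i j => ∑ k, a i k * b k j
      map_add' := fun a a' => by
        ext i j; simp [add_mul, Finset.sum_add_distrib]
      map_smul' := fun c a => by
        ext i j; simp [Finset.mul_sum, mul_assoc] }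
  let T : (Fin n → Fin n → ℚ_[p]) →L[ℚ_[p]] (Fin n → Fin n → ℚ_[p]) :=
    LinearMap.toContinuousLinearMap T₀
  have hT : ∀ a : GL (Fin n) ℚ_[p], T (fun i j => a i j) = fun i j => (a * b) i j := by
    intro a
    ext i j
    simp [T, T₀, Matrix.mul_apply]
  refine ⟨fun a => F (T a), ?_, ?_⟩
  · have hF' : AnalyticAt ℚ_[p] F (T fun i j => g i j) := by rw [hT]; exact hF
    exact hF'.comp (T.analyticAt _)
  · have hc : Tendsto (fun a : GL (Fin n) ℚ_[p] => a * b) (𝓝 g) (𝓝 (g * b)) :=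
      (continuous_mul_const b).tendsto g
    filter_upwards [hc.eventually h] with a ha
    rw [ha, hT]

/-- The subspace `Π^an` of the locally analytic vectors: those `e` whose orbit map `g ↦ g e` is
locally analytic on `GL_n(ℚ_p)`. -/
def analyticSubmodule (ρ : Representation L (GL (Fin n) ℚ_[p]) E) : Submodule L E where
  carrier := {e | IsLocallyAnalytic L fun g => ρ g e}
  zero_mem' := by
    intro g
    letI : NormedSpace ℚ_[p] E := NormedSpace.restrictScalars ℚ_[p] L E
    exact ⟨fun _ => 0, analyticAt_const, by simp⟩
  add_mem' := by
    intro a b ha hb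
    have := IsLocallyAnalytic.add ha hb
    simpa using this
  smul_mem' := by
    intro c a ha
    have := IsLocallyAnalytic.smul c ha
    simpa using this

lemma analyticSubmodule_stable (ρ : Representation L (GL (Fin n) ℚ_[p]) E)
    (g : GL (Fin n) ℚ_[p]) : ∀ e ∈ analyticSubmodule ρ, ρ g e ∈ analyticSubmodule ρ := by
  intro e he
  have := IsLocallyAnalytic.mul_right (show IsLocallyAnalytic L fun a => ρ a e from he) g
  change IsLocallyAnalytic L fun a => ρ a (ρ g e)
  simpa using this

/-- The space `Π^an`, which carries a topology finer than that of a subspace of `Π`. -/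
def AnalyticVectors (ρ : Representation L (GL (Fin n) ℚ_[p]) E) : Type v :=
  analyticSubmodule ρ

variable (ρ : Representation L (GL (Fin n) ℚ_[p]) E)

instance : AddCommGroup (AnalyticVectors ρ) :=
  inferInstanceAs (AddCommGroup (analyticSubmodule ρ))

instance : Module L (AnalyticVectors ρ) :=
  inferInstanceAs (Module L (analyticSubmodule ρ))

/-- The inclusion `Π^an → Π`. -/
def AnalyticVectors.incl : AnalyticVectors ρ →ₗ[L] E := (analyticSubmodule ρ).subtype

/-- The action of `GL_n(ℚ_p)` on `Π^an`. -/
def analyticRep : Representation L (GL (Fin n) ℚ_[p]) (AnalyticVectors ρ) where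
  toFun g := (ρ g).restrict (analyticSubmodule_stable ρ g)
  map_one' := by
    apply LinearMap.ext
    intro a
    apply Subtype.ext
    simp only [map_one]
    rfl
  map_mul' g g' := by
    apply LinearMap.ext
    intro a
    apply Subtype.ext
    simp only [map_mul]
    rfl

section Lattices

variable [IsUltrametricDist L]

/-- The trace on each `Π^(h)`, `h ≥ 1`, of the `𝒪_L`-submodule `W` of `Π^an` is open in the Banach
space `Π^(h)`. -/
def IsOpenInEachPiH (W : Submodule (OL L) (AnalyticVectors ρ)) : Prop :=
  ∀ h ≥ 1, ∃ ε : ℝ, 0 < ε ∧ ∀ a : AnalyticVectors ρ,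
    AnalyticVectors.incl ρ a ∈ PiH ρ h → normH ρ h (AnalyticVectors.incl ρ a) ≤ ε → a ∈ W

/-- The topology of `Π^an` as the locally convex inductive limit of the Banach spaces `Π^(h)`:
the `𝒪_L`-submodules whose trace on each `Π^(h)` is open form a basis of neighbourhoods of `0`. -/
instance : TopologicalSpace (AnalyticVectors ρ) where
  IsOpen U := ∀ a ∈ U, ∃ W : Submodule (OL L) (AnalyticVectors ρ),
    IsOpenInEachPiH ρ W ∧ ∀ b ∈ W, a + b ∈ U
  isOpen_univ := fun _ _ => ⟨⊤, fun _ _ => ⟨1, one_pos, fun _ _ _ => Submodule.mem_top⟩,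
    fun _ _ => Set.mem_univ _⟩
  isOpen_inter := by
    rintro U U' hU hU' a ⟨ha, ha'⟩
    obtain ⟨W, hW, h⟩ := hU a ha
    obtain ⟨W', hW', h'⟩ := hU' a ha'
    refine ⟨W ⊓ W', fun k hk => ?_, fun b hb => ⟨h b hb.1, h' b hb.2⟩⟩
    obtain ⟨ε, hε, H₁⟩ := hW k hk
    obtain ⟨ε', hε', H₂⟩ := hW' k hk
    exact ⟨min ε ε', lt_min hε hε', fun b hb hb' =>
      ⟨H₁ b hb (hb'.trans (min_le_left _ _)), H₂ b hb (hb'.trans (min_le_right _ _))⟩⟩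
  isOpen_sUnion := by
    rintro S hS a ⟨U, hU, ha⟩
    obtain ⟨W, hW, h⟩ := hS U hU a ha
    exact ⟨W, hW, fun b hb => ⟨U, hU, h b hb⟩⟩

/-- The `𝒪_L`-submodule `M = ∑_g g Π_0^(h)` of `Π^an`, where `Π_0^(h)` is the unit ball of `Π^(h)`
for the norm `‖·‖_h` (the span of the union of the `g Π_0^(h)`). -/
def latticeM (h : ℕ) : Submodule (OL L) (AnalyticVectors ρ) :=
  Submodule.span (OL L) {a | ∃ (g : GL (Fin n) ℚ_[p]) (b : AnalyticVectors ρ),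
    AnalyticVectors.incl ρ b ∈ PiH ρ h ∧ normH ρ h (AnalyticVectors.incl ρ b) ≤ 1 ∧
    a = analyticRep ρ g b}

lemma latticeM_stable (h : ℕ) (g : GL (Fin n) ℚ_[p]) :
    ∀ a ∈ latticeM ρ h, analyticRep ρ g a ∈ latticeM ρ h := by
  intro a ha
  refine Submodule.span_induction (p := fun a _ => analyticRep ρ g a ∈ latticeM ρ h)
    ?_ ?_ ?_ ?_ ha
  · rintro _ ⟨g', b, hb, hb', rfl⟩
    refine Submodule.subset_span ⟨g * g', b, hb, hb', ?_⟩
    rw [map_mul]; rfl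
  · rw [map_zero]; exact Submodule.zero_mem _
  · intro a b _ _ ha hb
    rw [map_add]; exact Submodule.add_mem _ ha hb
  · intro c a _ ha
    have : analyticRep ρ g (c • a) = c • analyticRep ρ g a :=
      (analyticRep ρ g).map_smul (c : L) a
    rw [this]; exact Submodule.smul_mem _ c ha

end Lattices

end Banach

end GLn

end

end UnitaryCompletion

/-!
An equivariant map from `Π^an` to a unitary Banach representation that is continuous, hence bounded
on the unit ball of `Π^(h)`, is bounded by the same constant on all its translates, hence on the
lattice `M`, and extends to the completion with respect to `M`. What has to be seen is that `M` is
open. By coherence `Π^(h+k)` is the sum of the `g Π^(h)` with `d(g,1) ≤ k`; these subspaces depend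
only on `g H`, so there are countably many of them. By Baire and the open mapping theorem finitely
many already suffice, and the sum of the translates of the unit ball of `Π^(h)` by these finitely
many `g` contains a ball of `Π^(h+k)`.

The identity `Π^an = ⋃ Π^(h)` compares two expansions of an orbit map near `1`. If it is analytic,
its finite differences in the direction of `h_ij` decay geometrically, and these are the
`(h_ij - 1)^k v`; the group ring of `H` being equicontinuous, this gives the decay of all `b^α v`.
Conversely, the Mahler series `∑_α binom(x, α) b^α v`, which computes `∏ h_ij^(x_ij) v` for natural
numbers `x_ij`, converges to an analytic function of the `p`-adic numbers `x_ij` close to `0`, and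
these are analytic coordinates on `GL_n(ℚ_p)` near `1`.
-/

namespace UnitaryCompletion

noncomputable section

/-! ### Lattices and their gauges -/

section Gauge

variable {L : Type u} [NormedField L] [IsUltrametricDist L]

lemma mem_OL {c : L} : c ∈ OL L ↔ ‖c‖ ≤ 1 := by
  rw [Valuation.mem_integer_iff, NormedField.valuation_apply]
  exact Iff.rfl

instance isFractionRing_OL : IsFractionRing (OL L) L :=
  (Valuation.integer.integers (NormedField.valuation (K := L))).isFractionRing

variable {W : Type v} [AddCommGroup W] [Module L W] {Λ : Submodule (OL L) W}

lemma smul_mem_of_norm_le_one {c : L} (hc : ‖c‖ ≤ 1) {a : W} (ha : a ∈ Λ) : c • a ∈ Λ :=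
  Λ.smul_mem ⟨c, mem_OL.2 hc⟩ ha

lemma exists_mem_smul_eq_smul {c d : L} (h : ‖c‖ ≤ ‖d‖) {a : W} (ha : a ∈ Λ) :
    ∃ b ∈ Λ, d • b = c • a := by
  rcases eq_or_ne d 0 with rfl | hd
  · have hc : c = 0 := by simpa using h
    exact ⟨a, ha, by rw [hc]⟩
  · refine ⟨(d⁻¹ * c) • a, smul_mem_of_norm_le_one ?_ ha, by
      rw [smul_smul, mul_inv_cancel_left₀ hd]⟩
    rw [norm_mul, norm_inv]
    exact inv_mul_le_one_of_le₀ h (norm_nonneg _)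

lemma exists_mem_smul_add_smul_eq {c d : L} {a b : W} (ha : a ∈ Λ) (hb : b ∈ Λ) :
    ∃ e : L, ∃ z ∈ Λ, e • z = c • a + d • b ∧ ‖e‖ = max ‖c‖ ‖d‖ := by
  rcases le_total ‖c‖ ‖d‖ with h | h
  · obtain ⟨a', ha', h'⟩ := exists_mem_smul_eq_smul h ha
    exact ⟨d, a' + b, Λ.add_mem ha' hb, by rw [smul_add, h'], (max_eq_right h).symm⟩
  · obtain ⟨b', hb', h'⟩ := exists_mem_smul_eq_smul h hb
    exact ⟨c, a + b', Λ.add_mem ha hb', by rw [smul_add, h'], (max_eq_left h).symm⟩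

lemma exists_mem_smul_eq (hΛ : Submodule.span L (Λ : Set W) = ⊤) (a : W) :
    ∃ c : L, ∃ z ∈ Λ, c • z = a := by
  have ha : a ∈ Submodule.span L (Λ : Set W) := hΛ ▸ Submodule.mem_top
  induction ha using Submodule.span_induction with
  | mem a ha => exact ⟨1, a, ha, one_smul L a⟩
  | zero => exact ⟨0, 0, Λ.zero_mem, smul_zero 0⟩
  | add a b _ _ iha ihb =>
    obtain ⟨c, z, hz, rfl⟩ := iha
    obtain ⟨d, y, hy, rfl⟩ := ihb
    obtain ⟨e, x, hx, h, -⟩ := exists_mem_smul_add_smul_eq hz hy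
    exact ⟨e, x, hx, h⟩
  | smul d a _ ih =>
    obtain ⟨c, z, hz, rfl⟩ := ih
    exact ⟨d * c, z, hz, mul_smul d c z⟩

/-- The gauge of an `𝒪_L`-submodule `Λ`: the infimum of the `‖c‖` with `a ∈ c Λ`. It is a
norm-like function as soon as `Λ` spans the space. -/
def latticeGauge (Λ : Submodule (OL L) W) (a : W) : ℝ :=
  sInf {r : ℝ | ∃ c : L, ∃ z ∈ Λ, c • z = a ∧ ‖c‖ = r}

lemma latticeGauge_nonneg (Λ : Submodule (OL L) W) (a : W) : 0 ≤ latticeGauge Λ a :=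
  Real.sInf_nonneg (by rintro _ ⟨c, -, -, -, rfl⟩; exact norm_nonneg c)

lemma latticeGauge_smul_le_norm (c : L) {z : W} (hz : z ∈ Λ) : latticeGauge Λ (c • z) ≤ ‖c‖ :=
  csInf_le ⟨0, by rintro _ ⟨c, -, -, -, rfl⟩; exact norm_nonneg c⟩ ⟨c, z, hz, rfl, rfl⟩

lemma latticeGauge_zero : latticeGauge Λ 0 = 0 :=
  le_antisymm (by simpa using latticeGauge_smul_le_norm (0 : L) Λ.zero_mem)
    (latticeGauge_nonneg _ _)

lemma le_latticeGauge (hΛ : Submodule.span L (Λ : Set W) = ⊤) {a : W} {r : ℝ}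
    (h : ∀ c : L, ∀ z ∈ Λ, c • z = a → r ≤ ‖c‖) : r ≤ latticeGauge Λ a := by
  obtain ⟨c, z, hz, hcz⟩ := exists_mem_smul_eq hΛ a
  refine le_csInf ⟨_, c, z, hz, hcz, rfl⟩ ?_
  rintro _ ⟨c, z, hz, hcz, rfl⟩
  exact h c z hz hcz

lemma exists_mem_smul_eq_of_latticeGauge_lt (hΛ : Submodule.span L (Λ : Set W) = ⊤) {a : W}
    {r : ℝ} (h : latticeGauge Λ a < r) : ∃ c : L, ∃ z ∈ Λ, c • z = a ∧ ‖c‖ < r := by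
  by_contra! H
  exact h.not_ge (le_latticeGauge hΛ H)

lemma exists_mem_smul_eq_of_latticeGauge_lt_norm (hΛ : Submodule.span L (Λ : Set W) = ⊤) {a : W}
    {c : L} (h : latticeGauge Λ a < ‖c‖) : ∃ z ∈ Λ, c • z = a := by
  obtain ⟨d, z, hz, rfl, hd⟩ := exists_mem_smul_eq_of_latticeGauge_lt hΛ h
  exact exists_mem_smul_eq_smul hd.le hz

lemma latticeGauge_add_le_max (hΛ : Submodule.span L (Λ : Set W) = ⊤) (a b : W) :
    latticeGauge Λ (a + b) ≤ max (latticeGauge Λ a) (latticeGauge Λ b) := by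
  refine le_of_forall_gt_imp_ge_of_dense fun r hr => ?_
  obtain ⟨ha, hb⟩ := max_lt_iff.1 hr
  obtain ⟨c, z, hz, rfl, hc⟩ := exists_mem_smul_eq_of_latticeGauge_lt hΛ ha
  obtain ⟨d, y, hy, rfl, hd⟩ := exists_mem_smul_eq_of_latticeGauge_lt hΛ hb
  obtain ⟨e, x, hx, h, he⟩ := exists_mem_smul_add_smul_eq (c := c) (d := d) hz hy
  rw [← h]
  exact (latticeGauge_smul_le_norm e hx).trans (he.trans_le (max_le hc.le hd.le))

lemma latticeGauge_smul_le (hΛ : Submodule.span L (Λ : Set W) = ⊤) (c : L) (a : W) :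
    latticeGauge Λ (c • a) ≤ ‖c‖ * latticeGauge Λ a := by
  rcases eq_or_ne c 0 with rfl | hc
  · simp [latticeGauge_zero]
  · have hc' : 0 < ‖c‖ := norm_pos_iff.2 hc
    rw [← div_le_iff₀' hc']
    refine le_latticeGauge hΛ ?_
    rintro d z hz rfl
    rw [div_le_iff₀' hc', ← norm_mul, smul_smul]
    exact latticeGauge_smul_le_norm _ hz

/-- The gauge of a spanning `𝒪_L`-submodule as a seminorm. -/
def latticeSeminorm (hΛ : Submodule.span L (Λ : Set W) = ⊤) : Seminorm L W :=
  Seminorm.ofSMulLE (latticeGauge Λ) latticeGauge_zero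
    (fun a b => (latticeGauge_add_le_max hΛ a b).trans
      (max_le_add_of_nonneg (latticeGauge_nonneg Λ a) (latticeGauge_nonneg Λ b)))
    (latticeGauge_smul_le hΛ)

lemma latticeGauge_map_le (hΛ : Submodule.span L (Λ : Set W) = ⊤) {W' : Type w} [AddCommGroup W']
    [Module L W'] {Λ' : Submodule (OL L) W'} (f : W →ₗ[L] W') (hf : ∀ a ∈ Λ, f a ∈ Λ') (a : W) :
    latticeGauge Λ' (f a) ≤ latticeGauge Λ a := by
  refine le_latticeGauge hΛ ?_
  rintro c z hz rfl
  rw [map_smul]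
  exact latticeGauge_smul_le_norm c (hf z hz)

lemma latticeGauge_rep (hΛ : Submodule.span L (Λ : Set W) = ⊤) {G : Type x} [Group G]
    (σ : Representation L G W) (hσ : ∀ g : G, ∀ a ∈ Λ, σ g a ∈ Λ) (g : G) (a : W) :
    latticeGauge Λ (σ g a) = latticeGauge Λ a := by
  refine le_antisymm (latticeGauge_map_le hΛ (σ g) (hσ g) a) ?_
  simpa using latticeGauge_map_le hΛ (σ g⁻¹) (hσ g⁻¹) (σ g a)

end Gauge

section PrimeNorm

variable {p : ℕ} [Fact p.Prime] {L : Type u} [NormedField L] [NormedAlgebra ℚ_[p] L]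

variable (p L) in
lemma norm_natCast_prime : ‖(p : L)‖ = (p : ℝ)⁻¹ := by
  rw [← map_natCast (algebraMap ℚ_[p] L), norm_algebraMap', Padic.norm_p]

variable (p L) in
lemma natCast_prime_ne_zero : (p : L) ≠ 0 := by
  rw [← norm_ne_zero_iff, norm_natCast_prime]
  exact inv_ne_zero (Nat.cast_ne_zero.2 (Fact.out : p.Prime).ne_zero)

variable (p L) in
lemma norm_natCast_prime_lt_one : ‖(p : L)‖ < 1 := by
  rw [norm_natCast_prime]
  exact inv_lt_one_of_one_lt₀ (Nat.one_lt_cast.2 (Fact.out : p.Prime).one_lt)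

variable (p L) in
lemma tendsto_natCast_prime_pow : Tendsto (fun k : ℕ => (p : L) ^ k) atTop (𝓝 0) :=
  tendsto_pow_atTop_nhds_zero_of_norm_lt_one (norm_natCast_prime_lt_one p L)

lemma exists_natCast_prime_pow_smul_mem [IsUltrametricDist L] {W : Type v} [AddCommGroup W]
    [Module L W] {Λ : Submodule (OL L) W} (hΛ : Submodule.span L (Λ : Set W) = ⊤) (a : W) :
    ∃ k : ℕ, (p : L) ^ k • a ∈ Λ := by
  obtain ⟨c, z, hz, rfl⟩ := exists_mem_smul_eq hΛ a
  have hlim : Tendsto (fun k : ℕ => ‖(p : L) ^ k * c‖) atTop (𝓝 0) := by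
    simpa using ((tendsto_natCast_prime_pow p L).mul_const c).norm
  obtain ⟨k, hk⟩ := (hlim.eventually (gt_mem_nhds one_pos)).exists
  exact ⟨k, by rw [smul_smul]; exact smul_mem_of_norm_le_one hk.le hz⟩

end PrimeNorm

section Banach

variable {L : Type u} [NormedField L]

/-- The normed group structure of a topological vector space whose topology is defined by the
norm `N`; the topology is unchanged. -/
abbrev normedAddCommGroupOfSeminorm {W : Type v} [AddCommGroup W] [Module L W]
    [T : TopologicalSpace W] {N : Seminorm L W} (hzero : ∀ a, N a = 0 → a = 0)
    (hopen : ∀ U : Set W, IsOpen U ↔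
      ∀ a ∈ U, ∃ ε : ℝ, 0 < ε ∧ ∀ b : W, N (b - a) < ε → b ∈ U) :
    NormedAddCommGroup W :=
  letI : Norm W := ⟨N⟩
  have core : NormedSpace.Core L W :=
    { norm_nonneg := apply_nonneg N
      norm_smul := map_smul_eq_mul N
      norm_triangle := map_add_le_add N
      norm_eq_zero_iff := fun a => ⟨hzero a, fun h => h ▸ map_zero N⟩ }
  NormedAddCommGroup.ofCoreReplaceTopology core <| by
    let := SeminormedAddCommGroup.ofCore core.toCore
    refine TopologicalSpace.ext_iff.2 fun U => (hopen U).trans ?_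
    refine Iff.trans ?_ Metric.isOpen_iff.symm
    refine forall₂_congr fun a _ => exists_congr fun ε => and_congr_right fun _ => ?_
    exact forall_congr' fun b => by rw [Metric.mem_ball, dist_eq_norm]; rfl

lemma completeSpace_of_norm_sub_tendsto {W : Type v} [NormedAddCommGroup W]
    (h : ∀ s : ℕ → W, (∀ ε : ℝ, 0 < ε → ∃ k : ℕ, ∀ i ≥ k, ∀ j ≥ k, ‖s i - s j‖ < ε) →
      ∃ a : W, Tendsto (fun i => ‖s i - a‖) atTop (𝓝 0)) : CompleteSpace W := by
  refine Metric.complete_of_cauchySeq_tendsto fun s hs => ?_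
  obtain ⟨a, ha⟩ := h s fun ε hε => by
    simpa only [dist_eq_norm] using Metric.cauchySeq_iff.1 hs ε hε
  exact ⟨a, tendsto_iff_norm_sub_tendsto_zero.2 ha⟩

variable {G : Type x} [Group G] [TopologicalSpace G]

lemma IsUnitaryBanachRep.of_norm {W : Type v} [NormedAddCommGroup W] [NormedSpace L W]
    [IsUltrametricDist W] [CompleteSpace W] {σ : Representation L G W}
    (hcont : Continuous fun z : G × W => σ z.1 z.2) (hnorm : ∀ g a, ‖σ g a‖ = ‖a‖) :
    IsUnitaryBanachRep σ where
  continuous_action := hcont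
  exists_norm := by
    refine ⟨normSeminorm L W, IsUltrametricDist.norm_add_le_max, fun a ha => norm_eq_zero.1 ha,
      fun U => ?_, fun s hs => ?_, hnorm⟩
    · simp only [Metric.isOpen_iff, Set.subset_def, Metric.mem_ball, dist_eq_norm, gt_iff_lt,
        coe_normSeminorm]
    · have hs' : CauchySeq s :=
        Metric.cauchySeq_iff.2 (by simpa only [dist_eq_norm, coe_normSeminorm] using hs)
      obtain ⟨a, ha⟩ := cauchySeq_tendsto_of_complete hs'
      exact ⟨a, tendsto_iff_norm_sub_tendsto_zero.1 ha⟩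

lemma tendsto_apply_one_of_dense {W : Type v} [NormedAddCommGroup W] [NormedSpace L W]
    {σ : Representation L G W} (hnorm : ∀ g a, ‖σ g a‖ = ‖a‖) {D : Set W} (hD : Dense D)
    (hσ : ∀ a ∈ D, Tendsto (fun g => σ g a) (𝓝 1) (𝓝 a)) (a : W) :
    Tendsto (fun g => σ g a) (𝓝 1) (𝓝 a) := by
  refine Metric.tendsto_nhds.2 fun ε hε => ?_
  obtain ⟨b, hb, hab⟩ := hD.exists_dist_lt a (by positivity : 0 < ε / 3)
  filter_upwards [Metric.tendsto_nhds.1 (hσ b hb) (ε / 3) (by positivity)] with g hg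
  have hgab : dist (σ g a) (σ g b) = dist a b := by
    rw [dist_eq_norm, ← map_sub, hnorm, dist_eq_norm]
  calc dist (σ g a) a ≤ dist (σ g a) (σ g b) + dist (σ g b) b + dist b a := dist_triangle4 ..
    _ < ε / 3 + ε / 3 + ε / 3 := by rw [hgab, dist_comm b a]; gcongr
    _ = ε := by ring

lemma continuous_action_of_dense [IsTopologicalGroup G] {W : Type v} [NormedAddCommGroup W]
    [NormedSpace L W] {σ : Representation L G W} (hnorm : ∀ g a, ‖σ g a‖ = ‖a‖) {D : Set W}
    (hD : Dense D) (hσ : ∀ a ∈ D, Tendsto (fun g => σ g a) (𝓝 1) (𝓝 a)) :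
    Continuous fun z : G × W => σ z.1 z.2 := by
  refine continuous_iff_continuousAt.2 fun ⟨g, a⟩ => ?_
  have hg : Tendsto (fun z : G × W => g⁻¹ * z.1) (𝓝 (g, a)) (𝓝 1) := by
    have : Continuous fun z : G × W => g⁻¹ * z.1 := by fun_prop
    simpa using this.tendsto (g, a)
  have hlim : Tendsto (fun z : G × W => ‖σ (g⁻¹ * z.1) a - a‖ + ‖z.2 - a‖) (𝓝 (g, a)) (𝓝 0) := by
    have h₁ := ((tendsto_apply_one_of_dense hnorm hD hσ a).comp hg).sub_const a
    have h₂ : Tendsto (fun z : G × W => z.2 - a) (𝓝 (g, a)) (𝓝 (a - a)) :=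
      (continuous_snd.tendsto (g, a)).sub_const a
    simpa using h₁.norm.add h₂.norm
  refine tendsto_iff_norm_sub_tendsto_zero.2
    (squeeze_zero (fun _ => norm_nonneg _) (fun z => ?_) hlim)
  have hz : σ z.1 z.2 - σ g a = σ g (σ (g⁻¹ * z.1) a - a) + σ z.1 (z.2 - a) := by
    rw [map_sub, map_sub, ← Module.End.mul_apply, ← map_mul, mul_inv_cancel_left]
    abel
  rw [hz]
  exact (norm_add_le _ _).trans_eq (by rw [hnorm, hnorm])

theorem isUniversalUnitaryCompletion_of_norm_le {V : Type v} [AddCommGroup V] [Module L V]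
    [TopologicalSpace V] {W : Type y} [NormedAddCommGroup W] [NormedSpace L W]
    {τ : Representation L G V} {σ : Representation L G W} {ι : V →L[L] W}
    (hσ : IsUnitaryBanachRep σ) (hdense : DenseRange ι)
    (hequiv : ∀ g a, ι (τ g a) = σ g (ι a))
    (hbound : ∀ (B : Type w) [NormedAddCommGroup B] [NormedSpace L B] [IsUltrametricDist B]
      (β : Representation L G B), (∀ g b, ‖β g b‖ = ‖b‖) →
      ∀ f : V →L[L] B, (∀ g a, f (τ g a) = β g (f a)) → ∃ C, ∀ a, ‖f a‖ ≤ C * ‖ι a‖) :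
    IsUniversalUnitaryCompletion.{u, v, w} τ σ ι where
  unitary := hσ
  equivariant := hequiv
  universal B _ _ _ β hβ f hf := by
    obtain ⟨N, hadd, hzero, hopen, hcomplete, hinv⟩ := hβ.exists_norm
    let : NormedAddCommGroup B := normedAddCommGroupOfSeminorm hzero hopen
    let : NormedSpace L B := ⟨fun c b => (map_smul_eq_mul N c b).le⟩
    have : IsUltrametricDist B :=
      IsUltrametricDist.isUltrametricDist_of_forall_norm_add_le_max_norm hadd
    have : CompleteSpace B := completeSpace_of_norm_sub_tendsto hcomplete
    have hσc (g : G) : Continuous (σ g) :=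
      hσ.continuous_action.comp (by fun_prop : Continuous (g, ·))
    have hβc (g : G) : Continuous (β g) :=
      hβ.continuous_action.comp (by fun_prop : Continuous (g, ·))
    let F : W →L[L] B := f.toLinearMap.extendOfNorm ι.toLinearMap
    have hF (a : V) : F (ι a) = f a := LinearMap.extendOfNorm_eq hdense (hbound B β hinv f hf) a
    refine ⟨F, ⟨fun g => congrFun (hdense.equalizer (F.continuous.comp (hσc g))
      ((hβc g).comp F.continuous) (funext fun a => ?_)), hF⟩, fun F' hF' => ?_⟩
    · change F (σ g (ι a)) = β g (F (ι a))
      rw [← hequiv, hF, hF, hf]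
    · refine ContinuousLinearMap.ext (congrFun (hdense.equalizer F'.continuous F.continuous ?_))
      exact funext fun a => (hF'.2 a).trans (hF a).symm

end Banach

/-! ### The completion with respect to a lattice -/

section AdicCompletion

variable {R : Type u} [CommRing R] {x : R} {N : Type v} [AddCommGroup N] [Module R N]

lemma mem_span_singleton_pow_smul_top {k : ℕ} {a : N} :
    a ∈ (Ideal.span {x} ^ k • ⊤ : Submodule R N) ↔ ∃ b : N, x ^ k • b = a := by
  rw [Ideal.span_singleton_pow, Submodule.ideal_span_singleton_smul,
    Submodule.mem_smul_pointwise_iff_exists]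
  simp

lemma adicCompletion_eval_eq_zero_iff {k : ℕ} {z : AdicCompletion (Ideal.span {x}) N} :
    AdicCompletion.eval _ N k z = 0 ↔ ∃ y, x ^ k • y = z := by
  rw [← mem_span_singleton_pow_smul_top, ← LinearMap.mem_ker,
    AdicCompletion.pow_smul_top_eq_ker_eval ⟨{x}, by simp⟩]

lemma isSMulRegular_adicCompletion (hx : IsSMulRegular N x) :
    IsSMulRegular (AdicCompletion (Ideal.span {x}) N) x := by
  refine .of_right_eq_zero_of_smul fun z hz =>
    AdicCompletion.ext fun k => ?_
  obtain ⟨a, ha⟩ := Submodule.Quotient.mk_surjective _ (z.val (k + 1))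
  have hxa : x • z.val (k + 1) = 0 := by rw [← AdicCompletion.val_smul_apply, hz]; rfl
  rw [← ha, ← Submodule.Quotient.mk_smul, Submodule.Quotient.mk_eq_zero,
    mem_span_singleton_pow_smul_top] at hxa
  obtain ⟨b, hb⟩ := hxa
  have hba : x ^ k • b = a := hx (by dsimp only; rw [← hb, pow_succ', mul_smul])
  rw [← z.prop (Nat.le_succ k), ← ha]
  exact (Submodule.Quotient.mk_eq_zero _).2 (mem_span_singleton_pow_smul_top.2 ⟨b, hba⟩)

end AdicCompletion

section BaseChange

variable {L : Type u} [NormedField L] [IsUltrametricDist L] {V : Type v} [AddCommGroup V]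
  [Module L V] {M : Submodule (OL L) V}

lemma isBaseChange_subtype (hM : Submodule.span L (M : Set V) = ⊤) :
    IsBaseChange L M.subtype := by
  refine (isLocalizedModule_iff_isBaseChange (nonZeroDivisors (OL L)) L _).1
    { map_units := fun c => ?_, surj := fun v => ?_, exists_of_eq := fun h => ?_ }
  · have hc : ((c : OL L) : L) ≠ 0 := fun h => nonZeroDivisors.coe_ne_zero c (Subtype.ext h)
    refine (Module.End.isUnit_iff _).2 ⟨smul_right_injective V hc, fun v => ?_⟩
    exact ⟨((c : OL L) : L)⁻¹ • v, smul_inv_smul₀ hc v⟩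
  · obtain ⟨c, z, hz, rfl⟩ := exists_mem_smul_eq hM v
    obtain ⟨a, d, hd, rfl⟩ := IsFractionRing.div_surjective (A := OL L) c
    refine ⟨⟨a • ⟨z, hz⟩, ⟨d, hd⟩⟩, ?_⟩
    have hd' : (d : L) ≠ 0 := fun h => nonZeroDivisors.ne_zero hd (Subtype.ext h)
    change (d : L) • ((a : L) / (d : L)) • z = (a : L) • z
    rw [smul_smul, mul_div_cancel₀ _ hd']
  · exact ⟨1, by rw [Subtype.ext h]⟩

end BaseChange

namespace LatticeCompletion

section Integral

variable {p : ℕ} {L : Type u} [NormedField L] [IsUltrametricDist L] {V : Type v}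
  [AddCommGroup V] [Module L V] {M : Submodule (OL L) V}

variable (p M) in
/-- The map `int` from `lim_k M / p^k M` to the completion, as an `𝒪_L`-linear map. -/
def intHom : AdicCompletion (idealP p L) M →ₗ[OL L] LatticeCompletion p M where
  toFun := int p M
  map_add' := map_add (ofInt p M)
  map_smul' := map_smul (ofInt p M)

lemma int_sub (y z : AdicCompletion (idealP p L) M) : int p M (y - z) = int p M y - int p M z :=
  map_sub (intHom p M) y z

variable (p M) in
/-- The unit ball `lim_k M / p^k M` of the completion. -/
def intLattice : Submodule (OL L) (LatticeCompletion p M) :=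
  LinearMap.range (intHom p M)

lemma int_mem_intLattice (z : AdicCompletion (idealP p L) M) : int p M z ∈ intLattice p M :=
  ⟨z, rfl⟩

lemma isBaseChange_intHom : IsBaseChange L (intHom p M) :=
  TensorProduct.isBaseChange (OL L) (AdicCompletion (idealP p L) M) L

variable (p M) in
lemma span_intLattice :
    Submodule.span L (intLattice p M : Set (LatticeCompletion p M)) = ⊤ := by
  refine Submodule.eq_top_iff'.2 fun a => ?_
  induction a using isBaseChange_intHom.inductionOn with
  | zero => exact Submodule.zero_mem _
  | tmul z => exact Submodule.subset_span (int_mem_intLattice z)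
  | smul c a ha => exact Submodule.smul_mem _ c ha
  | add a b ha hb => exact Submodule.add_mem _ ha hb

lemma exists_int_eq_of_latticeGauge_lt {k : ℕ} {a : LatticeCompletion p M}
    (h : latticeGauge (intLattice p M) a < ‖(p : L)‖ ^ k) :
    ∃ z, int p M ((p : OL L) ^ k • z) = a := by
  rw [← norm_pow] at h
  obtain ⟨_, ⟨z, rfl⟩, hz⟩ := exists_mem_smul_eq_of_latticeGauge_lt_norm (span_intLattice p M) h
  exact ⟨z, (int_pow_smul p M k z).trans hz⟩

lemma latticeGauge_int_pow_smul_le (k : ℕ) (z : AdicCompletion (idealP p L) M) :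
    latticeGauge (intLattice p M) (int p M ((p : OL L) ^ k • z)) ≤ ‖(p : L)‖ ^ k := by
  rw [int_pow_smul, ← norm_pow]
  exact latticeGauge_smul_le_norm _ (int_mem_intLattice z)

lemma rep_mem_intLattice {G : Type x} [Group G] (τ : Representation L G V)
    (hτ : ∀ g : G, ∀ a ∈ M, τ g a ∈ M) (g : G) :
    ∀ a ∈ intLattice p M, latticeCompletionRep p M τ hτ g a ∈ intLattice p M := by
  rintro _ ⟨z, rfl⟩
  exact int_mem_intLattice (AdicCompletion.map (idealP p L) (latticeAction M τ hτ g) z)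

end Integral

section Norm

variable {p : ℕ} [Fact p.Prime] {L : Type u} [NormedField L] [NormedAlgebra ℚ_[p] L]
  [IsUltrametricDist L] {V : Type v} [AddCommGroup V] [Module L V] {M : Submodule (OL L) V}

lemma int_injective : Function.Injective (int p M) := by
  have : IsLocalizedModule (nonZeroDivisors (OL L)) (intHom p M) :=
    (isLocalizedModule_iff_isBaseChange _ L _).2 isBaseChange_intHom
  intro y z hyz
  obtain ⟨c, hc⟩ := (IsLocalizedModule.eq_iff_exists (nonZeroDivisors (OL L)) (intHom p M)).1 hyz
  obtain ⟨k, b, hb⟩ : ∃ k : ℕ, ∃ b : OL L, (p : OL L) ^ k = b * c := by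
    have hc0 : ((c : OL L) : L) ≠ 0 := fun h => nonZeroDivisors.coe_ne_zero c (Subtype.ext h)
    obtain ⟨k, hk⟩ := exists_pow_lt_of_lt_one (norm_pos_iff.2 hc0) (norm_natCast_prime_lt_one p L)
    refine ⟨k, ⟨(p : L) ^ k / (c : OL L), mem_OL.2 ?_⟩, Subtype.ext ?_⟩
    · rw [norm_div, norm_pow]
      exact div_le_one_of_le₀ hk.le (norm_nonneg _)
    · change ((p : OL L) ^ k : OL L).1 = (p : L) ^ k / (c : OL L) * (c : OL L)
      rw [div_mul_cancel₀ _ hc0]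
      simp
  have hreg : IsSMulRegular M (p : OL L) := fun a b hab =>
    Subtype.ext (smul_right_injective V (natCast_prime_ne_zero p L) (congrArg Subtype.val hab))
  refine (isSMulRegular_adicCompletion hreg).pow k ?_
  change (p : OL L) ^ k • y = (p : OL L) ^ k • z
  rw [hb, mul_smul, mul_smul]
  exact congrArg (b • ·) hc

lemma isOpen_iff_latticeGauge {U : Set (LatticeCompletion p M)} :
    IsOpen U ↔ ∀ a ∈ U, ∃ ε : ℝ, 0 < ε ∧
      ∀ b, latticeGauge (intLattice p M) (b - a) < ε → b ∈ U := by
  refine forall₂_congr fun a _ => ⟨fun ⟨k, hk⟩ => ?_, fun ⟨ε, hε, h⟩ => ?_⟩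
  · refine ⟨‖(p : L)‖ ^ k, pow_pos (norm_pos_iff.2 (natCast_prime_ne_zero p L)) k, fun b hb => ?_⟩
    obtain ⟨z, hz⟩ := exists_int_eq_of_latticeGauge_lt hb
    have := hk z
    rwa [← int_pow_smul, hz, add_sub_cancel] at this
  · obtain ⟨k, hk⟩ := exists_pow_lt_of_lt_one hε (norm_natCast_prime_lt_one p L)
    refine ⟨k, fun z => h _ ?_⟩
    rw [add_sub_cancel_left, ← int_pow_smul]
    exact (latticeGauge_int_pow_smul_le k z).trans_lt hk

lemma eq_zero_of_latticeGauge_eq_zero {a : LatticeCompletion p M}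
    (ha : latticeGauge (intLattice p M) a = 0) : a = 0 := by
  have hlt (k : ℕ) : latticeGauge (intLattice p M) a < ‖(p : L)‖ ^ k :=
    ha ▸ pow_pos (norm_pos_iff.2 (natCast_prime_ne_zero p L)) k
  obtain ⟨z, rfl⟩ : ∃ z, int p M z = a := by
    obtain ⟨z, hz⟩ := exists_int_eq_of_latticeGauge_lt (hlt 0)
    exact ⟨_, hz⟩
  have hz : z = 0 := AdicCompletion.ext fun k => by
    obtain ⟨y, hy⟩ := exists_int_eq_of_latticeGauge_lt (hlt k)
    exact adicCompletion_eval_eq_zero_iff.2 ⟨y, int_injective hy⟩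
  rw [hz]
  exact map_zero (intHom p M)

instance : NormedAddCommGroup (LatticeCompletion p M) :=
  normedAddCommGroupOfSeminorm (N := latticeSeminorm (span_intLattice p M))
    (fun _ => eq_zero_of_latticeGauge_eq_zero) (fun _ => isOpen_iff_latticeGauge)

lemma norm_def (a : LatticeCompletion p M) : ‖a‖ = latticeGauge (intLattice p M) a := rfl

instance : NormedSpace L (LatticeCompletion p M) :=
  ⟨latticeGauge_smul_le (span_intLattice p M)⟩

instance : IsUltrametricDist (LatticeCompletion p M) :=
  IsUltrametricDist.isUltrametricDist_of_forall_norm_add_le_max_norm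
    (latticeGauge_add_le_max (span_intLattice p M))

instance : CompleteSpace (LatticeCompletion p M) := by
  have hp (k : ℕ) : 0 < ‖(p : L)‖ ^ k := pow_pos (norm_pos_iff.2 (natCast_prime_ne_zero p L)) k
  refine Metric.complete_of_convergent_controlled_sequences (fun k => ‖(p : L)‖ ^ k) hp
    fun s hs => ?_
  have hs' (k i j : ℕ) (hi : k ≤ i) (hj : k ≤ j) : ∃ z, int p M ((p : OL L) ^ k • z) = s i - s j :=
    exists_int_eq_of_latticeGauge_lt (by rw [← norm_def, ← dist_eq_norm]; exact hs k i j hi hj)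
  have hs₀ (i : ℕ) : ∃ z, int p M z = s i - s 0 := by
    obtain ⟨z, hz⟩ := hs' 0 i 0 i.zero_le le_rfl
    exact ⟨_, hz⟩
  choose z hz using hs₀
  have hcauchy {k i : ℕ} (hki : k ≤ i) :
      z k ≡ z i [SMOD (idealP p L ^ k • ⊤ : Submodule (OL L) (AdicCompletion (idealP p L) M))] := by
    obtain ⟨y, hy⟩ := hs' k k i le_rfl hki
    refine SModEq.sub_mem.2 (mem_span_singleton_pow_smul_top.2 ⟨y, int_injective ?_⟩)
    rw [hy, int_sub, hz, hz, sub_sub_sub_cancel_right]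
  have hadic : IsAdicComplete (idealP p L) (AdicCompletion (idealP p L) M) :=
    AdicCompletion.isAdicComplete ⟨{(p : OL L)}, by simp [idealP]⟩
  obtain ⟨t, ht⟩ := hadic.toIsPrecomplete.prec hcauchy
  refine ⟨s 0 + int p M t, tendsto_iff_norm_sub_tendsto_zero.2 (squeeze_zero
    (fun _ => norm_nonneg _) (fun k => ?_)
    (tendsto_pow_atTop_nhds_zero_of_lt_one (norm_nonneg _) (norm_natCast_prime_lt_one p L)))⟩
  obtain ⟨y, hy⟩ := mem_span_singleton_pow_smul_top.1 (SModEq.sub_mem.1 (ht k))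
  rw [← sub_sub, ← hz, ← int_sub, ← hy]
  exact latticeGauge_int_pow_smul_le k y

lemma norm_rep {G : Type x} [Group G] (τ : Representation L G V)
    (hτ : ∀ g : G, ∀ a ∈ M, τ g a ∈ M) (g : G) (a : LatticeCompletion p M) :
    ‖latticeCompletionRep p M τ hτ g a‖ = ‖a‖ :=
  latticeGauge_rep (span_intLattice p M) _ (rep_mem_intLattice τ hτ) g a

end Norm

end LatticeCompletion

namespace LatticeCompletion

section OfSpace

variable {p : ℕ} {L : Type u} [NormedField L] [IsUltrametricDist L] {V : Type v}
  [AddCommGroup V] [Module L V] {M : Submodule (OL L) V}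

variable (p) in
/-- The canonical map from `V` to its completion with respect to a lattice `M`, the `L`-linear
extension of `M → lim_k M / p^k M`. -/
def ofSpace (hM : Submodule.span L (M : Set V) = ⊤) : V →ₗ[L] LatticeCompletion p M :=
  (isBaseChange_subtype hM).lift (intHom p M ∘ₗ AdicCompletion.of (idealP p L) M)

variable (hM : Submodule.span L (M : Set V) = ⊤)

lemma ofSpace_coe (a : M) :
    ofSpace p hM a = int p M (AdicCompletion.of (idealP p L) M a) :=
  (isBaseChange_subtype hM).lift_eq _ a

lemma rep_ofSpace {G : Type x} [Group G] (τ : Representation L G V)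
    (hτ : ∀ g : G, ∀ a ∈ M, τ g a ∈ M) (g : G) (v : V) :
    latticeCompletionRep p M τ hτ g (ofSpace p hM v) = ofSpace p hM (τ g v) := by
  obtain ⟨c, a, ha, rfl⟩ := exists_mem_smul_eq hM v
  have hga : ofSpace p hM (τ g a) =
      int p M (AdicCompletion.of _ M (latticeAction M τ hτ g ⟨a, ha⟩)) :=
    ofSpace_coe hM (latticeAction M τ hτ g ⟨a, ha⟩)
  simp only [map_smul]
  rw [hga, ofSpace_coe hM ⟨a, ha⟩, ← AdicCompletion.map_of]
  rfl

end OfSpace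

section Isometry

variable {p : ℕ} [Fact p.Prime] {L : Type u} [NormedField L] [NormedAlgebra ℚ_[p] L]
  [IsUltrametricDist L] {V : Type v} [AddCommGroup V] [Module L V] {M : Submodule (OL L) V}
  (hM : Submodule.span L (M : Set V) = ⊤)

lemma mem_of_ofSpace_mem_intLattice {v : V} (hv : ofSpace p hM v ∈ intLattice p M) : v ∈ M := by
  obtain ⟨z, hz⟩ := hv
  obtain ⟨k, hk⟩ := exists_natCast_prime_pow_smul_mem (p := p) hM v
  have hpz : (p : OL L) ^ k • z = AdicCompletion.of (idealP p L) M ⟨_, hk⟩ := by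
    apply int_injective
    rw [← ofSpace_coe hM, int_pow_smul, map_smul, ← hz]
    rfl
  obtain ⟨b, hb⟩ := mem_span_singleton_pow_smul_top.1 ((Submodule.Quotient.mk_eq_zero _).1
    (adicCompletion_eval_eq_zero_iff.2 ⟨z, hpz⟩))
  have hbv : (p : L) ^ k • (b : V) = (p : L) ^ k • v := by
    simpa [Subring.smul_def] using congrArg Subtype.val hb
  exact smul_right_injective V (pow_ne_zero k (natCast_prime_ne_zero p L)) hbv ▸ b.2

lemma norm_ofSpace (v : V) : ‖ofSpace p hM v‖ = latticeGauge M v := by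
  refine le_antisymm (latticeGauge_map_le hM (ofSpace p hM) (fun a ha => ?_) v)
    (le_latticeGauge (span_intLattice p M) fun c z hz hcz => ?_)
  · rw [ofSpace_coe hM ⟨a, ha⟩]
    exact int_mem_intLattice _
  have hgauge {d : L} (hd : d ≠ 0) (h : d⁻¹ • ofSpace p hM v ∈ intLattice p M) :
      latticeGauge M v ≤ ‖d‖ := by
    rw [← map_smul] at h
    simpa [smul_inv_smul₀ hd] using
      latticeGauge_smul_le_norm d (mem_of_ofSpace_mem_intLattice hM h)
  rcases eq_or_ne c 0 with rfl | hc
  · rw [zero_smul] at hcz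
    have hle (k : ℕ) : latticeGauge M v ≤ ‖(p : L) ^ k‖ :=
      hgauge (pow_ne_zero k (natCast_prime_ne_zero p L))
        (by rw [← hcz, smul_zero]; exact Submodule.zero_mem _)
    exact ge_of_tendsto' (tendsto_natCast_prime_pow p L).norm hle
  · exact hgauge hc (by rwa [← hcz, inv_smul_smul₀ hc])

lemma denseRange_ofSpace : DenseRange (ofSpace p hM) := by
  suffices hΛ : (intLattice p M : Set (LatticeCompletion p M)) ⊆
      (LinearMap.range (ofSpace p hM)).topologicalClosure by
    refine dense_iff_closure_eq.2 (Set.eq_univ_of_univ_subset fun a _ => ?_)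
    have ha : a ∈ Submodule.span L (intLattice p M : Set (LatticeCompletion p M)) :=
      span_intLattice p M ▸ Submodule.mem_top
    exact Submodule.span_le.2 hΛ ha
  rintro _ ⟨z, rfl⟩
  refine Metric.mem_closure_iff.2 fun ε hε => ?_
  obtain ⟨k, hk⟩ := exists_pow_lt_of_lt_one hε (norm_natCast_prime_lt_one p L)
  obtain ⟨a, ha⟩ := Submodule.Quotient.mk_surjective _ (z.val k)
  obtain ⟨y, hy⟩ : ∃ y, (p : OL L) ^ k • y = z - AdicCompletion.of (idealP p L) M a := by
    refine adicCompletion_eval_eq_zero_iff.1 ?_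
    change AdicCompletion.eval (idealP p L) M k (z - _) = 0
    rw [map_sub, AdicCompletion.eval_apply, ← ha]
    exact sub_self _
  refine ⟨ofSpace p hM a, ⟨a, rfl⟩, lt_of_le_of_lt ?_ hk⟩
  rw [dist_eq_norm, ofSpace_coe]
  change ‖int p M z - _‖ ≤ _
  rw [← int_sub, ← hy]
  exact latticeGauge_int_pow_smul_le k y

lemma continuous_ofSpace [TopologicalSpace V] [IsTopologicalAddGroup V] [ContinuousConstSMul L V]
    (hopen : (M : Set V) ∈ 𝓝 0) : Continuous (ofSpace p hM) := by
  refine continuous_of_continuousAt_zero (ofSpace p hM) (Metric.tendsto_nhds.2 fun ε hε => ?_)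
  obtain ⟨k, hk⟩ := exists_pow_lt_of_lt_one hε (norm_natCast_prime_lt_one p L)
  have hlim : Tendsto (fun v : V => ((p : L) ^ k)⁻¹ • v) (𝓝 0) (𝓝 0) := by
    simpa using (continuous_const_smul ((p : L) ^ k)⁻¹).tendsto (0 : V)
  filter_upwards [hlim hopen] with v hv
  have hle := latticeGauge_smul_le_norm ((p : L) ^ k) hv
  rw [smul_inv_smul₀ (pow_ne_zero k (natCast_prime_ne_zero p L)), norm_pow] at hle
  rw [map_zero, dist_zero_right, norm_ofSpace]
  exact hle.trans_lt hk

end Isometry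

end LatticeCompletion

section Universal

variable {L : Type u} [NormedField L] [IsUltrametricDist L] {G : Type x} [Group G]
  {V : Type v} [AddCommGroup V] [Module L V] {M : Submodule (OL L) V}

lemma norm_apply_le_mul_latticeGauge (hM : Submodule.span L (M : Set V) = ⊤) {B : Type w}
    [NormedAddCommGroup B] [NormedSpace L B] (f : V →ₗ[L] B) {C : ℝ} (hC : 0 < C)
    (hf : ∀ a ∈ M, ‖f a‖ ≤ C) (v : V) : ‖f v‖ ≤ C * latticeGauge M v := by
  rw [← div_le_iff₀' hC]
  refine le_latticeGauge hM ?_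
  rintro c a ha rfl
  rw [map_smul, norm_smul, div_le_iff₀ hC]
  exact mul_le_mul_of_nonneg_left (hf a ha) (norm_nonneg c)

lemma norm_apply_le_of_mem_span_translates {τ : Representation L G V} {S : Set V} {B : Type w}
    [NormedAddCommGroup B] [NormedSpace L B] [IsUltrametricDist B] {β : Representation L G B}
    (hβ : ∀ g b, ‖β g b‖ = ‖b‖) {f : V →ₗ[L] B} (hf : ∀ g v, f (τ g v) = β g (f v)) {C : ℝ}
    (hC : 0 ≤ C) (hS : ∀ s ∈ S, ‖f s‖ ≤ C) {a : V}
    (ha : a ∈ Submodule.span (OL L) {a | ∃ g, ∃ s ∈ S, a = τ g s}) : ‖f a‖ ≤ C := by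
  induction ha using Submodule.span_induction with
  | mem a ha =>
    obtain ⟨g, s, hs, rfl⟩ := ha
    rw [hf, hβ]
    exact hS s hs
  | zero => simpa using hC
  | add a b _ _ iha ihb =>
    rw [map_add]
    exact (IsUltrametricDist.norm_add_le_max _ _).trans (max_le iha ihb)
  | smul c a _ ih =>
    have hca : f (c • a) = (c : L) • f a := f.map_smul (c : L) a
    rw [hca, norm_smul]
    exact (mul_le_of_le_one_left (norm_nonneg _) (mem_OL.1 c.2)).trans ih

end Universal

namespace LatticeCompletion

variable {p : ℕ} [Fact p.Prime] {L : Type u} [NontriviallyNormedField L] [NormedAlgebra ℚ_[p] L]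
  [IsUltrametricDist L] {V : Type v} [AddCommGroup V] [Module L V] [TopologicalSpace V]
  [IsTopologicalAddGroup V] [ContinuousConstSMul L V] {M : Submodule (OL L) V}

/-- The canonical map `ofSpace`, as a continuous map when `M` is a neighbourhood of `0`. -/
def ofSpaceL (hM : Submodule.span L (M : Set V) = ⊤) (hopen : (M : Set V) ∈ 𝓝 0) :
    V →L[L] LatticeCompletion p M :=
  ⟨ofSpace p hM, continuous_ofSpace hM hopen⟩

theorem isUniversalUnitaryCompletion_ofSpaceL {G : Type x} [Group G] [TopologicalSpace G]
    [IsTopologicalGroup G] {τ : Representation L G V} (hτ : ∀ g : G, ∀ a ∈ M, τ g a ∈ M)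
    (horbit : ∀ v, Tendsto (fun g => τ g v) (𝓝 1) (𝓝 v))
    (hM : Submodule.span L (M : Set V) = ⊤) (hopen : (M : Set V) ∈ 𝓝 0)
    {S : Set V} (hS : Bornology.IsVonNBounded L S)
    (hMS : M ≤ Submodule.span (OL L) {a | ∃ g, ∃ s ∈ S, a = τ g s}) :
    IsUniversalUnitaryCompletion.{u, v, w} τ (latticeCompletionRep p M τ hτ)
      (ofSpaceL (p := p) hM hopen) := by
  have hdense : DenseRange (ofSpaceL (p := p) hM hopen) := denseRange_ofSpace hM
  have hequiv (g : G) (v : V) : ofSpaceL (p := p) hM hopen (τ g v) =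
      latticeCompletionRep p M τ hτ g (ofSpaceL hM hopen v) := (rep_ofSpace hM τ hτ g v).symm
  have hcont : Continuous fun z : G × LatticeCompletion p M =>
      latticeCompletionRep p M τ hτ z.1 z.2 := by
    refine continuous_action_of_dense (norm_rep τ hτ) hdense ?_
    rintro _ ⟨v, rfl⟩
    exact (((ofSpaceL (p := p) hM hopen).continuous.tendsto v).comp (horbit v)).congr
      fun g => hequiv g v
  refine isUniversalUnitaryCompletion_of_norm_le (.of_norm hcont (norm_rep τ hτ)) hdense hequiv ?_
  intro B _ _ _ β hβ f hf
  obtain ⟨C, hC, hfS⟩ := ((NormedSpace.isVonNBounded_iff L).1 (hS.image f)).exists_pos_norm_le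
  have hfM (a : V) (ha : a ∈ M) : ‖f a‖ ≤ C :=
    norm_apply_le_of_mem_span_translates hβ hf hC.le
      (fun s hs => hfS _ (Set.mem_image_of_mem f hs)) (hMS ha)
  refine ⟨C, fun v => ?_⟩
  exact (norm_apply_le_mul_latticeGauge hM (f : V →ₗ[L] B) hC hfM v).trans_eq
    (congrArg (C * ·) (norm_ofSpace hM v).symm)

end LatticeCompletion

/-! ### The topology of `H` -/

section GLTopology

lemma kappa_pos (p : ℕ) : 0 < kappa p := by
  unfold kappa; split_ifs <;> norm_num

variable {p : ℕ} [Fact p.Prime] {n : ℕ}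

lemma isEmbedding_GL_val {K : Type*} [NormedField K] :
    IsEmbedding (Units.val : GL (Fin n) K → Matrix (Fin n) (Fin n) K) := by
  have hdet : Continuous fun A : Matrix (Fin n) (Fin n) K => A.det :=
    Continuous.matrix_det continuous_id
  have hadj : Continuous fun A : Matrix (Fin n) (Fin n) K => A.adjugate :=
    Continuous.matrix_adjugate continuous_id
  refine Units.isEmbedding_val_mk' (f := fun A => (A.det)⁻¹ • A.adjugate) ?_ fun u => ?_
  · exact ContinuousOn.smul (hdet.continuousOn.inv₀ fun A hA =>
      ((Matrix.isUnit_iff_isUnit_det A).1 hA).ne_zero) hadj.continuousOn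
  · rw [Matrix.coe_units_inv, Matrix.inv_def, Ring.inverse_eq_inv']

lemma one_lt_prime_cast : (1 : ℝ) < p := by exact_mod_cast (Fact.out : p.Prime).one_lt

lemma isUnit_det_of_mapMatrix_toZModPow_eq_one {k : ℕ} (hk : 0 < k)
    {X : Matrix (Fin n) (Fin n) ℤ_[p]}
    (hX : (PadicInt.toZModPow (p := p) k).mapMatrix X = 1) : IsUnit X.det := by
  have : Fact (1 < p ^ k) := ⟨Nat.one_lt_pow hk.ne' (Fact.out : p.Prime).one_lt⟩
  have : IsLocalHom (PadicInt.toZModPow (p := p) k) :=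
    IsLocalHom.of_surjective _ (ZMod.ringHom_surjective _)
  refine isUnit_of_map_unit (PadicInt.toZModPow (p := p) k) _ ?_
  rw [RingHom.map_det, hX, Matrix.det_one]
  exact isUnit_one

lemma mem_H_of_norm_le {g : GL (Fin n) ℚ_[p]}
    (h : ∀ i j, ‖g i j - (1 : Matrix (Fin n) (Fin n) ℚ_[p]) i j‖ ≤ (p : ℝ) ^ (-(kappa p : ℤ))) :
    g ∈ H p n := by
  have hp : (p : ℝ) ^ (-(kappa p : ℤ)) ≤ 1 :=
    zpow_le_one_of_nonpos₀ one_lt_prime_cast.le (by simp)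
  have hentry (i j) : ‖g i j‖ ≤ 1 := by
    rw [← sub_add_cancel (g i j) ((1 : Matrix (Fin n) (Fin n) ℚ_[p]) i j)]
    refine (IsUltrametricDist.norm_add_le_max _ _).trans (max_le ((h i j).trans hp) ?_)
    rw [Matrix.one_apply]
    split_ifs <;> simp
  let X : Matrix (Fin n) (Fin n) ℤ_[p] := fun i j => ⟨g i j, hentry i j⟩
  have hX : (PadicInt.toZModPow (p := p) (kappa p)).mapMatrix X = 1 := by
    rw [← map_one (PadicInt.toZModPow (p := p) (kappa p)).mapMatrix, ← sub_eq_zero, ← map_sub]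
    ext i j
    change PadicInt.toZModPow (kappa p) (X i j - (1 : Matrix (Fin n) (Fin n) ℤ_[p]) i j) = 0
    rw [← RingHom.mem_ker, PadicInt.ker_toZModPow, ← PadicInt.norm_le_pow_iff_mem_span_pow,
      PadicInt.norm_def, PadicInt.coe_sub]
    convert h i j using 3
    by_cases hij : i = j <;> simp [hij, Matrix.one_apply]
  have hdet := isUnit_det_of_mapMatrix_toZModPow_eq_one (kappa_pos p) hX
  exact ⟨Matrix.GeneralLinearGroup.mk'' X hdet, MonoidHom.mem_ker.2 (Units.ext hX), Units.ext rfl⟩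

lemma isOpen_H : IsOpen (H p n : Set (GL (Fin n) ℚ_[p])) := by
  refine Subgroup.isOpen_of_mem_nhds (H p n) (g := 1) ?_
  have hnear (i j : Fin n) : ∀ᶠ g : GL (Fin n) ℚ_[p] in 𝓝 1,
      ‖g i j - (1 : Matrix (Fin n) (Fin n) ℚ_[p]) i j‖ < (p : ℝ) ^ (-(kappa p : ℤ)) := by
    have hc : Continuous fun g : GL (Fin n) ℚ_[p] =>
        ‖g i j - (1 : Matrix (Fin n) (Fin n) ℚ_[p]) i j‖ :=
      ((Units.continuous_val.matrix_elem i j).sub continuous_const).norm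
    refine (hc.tendsto 1).eventually (gt_mem_nhds ?_)
    simp only [Units.val_one, sub_self, norm_zero]
    exact zpow_pos (zero_lt_one.trans one_lt_prime_cast) _
  filter_upwards [eventually_all.2 fun i => eventually_all.2 (hnear i)] with g hg
  exact mem_H_of_norm_le fun i j => (hg i j).le

lemma isCompact_H : IsCompact (H p n : Set (GL (Fin n) ℚ_[p])) := by
  have hc : Continuous (Matrix.GeneralLinearGroup.map (n := Fin n) (algebraMap ℤ_[p] ℚ_[p])) :=
    Continuous.generalLinearGroup_map continuous_subtype_val
  have : CompactSpace (Matrix (Fin n) (Fin n) ℤ_[p]) :=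
    inferInstanceAs (CompactSpace (Fin n → Fin n → ℤ_[p]))
  have : CompactSpace (GL (Fin n) ℤ_[p]) :=
    inferInstanceAs (CompactSpace (Matrix (Fin n) (Fin n) ℤ_[p])ˣ)
  exact (isCompact_range hc).of_isClosed_subset (Subgroup.isClosed_of_isOpen _ isOpen_H)
    (Set.image_subset_range _ _)

lemma generator_mem_H (ij : Fin n × Fin n) : generator p ij ∈ H p n := by
  refine mem_H_of_norm_le fun i j => ?_
  change ‖(1 + Matrix.single ij.1 ij.2 ((p : ℚ_[p]) ^ kappa p) : Matrix (Fin n) (Fin n) ℚ_[p]) i j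
    - (1 : Matrix (Fin n) (Fin n) ℚ_[p]) i j‖ ≤ _
  rw [Matrix.add_apply, add_sub_cancel_left, Matrix.single_apply]
  split_ifs
  · rw [norm_pow, Padic.norm_p, zpow_neg, zpow_natCast, inv_pow]
  · rw [norm_zero]; positivity

lemma dist1_eq_zero {g : GL (Fin n) ℚ_[p]} (hg : g ∈ H p n) : dist1 g = 0 := by
  refine Nat.sInf_eq_zero.2 (Or.inl fun a ha => ?_)
  rw [pow_zero, pow_one]
  exact mul_mem (mul_mem (inv_mem hg) ha) hg

lemma countable_quotient_H : Countable (GL (Fin n) ℚ_[p] ⧸ H p n) := by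
  have : SecondCountableTopology (Matrix (Fin n) (Fin n) ℚ_[p]) :=
    inferInstanceAs (SecondCountableTopology (Fin n → Fin n → ℚ_[p]))
  have : SecondCountableTopology (GL (Fin n) ℚ_[p]) :=
    isEmbedding_GL_val.secondCountableTopology
  have : DiscreteTopology (GL (Fin n) ℚ_[p] ⧸ H p n) := QuotientGroup.discreteTopology isOpen_H
  exact countable_of_Lindelof_of_discrete

end GLTopology

/-! ### An open mapping theorem for countable families -/

section OpenMapping

variable {L : Type*} [NontriviallyNormedField L]
variable {X Y : Type*} [NormedAddCommGroup X] [NormedSpace L X] [NormedAddCommGroup Y]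
  [NormedSpace L Y]

lemma exists_ball_subset_closure_image (T : X →L[L] Y) {R : ℝ}
    (h : (interior (closure (T '' Metric.closedBall 0 R))).Nonempty) :
    ∃ δ > 0, Metric.ball 0 δ ⊆ closure (T '' Metric.closedBall 0 (R + R)) := by
  obtain ⟨y₀, hy₀⟩ := h
  obtain ⟨δ, hδ, hball⟩ := Metric.mem_nhds_iff.1 (mem_interior_iff_mem_nhds.1 hy₀)
  refine ⟨δ, hδ, fun y hy => ?_⟩
  have hy : y₀ + y ∈ closure (T '' Metric.closedBall 0 R) :=
    hball (by simpa [dist_eq_norm] using hy)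
  rw [← add_sub_cancel_left y₀ y]
  refine map_mem_closure₂ continuous_sub hy (interior_subset hy₀) ?_
  rintro _ ⟨x, hx, rfl⟩ _ ⟨x', hx', rfl⟩
  refine ⟨x - x', ?_, map_sub T x x'⟩
  rw [mem_closedBall_zero_iff] at hx hx' ⊢
  exact norm_sub_le_of_le hx hx'

lemma exists_approx_preimage_of_ball_subset_closure_image (T : X →L[L] Y) {δ R : ℝ} (hδ : 0 < δ)
    (h : Metric.ball 0 δ ⊆ closure (T '' Metric.closedBall 0 R)) :
    ∃ C, ∀ y, ∃ x, ‖y - T x‖ ≤ 1 / 2 * ‖y‖ ∧ ‖x‖ ≤ C * ‖y‖ := by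
  obtain ⟨c, hc⟩ := NormedField.exists_one_lt_norm L
  refine ⟨δ⁻¹ * ‖c‖ * R, fun y => ?_⟩
  obtain rfl | hy := eq_or_ne y 0
  · exact ⟨0, by simp⟩
  obtain ⟨d, hd, hdy, -, hdinv⟩ := rescale_to_shell hc hδ hy
  have hd' : 0 < ‖d‖ := norm_pos_iff.2 hd
  obtain ⟨_, ⟨x, hx, rfl⟩, hxy⟩ := Metric.mem_closure_iff.1 (h (mem_ball_zero_iff.2 hdy))
    (‖d‖ * (1 / 2 * ‖y‖)) (by positivity)
  rw [mem_closedBall_zero_iff] at hx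
  refine ⟨d⁻¹ • x, ?_, ?_⟩
  · have : d • (y - T (d⁻¹ • x)) = d • y - T x := by rw [smul_sub, map_smul, smul_inv_smul₀ hd]
    rw [← mul_le_mul_iff_right₀ hd', ← norm_smul, this, ← dist_eq_norm]
    exact hxy.le
  · calc ‖d⁻¹ • x‖ = ‖d‖⁻¹ * ‖x‖ := by rw [norm_smul, norm_inv]
      _ ≤ (δ⁻¹ * ‖c‖ * ‖y‖) * R := by gcongr
      _ = δ⁻¹ * ‖c‖ * R * ‖y‖ := by ring

lemma surjective_of_approx_preimage [CompleteSpace X] (T : X →L[L] Y) {C : ℝ}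
    (h : ∀ y, ∃ x, ‖y - T x‖ ≤ 1 / 2 * ‖y‖ ∧ ‖x‖ ≤ C * ‖y‖) : Function.Surjective T := by
  choose s hs hsC using h
  intro y
  let z : ℕ → Y := fun k => (fun y => y - T (s y))^[k] y
  have hz (k : ℕ) : z (k + 1) = z k - T (s (z k)) := Function.iterate_succ_apply' _ k y
  have hz_le (k : ℕ) : ‖z k‖ ≤ (1 / 2) ^ k * ‖y‖ := by
    induction k with
    | zero => simp [z]
    | succ k ih =>
      rw [hz, pow_succ', mul_assoc]
      exact (hs _).trans (mul_le_mul_of_nonneg_left ih (by norm_num))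
  have hgeom : Summable fun k : ℕ => (1 / 2 : ℝ) ^ k * ‖y‖ :=
    summable_geometric_two.mul_right _
  have hsum : Summable fun k => s (z k) :=
    Summable.of_norm_bounded (hgeom.mul_left |C|) fun k => (hsC _).trans <|
      mul_le_mul (le_abs_self C) (hz_le k) (norm_nonneg _) (abs_nonneg C)
  have hpart (k : ℕ) : ∑ i ∈ Finset.range k, T (s (z i)) = y - z k := by
    induction k with
    | zero => simp [z]
    | succ k ih => rw [Finset.sum_range_succ, ih, hz]; abel
  refine ⟨∑' k, s (z k), tendsto_nhds_unique (T.hasSum hsum.hasSum).tendsto_sum_nat ?_⟩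
  simpa only [hpart, sub_zero] using
    (squeeze_zero_norm hz_le hgeom.tendsto_atTop_zero).const_sub y

lemma surjective_of_not_isMeagre_range [CompleteSpace X] (T : X →L[L] Y)
    (h : ¬ IsMeagre (Set.range T)) : Function.Surjective T := by
  have hcov : Set.range T ⊆ ⋃ k : ℕ, T '' Metric.closedBall 0 k := by
    rintro _ ⟨x, rfl⟩
    obtain ⟨k, hk⟩ := exists_nat_ge ‖x‖
    exact Set.mem_iUnion.2 ⟨k, x, mem_closedBall_zero_iff.2 hk, rfl⟩
  obtain ⟨k, hk⟩ : ∃ k : ℕ, (interior (closure (T '' Metric.closedBall 0 k))).Nonempty := by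
    by_contra! hempty
    exact h ((isMeagre_iUnion fun k => IsNowhereDense.isMeagre (hempty k)).mono hcov)
  obtain ⟨δ, hδ, hball⟩ := exists_ball_subset_closure_image T hk
  obtain ⟨C, hC⟩ := exists_approx_preimage_of_ball_subset_closure_image T hδ hball
  exact surjective_of_approx_preimage T hC

variable {ι : Type*}

/-- The sum of finitely many members of a family of continuous linear maps. -/
def finsetSumCLM (T : ι → X →L[L] Y) (F : Finset ι) : (F → X) →L[L] Y :=
  ∑ i : F, (T i).comp (ContinuousLinearMap.proj i)

lemma finsetSumCLM_apply (T : ι → X →L[L] Y) (F : Finset ι) (x : F → X) :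
    finsetSumCLM T F x = ∑ i : F, T i (x i) := by
  simp [finsetSumCLM]

lemma iUnion_range_finsetSumCLM {T : ι → X →L[L] Y}
    (hT : ⨆ i, LinearMap.range (T i : X →ₗ[L] Y) = ⊤) :
    ⋃ F, Set.range (finsetSumCLM T F) = Set.univ := by
  refine Set.eq_univ_of_forall fun y => ?_
  have hy : y ∈ ⨆ i, LinearMap.range (T i : X →ₗ[L] Y) := hT ▸ Submodule.mem_top
  obtain ⟨f, hf, rfl⟩ := (Submodule.mem_iSup_iff_exists_finsupp _ _).1 hy
  choose x hx using hf
  refine Set.mem_iUnion.2 ⟨f.support, fun i => x i, ?_⟩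
  rw [finsetSumCLM_apply]
  exact (Fintype.sum_congr _ (fun i : f.support => f i) fun i => hx i).trans
    (Finset.sum_coe_sort f.support f)

lemma mem_nhds_zero_of_iSup_range_eq_top [CompleteSpace X] [CompleteSpace Y] [Countable ι]
    {T : ι → X →L[L] Y} (hT : ⨆ i, LinearMap.range (T i : X →ₗ[L] Y) = ⊤)
    {A : AddSubgroup Y} (hA : ∀ i x, ‖x‖ ≤ 1 → T i x ∈ A) : (A : Set Y) ∈ 𝓝 0 := by
  obtain ⟨F, hF⟩ : ∃ F, ¬ IsMeagre (Set.range (finsetSumCLM T F)) := by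
    by_contra! hmeagre
    exact not_isMeagre_of_isOpen (isOpen_univ (X := Y)) Set.univ_nonempty
      (iUnion_range_finsetSumCLM hT ▸ isMeagre_iUnion hmeagre)
  have hopen := (finsetSumCLM T F).isOpenMap (surjective_of_not_isMeagre_range _ hF)
  have hball := hopen.image_mem_nhds (Metric.closedBall_mem_nhds (0 : F → X) one_pos)
  rw [map_zero] at hball
  refine mem_of_superset hball ?_
  rintro _ ⟨x, hx, rfl⟩
  rw [finsetSumCLM_apply]
  exact sum_mem fun i _ => hA i _ ((norm_le_pi_norm x i).trans (mem_closedBall_zero_iff.1 hx))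

end OpenMapping

/-! ### The Banach spaces `Π^(h)` -/

section PiHBanach

variable {p : ℕ} [Fact p.Prime] {n : ℕ}
variable {L : Type u} [NormedField L]
variable {E : Type v} [NormedAddCommGroup E] [NormedSpace L E]
variable {ρ : Representation L (GL (Fin n) ℚ_[p]) E}

lemma IsContinuousRep.continuous_apply (hρ : IsContinuousRep ρ) (g : GL (Fin n) ℚ_[p]) :
    Continuous (ρ g) :=
  hρ.comp (Continuous.prodMk_right g)

lemma IsContinuousRep.continuous_bOp (hρ : IsContinuousRep ρ) (α : Fin n × Fin n → ℕ) :
    Continuous (bOp ρ α) := by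
  unfold bOp
  induction List.finRange n ×ˢ List.finRange n with
  | nil => exact continuous_id
  | cons ij l ih =>
    rw [List.map_cons, List.prod_cons]
    refine Continuous.comp (g := ((ρ (generator p ij) - 1) ^ α ij : Module.End L E)) ?_ ih
    rw [Module.End.coe_pow]
    exact Continuous.iterate ((hρ.continuous_apply _).sub continuous_id) _

lemma bOp_zero : bOp ρ 0 = 1 := by
  unfold bOp
  exact List.prod_eq_one (by simp)

lemma le_normH {h : ℕ} {e : E} (he : e ∈ PiH ρ h) (α : Fin n × Fin n → ℕ) :
    (p : ℝ) ^ (radius p h * degree α) * ‖bOp ρ α e‖ ≤ normH ρ h e :=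
  le_ciSup (Filter.Tendsto.bddAbove_range_of_cofinite he) α

lemma norm_le_normH {h : ℕ} {e : E} (he : e ∈ PiH ρ h) : ‖e‖ ≤ normH ρ h e := by
  simpa [degree, bOp_zero] using le_normH he 0

lemma normH_nonneg (h : ℕ) (e : E) : 0 ≤ normH ρ h e :=
  Real.iSup_nonneg fun α => by positivity

lemma normH_zero (h : ℕ) : normH ρ h 0 = 0 := by simp [normH]

lemma normH_smul (h : ℕ) (c : L) (e : E) : normH ρ h (c • e) = ‖c‖ * normH ρ h e := by
  rw [normH, normH, Real.mul_iSup_of_nonneg (norm_nonneg c)]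
  congr 1; ext α
  rw [map_smul, norm_smul]; ring

lemma normH_add_le {h : ℕ} {e f : E} (he : e ∈ PiH ρ h) (hf : f ∈ PiH ρ h) :
    normH ρ h (e + f) ≤ normH ρ h e + normH ρ h f := by
  refine ciSup_le fun α => ?_
  rw [map_add]
  refine (mul_le_mul_of_nonneg_left (norm_add_le _ _) (by positivity)).trans ?_
  rw [mul_add]
  exact add_le_add (le_normH he α) (le_normH hf α)

variable (ρ) in
/-- The space `Π^(h)` with the norm `‖·‖_h`; it is a type synonym since the submodule `Π^(h)` of
`Π` already carries the norm of `Π`. -/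
def PiHBanach (h : ℕ) : Type v := PiH ρ h

instance (h : ℕ) : AddCommGroup (PiHBanach ρ h) := inferInstanceAs (AddCommGroup (PiH ρ h))

instance (h : ℕ) : Module L (PiHBanach ρ h) := inferInstanceAs (Module L (PiH ρ h))

instance (h : ℕ) : Norm (PiHBanach ρ h) := ⟨fun e => normH ρ h ((PiH ρ h).subtype e)⟩

namespace PiHBanach

variable (ρ) in
/-- The inclusion of `Π^(h)` in `Π`. -/
def incl (h : ℕ) : PiHBanach ρ h →ₗ[L] E := (PiH ρ h).subtype

lemma incl_mem {h : ℕ} (e : PiHBanach ρ h) : incl ρ h e ∈ PiH ρ h := Subtype.prop _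

lemma exists_incl_eq {h : ℕ} {e : E} (he : e ∈ PiH ρ h) : ∃ e' : PiHBanach ρ h, incl ρ h e' = e :=
  ⟨(⟨e, he⟩ : PiH ρ h), rfl⟩

lemma incl_injective (h : ℕ) : Function.Injective (incl ρ h) := Subtype.val_injective

lemma norm_def {h : ℕ} (e : PiHBanach ρ h) : ‖e‖ = normH ρ h (incl ρ h e) := rfl

lemma core (h : ℕ) : NormedSpace.Core L (PiHBanach ρ h) where
  norm_nonneg e := normH_nonneg _ _
  norm_smul c e := by rw [norm_def, norm_def, map_smul, normH_smul]
  norm_triangle e f := by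
    rw [norm_def, norm_def, norm_def, map_add]
    exact normH_add_le (incl_mem e) (incl_mem f)
  norm_eq_zero_iff e := by
    refine ⟨fun h0 => incl_injective h ?_, ?_⟩
    · rw [map_zero, ← norm_le_zero_iff, ← h0]
      exact norm_le_normH (incl_mem e)
    · rintro rfl
      rw [norm_def, map_zero, normH_zero]

instance (h : ℕ) : NormedAddCommGroup (PiHBanach ρ h) :=
  NormedAddCommGroup.ofCore (core (ρ := ρ) h)

instance (h : ℕ) : NormedSpace L (PiHBanach ρ h) := NormedSpace.ofCore (core (ρ := ρ) h)

lemma norm_incl_le {h : ℕ} (e : PiHBanach ρ h) : ‖incl ρ h e‖ ≤ ‖e‖ :=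
  norm_le_normH (incl_mem e)

lemma continuous_incl (h : ℕ) : Continuous (incl ρ h) :=
  AddMonoidHomClass.continuous_of_bound (incl ρ h) 1 fun e => by
    rw [one_mul]; exact norm_incl_le e

end PiHBanach

lemma mem_PiH_of_forall_exists_approx {h : ℕ} {e : E}
    (he : ∀ ε > 0, ∃ f ∈ PiH ρ h, ∀ α : Fin n × Fin n → ℕ,
      (p : ℝ) ^ (radius p h * degree α) * ‖bOp ρ α (e - f)‖ ≤ ε) : e ∈ PiH ρ h := by
  refine Metric.tendsto_nhds.2 fun ε hε => ?_
  obtain ⟨f, hf, hef⟩ := he (ε / 2) (half_pos hε)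
  filter_upwards [Tendsto.eventually hf (gt_mem_nhds (half_pos hε))] with α hα
  rw [Real.dist_eq, sub_zero, abs_of_nonneg (by positivity)]
  calc (p : ℝ) ^ (radius p h * degree α) * ‖bOp ρ α e‖
      ≤ (p : ℝ) ^ (radius p h * degree α) * (‖bOp ρ α (e - f)‖ + ‖bOp ρ α f‖) := by
        gcongr
        rw [map_sub]
        exact norm_le_norm_sub_add _ _
    _ < ε / 2 + ε / 2 := by
        rw [mul_add]
        exact add_lt_add_of_le_of_lt (hef α) hα
    _ = ε := add_halves ε

lemma weight_mul_norm_bOp_sub_le_of_tendsto (hρ : IsContinuousRep ρ) {h : ℕ}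
    {s : ℕ → PiHBanach ρ h} {e : E}
    (he : Tendsto (fun j => PiHBanach.incl ρ h (s j)) atTop (𝓝 e)) {ε : ℝ} {i : ℕ}
    (hs : ∀ᶠ j in atTop, dist (s j) (s i) ≤ ε) (α : Fin n × Fin n → ℕ) :
    (p : ℝ) ^ (radius p h * degree α) * ‖bOp ρ α (e - PiHBanach.incl ρ h (s i))‖ ≤ ε := by
  have hlim : Tendsto (fun j => (p : ℝ) ^ (radius p h * degree α) *
      ‖bOp ρ α (PiHBanach.incl ρ h (s j) - PiHBanach.incl ρ h (s i))‖) atTop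
      (𝓝 ((p : ℝ) ^ (radius p h * degree α) * ‖bOp ρ α (e - PiHBanach.incl ρ h (s i))‖)) :=
    (((hρ.continuous_bOp α).tendsto _).comp (he.sub_const _)).norm.const_mul _
  refine le_of_tendsto hlim (hs.mono fun j hj => ?_)
  rw [← map_sub]
  exact (le_normH (PiHBanach.incl_mem _) α).trans ((dist_eq_norm (s j) (s i)).symm.trans_le hj)

lemma completeSpace_PiHBanach [CompleteSpace E] (hρ : IsContinuousRep ρ) (h : ℕ) :
    CompleteSpace (PiHBanach ρ h) := by
  refine Metric.complete_of_cauchySeq_tendsto fun s hs => ?_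
  obtain ⟨e, he⟩ := cauchySeq_tendsto_of_complete
    ((uniformContinuous_addMonoidHom_of_continuous
      (PiHBanach.continuous_incl (ρ := ρ) h)).comp_cauchySeq hs)
  have happrox : ∀ ε > 0, ∃ N, ∀ i ≥ N, ∀ α : Fin n × Fin n → ℕ,
      (p : ℝ) ^ (radius p h * degree α) * ‖bOp ρ α (e - PiHBanach.incl ρ h (s i))‖ ≤ ε := by
    intro ε hε
    obtain ⟨N, hN⟩ := Metric.cauchySeq_iff.1 hs ε hε
    exact ⟨N, fun i hi α => weight_mul_norm_bOp_sub_le_of_tendsto hρ he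
      (eventually_atTop.2 ⟨N, fun j hj => (hN j hj i hi).le⟩) α⟩
  obtain ⟨e', rfl⟩ : ∃ e', PiHBanach.incl ρ h e' = e := by
    refine PiHBanach.exists_incl_eq (mem_PiH_of_forall_exists_approx fun ε hε => ?_)
    obtain ⟨N, hN⟩ := happrox ε hε
    exact ⟨_, PiHBanach.incl_mem (s N), hN N le_rfl⟩
  refine ⟨e', Metric.tendsto_atTop.2 fun ε hε => ?_⟩
  obtain ⟨N, hN⟩ := happrox (ε / 2) (half_pos hε)
  refine ⟨N, fun i hi => lt_of_le_of_lt ?_ (half_lt_self hε)⟩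
  rw [dist_comm, dist_eq_norm, PiHBanach.norm_def, map_sub]
  exact ciSup_le (hN i hi)

lemma radius_pos (h : ℕ) : 0 < radius p h :=
  have hp : (1 : ℝ) < p := one_lt_prime_cast
  one_div_pos.2 (mul_pos (by positivity) (sub_pos.2 hp))

lemma radius_anti {h h' : ℕ} (hh : h ≤ h') : radius p h' ≤ radius p h := by
  have hp : (1 : ℝ) < p := one_lt_prime_cast
  refine one_div_le_one_div_of_le (mul_pos (by positivity) (sub_pos.2 hp)) ?_
  exact mul_le_mul_of_nonneg_right (pow_le_pow_right₀ hp.le (by omega)) (sub_pos.2 hp).le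

lemma weight_le {h h' : ℕ} (hh : h ≤ h') (α : Fin n × Fin n → ℕ) :
    (p : ℝ) ^ (radius p h' * degree α) ≤ (p : ℝ) ^ (radius p h * degree α) :=
  Real.rpow_le_rpow_of_exponent_le one_lt_prime_cast.le
    (mul_le_mul_of_nonneg_right (radius_anti hh) (Nat.cast_nonneg _))

lemma PiH_mono {h h' : ℕ} (hh : h ≤ h') : PiH ρ h ≤ PiH ρ h' := fun _ he =>
  squeeze_zero (fun α => by positivity)
    (fun α => mul_le_mul_of_nonneg_right (weight_le hh α) (norm_nonneg _)) he

lemma normH_anti {h h' : ℕ} (hh : h ≤ h') {e : E} (he : e ∈ PiH ρ h) :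
    normH ρ h' e ≤ normH ρ h e :=
  ciSup_le fun α => (mul_le_mul_of_nonneg_right (weight_le hh α) (norm_nonneg _)).trans
    (le_normH he α)

end PiHBanach

/-! ### Coherence and openness -/

section Openness

variable {p : ℕ} [Fact p.Prime] {n : ℕ}

section Algebraic

variable {L : Type u} [NormedField L]
variable {E : Type v} [NormedAddCommGroup E] [NormedSpace L E]
variable {ρ : Representation L (GL (Fin n) ℚ_[p]) E}

lemma map_rep_mul (g g' : GL (Fin n) ℚ_[p]) (W : Submodule L E) :
    W.map (ρ (g * g')) = (W.map (ρ g')).map (ρ g) := by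
  rw [← Submodule.map_comp, map_mul]; rfl

lemma map_rep_mul_of_forall_map_le {W : Submodule L E} {K : Subgroup (GL (Fin n) ℚ_[p])}
    (hW : ∀ a ∈ K, W.map (ρ a) ≤ W) (g : GL (Fin n) ℚ_[p]) {a : GL (Fin n) ℚ_[p]} (ha : a ∈ K) :
    W.map (ρ (g * a)) = W.map (ρ g) := by
  rw [map_rep_mul]
  refine le_antisymm (Submodule.map_mono (hW a ha)) (Submodule.map_mono ?_)
  calc W = (W.map (ρ a⁻¹)).map (ρ a) := by
        rw [← map_rep_mul, mul_inv_cancel, map_one]; exact (Submodule.map_id W).symm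
    _ ≤ W.map (ρ a) := Submodule.map_mono (hW _ (inv_mem ha))

lemma IsCoherentFrom.map_le {m : ℕ} (hm : IsCoherentFrom ρ m) {h : ℕ} (hh : m ≤ h) {k : ℕ}
    {g : GL (Fin n) ℚ_[p]} (hg : dist1 g ≤ k) : (PiH ρ h).map (ρ g) ≤ PiH ρ (h + k) := by
  rw [hm.2 h hh k]
  exact le_iSup₂_of_le g hg le_rfl

lemma IsCoherentFrom.le_iSup_map_out {m : ℕ} (hm : IsCoherentFrom ρ m) {h : ℕ} (hh : m ≤ h)
    (k : ℕ) : PiH ρ (h + k) ≤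
      ⨆ q : {q : GL (Fin n) ℚ_[p] ⧸ H p n // (PiH ρ h).map (ρ q.out) ≤ PiH ρ (h + k)},
        (PiH ρ h).map (ρ q.1.out) := by
  have hH : ∀ a ∈ H p n, (PiH ρ h).map (ρ a) ≤ PiH ρ h := fun a ha =>
    hm.map_le hh (k := 0) (dist1_eq_zero ha).le
  refine (hm.2 h hh k).le.trans (iSup₂_le fun g hg => ?_)
  have hout : (PiH ρ h).map (ρ (g : GL (Fin n) ℚ_[p] ⧸ H p n).out) = (PiH ρ h).map (ρ g) := by
    obtain ⟨a, ha⟩ := QuotientGroup.mk_out_eq_mul (H p n) g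
    rw [ha, map_rep_mul_of_forall_map_le hH g a.2]
  exact le_iSup_of_le ⟨g, hout.trans_le (hm.map_le hh hg)⟩ hout.ge

end Algebraic

variable {L : Type u} [NontriviallyNormedField L]
variable {E : Type v} [NormedAddCommGroup E] [NormedSpace L E] [CompleteSpace E]
variable {ρ : Representation L (GL (Fin n) ℚ_[p]) E}

lemma exists_clm_of_map_le (hρ : IsContinuousRep ρ) {h h' : ℕ} {g : GL (Fin n) ℚ_[p]}
    (hg : (PiH ρ h).map (ρ g) ≤ PiH ρ h') : ∃ T : PiHBanach ρ h →L[L] PiHBanach ρ h',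
      ∀ e, PiHBanach.incl ρ h' (T e) = ρ g (PiHBanach.incl ρ h e) := by
  have := completeSpace_PiHBanach hρ h
  have := completeSpace_PiHBanach hρ h'
  let T : PiHBanach ρ h →ₗ[L] PiHBanach ρ h' := LinearMap.codRestrict (PiH ρ h')
    (ρ g ∘ₗ PiHBanach.incl ρ h) fun e => hg ⟨_, PiHBanach.incl_mem e, rfl⟩
  have hT (e) : PiHBanach.incl ρ h' (T e) = ρ g (PiHBanach.incl ρ h e) := rfl
  refine ⟨⟨T, T.continuous_of_seq_closed_graph fun s x y hx hy => ?_⟩, hT⟩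
  apply PiHBanach.incl_injective
  rw [hT]
  exact tendsto_nhds_unique (((PiHBanach.continuous_incl h').tendsto y).comp hy)
    (((hρ.continuous_apply g).tendsto _).comp (((PiHBanach.continuous_incl h).tendsto x).comp hx))

lemma IsCoherentFrom.exists_ball_subset (hρ : IsContinuousRep ρ) {m : ℕ}
    (hm : IsCoherentFrom ρ m) {h : ℕ} (hh : m ≤ h) (k : ℕ) {A : AddSubgroup E}
    (hA : ∀ (g : GL (Fin n) ℚ_[p]), ∀ e ∈ PiH ρ h, normH ρ h e ≤ 1 → ρ g e ∈ A) :
    ∃ ε > 0, ∀ e ∈ PiH ρ (h + k), normH ρ (h + k) e ≤ ε → e ∈ A := by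
  have := completeSpace_PiHBanach hρ h
  have := completeSpace_PiHBanach hρ (h + k)
  have := countable_quotient_H (p := p) (n := n)
  choose T hT using
    fun q : {q : GL (Fin n) ℚ_[p] ⧸ H p n // (PiH ρ h).map (ρ q.out) ≤ PiH ρ (h + k)} =>
      exists_clm_of_map_le hρ q.2
  have htop : ⨆ q, LinearMap.range (T q : PiHBanach ρ h →ₗ[L] PiHBanach ρ (h + k)) = ⊤ := by
    refine Submodule.map_injective_of_injective (PiHBanach.incl_injective (ρ := ρ) (h + k)) ?_
    rw [Submodule.map_iSup]
    refine le_antisymm (iSup_le fun q => Submodule.map_mono le_top) ?_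
    rintro _ ⟨e, -, rfl⟩
    refine ((hm.le_iSup_map_out hh k).trans (iSup_mono fun q => ?_)) (PiHBanach.incl_mem e)
    rintro _ ⟨f, hf, rfl⟩
    obtain ⟨f, rfl⟩ := PiHBanach.exists_incl_eq hf
    exact ⟨_, ⟨f, rfl⟩, hT q f⟩
  have hmem : ∀ q x, ‖x‖ ≤ 1 → T q x ∈ A.comap (PiHBanach.incl ρ (h + k)).toAddMonoidHom := by
    intro q x hx
    change PiHBanach.incl ρ (h + k) (T q x) ∈ A
    rw [hT]
    exact hA _ _ (PiHBanach.incl_mem x) hx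
  obtain ⟨ε, hε, hball⟩ := Metric.nhds_basis_closedBall.mem_iff.1
    (mem_nhds_zero_of_iSup_range_eq_top htop hmem)
  refine ⟨ε, hε, fun e he hee => ?_⟩
  obtain ⟨e, rfl⟩ := PiHBanach.exists_incl_eq he
  exact hball (mem_closedBall_zero_iff.2 hee)

end Openness

/-! ### Powers with `p`-adic exponents -/

section PowAnalytic

variable {p : ℕ} [Fact p.Prime]

lemma inv_prime_le_one : (p : ℝ)⁻¹ ≤ 1 :=
  (inv_lt_one_of_one_lt₀ one_lt_prime_cast).le

lemma norm_inv_factorial_le (k : ℕ) : ‖((k.factorial : ℚ_[p]))⁻¹‖ ≤ (p : ℝ) ^ k := by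
  have hfact : (k.factorial : ℚ_[p]) ≠ 0 := by exact_mod_cast k.factorial_ne_zero
  rw [norm_inv, Padic.norm_eq_zpow_neg_valuation hfact, zpow_neg, inv_inv,
    Padic.valuation_natCast, zpow_natCast]
  refine pow_le_pow_right₀ one_lt_prime_cast.le ?_
  have hlegendre := sub_one_mul_padicValNat_factorial (p := p) k
  have hp := (Fact.out : p.Prime).two_le
  have : 1 * padicValNat p k.factorial ≤ (p - 1) * padicValNat p k.factorial :=
    Nat.mul_le_mul_right _ (by omega)
  omega

section Expansion

variable {A : Type*} [NormedRing A] [NormedAlgebra ℚ_[p] A]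

variable (p) in
/-- The coefficient of `x ^ m` in the `k`-th term of the binomial series
`(1 + T) ^ x = ∑ k, x (x - 1) ⋯ (x - k + 1) • (T ^ k / k!)`. -/
def powCoeff (T : A) (k m : ℕ) : A :=
  ((descPochhammer ℤ k).coeff m : ℚ_[p]) • ((k.factorial : ℚ_[p])⁻¹ • T ^ k)

lemma powCoeff_of_lt (T : A) {k m : ℕ} (h : k < m) : powCoeff p T k m = 0 := by
  rw [powCoeff, Polynomial.coeff_eq_zero_of_natDegree_lt (by rwa [descPochhammer_natDegree]),
    Int.cast_zero, zero_smul]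

lemma norm_powCoeff_le_mul_norm_pow (T : A) (k m : ℕ) :
    ‖powCoeff p T k m‖ ≤ (p : ℝ) ^ k * ‖T ^ k‖ := by
  rw [powCoeff, norm_smul, norm_smul]
  exact (mul_le_of_le_one_left (by positivity) (Padic.norm_int_le_one _)).trans
    (mul_le_mul_of_nonneg_right (norm_inv_factorial_le k) (norm_nonneg _))

lemma hasSum_powCoeff (T : A) (k : ℕ) (y : ℚ_[p]) :
    HasSum (fun m => y ^ m • powCoeff p T k m)
      ((descPochhammer ℚ_[p] k).eval y • ((k.factorial : ℚ_[p])⁻¹ • T ^ k)) := by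
  have heval : (descPochhammer ℚ_[p] k).eval y
      = ∑ m ∈ Finset.range (k + 1), ((descPochhammer ℤ k).coeff m : ℚ_[p]) * y ^ m := by
    rw [← descPochhammer_map (Int.castRingHom ℚ_[p]), Polynomial.eval_map,
      Polynomial.eval₂_eq_sum_range, descPochhammer_natDegree]
    rfl
  have hsum : (descPochhammer ℚ_[p] k).eval y • ((k.factorial : ℚ_[p])⁻¹ • T ^ k)
      = ∑ m ∈ Finset.range (k + 1), y ^ m • powCoeff p T k m := by
    rw [heval, Finset.sum_smul]
    exact Finset.sum_congr rfl fun m _ => by rw [powCoeff, smul_smul (y ^ m), mul_comm]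
  rw [hsum]
  refine hasSum_sum_of_ne_finset_zero fun m hm => ?_
  rw [powCoeff_of_lt T (by simpa using hm), smul_zero]

lemma summable_inv_pow_mul : Summable fun q : ℕ × ℕ => (p : ℝ)⁻¹ ^ q.1 * (p : ℝ)⁻¹ ^ q.2 := by
  have h : Summable fun k : ℕ => (p : ℝ)⁻¹ ^ k :=
    summable_geometric_of_lt_one (by positivity) (inv_lt_one_of_one_lt₀ one_lt_prime_cast)
  exact h.mul_of_nonneg h (fun _ => by positivity) (fun _ => by positivity)

lemma norm_powCoeff_le {T : A} (hT : ∀ k, ‖T ^ k‖ ≤ ((p : ℝ)⁻¹ ^ 3) ^ k) (k m : ℕ) :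
    ‖powCoeff p T k m‖ ≤ (p : ℝ)⁻¹ ^ k * (p : ℝ)⁻¹ ^ m := by
  have hp := one_lt_prime_cast (p := p)
  rcases lt_or_ge k m with hkm | hmk
  · rw [powCoeff_of_lt T hkm, norm_zero]
    positivity
  calc ‖powCoeff p T k m‖ ≤ (p : ℝ) ^ k * ((p : ℝ)⁻¹ ^ 3) ^ k :=
        (norm_powCoeff_le_mul_norm_pow T k m).trans
          (mul_le_mul_of_nonneg_left (hT k) (by positivity))
    _ = (p : ℝ)⁻¹ ^ k * (p : ℝ)⁻¹ ^ k := by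
        rw [← mul_pow, ← mul_pow]
        congr 1
        field_simp
    _ ≤ (p : ℝ)⁻¹ ^ k * (p : ℝ)⁻¹ ^ m := mul_le_mul_of_nonneg_left
        (pow_le_pow_of_le_one (by positivity) inv_prime_le_one hmk) (by positivity)

variable [CompleteSpace A]

lemma summable_powCoeff {T : A} (hT : ∀ k, ‖T ^ k‖ ≤ ((p : ℝ)⁻¹ ^ 3) ^ k) (m : ℕ) :
    Summable fun k => powCoeff p T k m :=
  Summable.of_norm_bounded ((summable_inv_pow_mul (p := p)).comp_injective
    (i := fun k : ℕ => (k, m)) fun _ _ h => (Prod.ext_iff.1 h).1) fun k => norm_powCoeff_le hT k m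

lemma summable_powCoeff_smul {T : A} (hT : ∀ k, ‖T ^ k‖ ≤ ((p : ℝ)⁻¹ ^ 3) ^ k) {y : ℚ_[p]}
    (hy : ‖y‖ ≤ 1) : Summable fun q : ℕ × ℕ => y ^ q.2 • powCoeff p T q.1 q.2 := by
  refine Summable.of_norm_bounded (summable_inv_pow_mul (p := p)) fun q => ?_
  rw [norm_smul, norm_pow]
  exact (mul_le_of_le_one_left (norm_nonneg _) (pow_le_one₀ (norm_nonneg _) hy)).trans
    (norm_powCoeff_le hT _ _)

/-- The function `x ↦ (1 + T) ^ x` for `T` close to `0`, as a power series in `x`. -/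
def padicPow (T : A) (y : ℚ_[p]) : A := ∑' m, y ^ m • ∑' k, powCoeff p T k m

lemma hasSum_prod_padicPow {T : A} (hT : ∀ k, ‖T ^ k‖ ≤ ((p : ℝ)⁻¹ ^ 3) ^ k) {y : ℚ_[p]}
    (hy : ‖y‖ ≤ 1) :
    HasSum (fun q : ℕ × ℕ => y ^ q.2 • powCoeff p T q.1 q.2) (padicPow T y) := by
  have hsum := (summable_powCoeff_smul hT hy).hasSum
  have hswap := ((Equiv.prodComm ℕ ℕ).hasSum_iff.2 hsum).prod_fiberwise
    (g := fun m => y ^ m • ∑' k, powCoeff p T k m)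
    fun m => (summable_powCoeff hT m).hasSum.const_smul (y ^ m)
  rwa [padicPow, hswap.tsum_eq]

lemma hasSum_padicPow {T : A} (hT : ∀ k, ‖T ^ k‖ ≤ ((p : ℝ)⁻¹ ^ 3) ^ k) {y : ℚ_[p]}
    (hy : ‖y‖ ≤ 1) : HasSum (fun m => y ^ m • ∑' k, powCoeff p T k m) (padicPow T y) :=
  ((Equiv.prodComm ℕ ℕ).hasSum_iff.2 (hasSum_prod_padicPow hT hy)).prod_fiberwise
    fun m => (summable_powCoeff hT m).hasSum.const_smul (y ^ m)

lemma hasSum_padicPow_descPochhammer {T : A} (hT : ∀ k, ‖T ^ k‖ ≤ ((p : ℝ)⁻¹ ^ 3) ^ k)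
    {y : ℚ_[p]} (hy : ‖y‖ ≤ 1) :
    HasSum (fun k => (descPochhammer ℚ_[p] k).eval y • ((k.factorial : ℚ_[p])⁻¹ • T ^ k))
      (padicPow T y) :=
  (hasSum_prod_padicPow hT hy).prod_fiberwise fun k => hasSum_powCoeff T k y

lemma padicPow_natCast {T : A} (hT : ∀ k, ‖T ^ k‖ ≤ ((p : ℝ)⁻¹ ^ 3) ^ k) (s : ℕ) :
    padicPow T (s : ℚ_[p]) = (1 + T) ^ s := by
  refine (hasSum_padicPow_descPochhammer hT
    (by simpa using Padic.norm_int_le_one (p := p) s)).unique ?_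
  have hterm : ∀ k, (descPochhammer ℚ_[p] k).eval (s : ℚ_[p]) • ((k.factorial : ℚ_[p])⁻¹ • T ^ k)
      = s.choose k • T ^ k := fun k => by
    rw [descPochhammer_eval_eq_descFactorial, smul_smul, Nat.descFactorial_eq_factorial_mul_choose,
      Nat.cast_mul, mul_comm, inv_mul_cancel_left₀ (by exact_mod_cast k.factorial_ne_zero),
      Nat.cast_smul_eq_nsmul]
  simp only [hterm]
  rw [add_comm, (Commute.one_right T).add_pow]
  simp only [one_pow, mul_one, ← nsmul_eq_mul']
  exact hasSum_sum_of_ne_finset_zero fun k hk => by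
    rw [Nat.choose_eq_zero_of_lt (by simpa using hk), zero_smul]

variable (p) in
/-- The power series of `padicPow T` at `0`. -/
def powSeries (T : A) : FormalMultilinearSeries ℚ_[p] ℚ_[p] A := fun m =>
  ContinuousMultilinearMap.mkPiRing ℚ_[p] (Fin m) (∑' k, powCoeff p T k m)

lemma hasFPowerSeriesAt_padicPow {T : A} (hT : ∀ k, ‖T ^ k‖ ≤ ((p : ℝ)⁻¹ ^ 3) ^ k) :
    HasFPowerSeriesAt (padicPow T) (powSeries p T) 0 := by
  have hcoeff : ∀ m, (powSeries p T).coeff m = ∑' k, powCoeff p T k m := fun m => by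
    simp [FormalMultilinearSeries.coeff, powSeries]
  rw [hasFPowerSeriesAt_iff]
  filter_upwards [Metric.closedBall_mem_nhds (0 : ℚ_[p]) one_pos] with y hy
  simp only [zero_add, hcoeff]
  exact hasSum_padicPow hT (by simpa using hy)

lemma analyticAt_padicPow_const_mul {T : A} (hT : ∀ k, ‖T ^ k‖ ≤ ((p : ℝ)⁻¹ ^ 3) ^ k)
    (c : ℚ_[p]) : AnalyticAt ℚ_[p] (fun x => padicPow T (c * x)) 0 := by
  have h : AnalyticAt ℚ_[p] (padicPow (p := p) T) (c * 0) := by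
    rw [mul_zero]
    exact (hasFPowerSeriesAt_padicPow hT).analyticAt
  exact h.comp (analyticAt_const.mul analyticAt_id)

lemma padicPow_inv_mul_of_dvd {T : A} {N : ℕ}
    (hT : ∀ k, ‖((1 + T) ^ p ^ N - 1) ^ k‖ ≤ ((p : ℝ)⁻¹ ^ 3) ^ k) {s : ℕ} (hs : p ^ N ∣ s) :
    padicPow ((1 + T) ^ p ^ N - 1) (((p : ℚ_[p]) ^ N)⁻¹ * (s : ℚ_[p])) = (1 + T) ^ s := by
  obtain ⟨s, rfl⟩ := hs
  have hpN : (p : ℚ_[p]) ^ N ≠ 0 := pow_ne_zero _ (natCast_prime_ne_zero p _)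
  rw [Nat.cast_mul, Nat.cast_pow, inv_mul_cancel_left₀ hpN, padicPow_natCast hT, add_sub_cancel,
    ← pow_mul]

end Expansion

section Ultrametric

variable {A : Type*} [NormedRing A] [IsUltrametricDist A]

/-- The closed unit ball of an ultrametric normed ring in which `‖1‖ ≤ 1`. -/
def unitBallSubring (hone : ‖(1 : A)‖ ≤ 1) : Subring A where
  carrier := {a | ‖a‖ ≤ 1}
  mul_mem' ha hb := (norm_mul_le _ _).trans (mul_le_one₀ ha (norm_nonneg _) hb)
  one_mem' := hone
  add_mem' ha hb := (IsUltrametricDist.norm_add_le_max _ _).trans (max_le ha hb)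
  zero_mem' := by simp
  neg_mem' ha := by simpa using ha

variable [NormedAlgebra ℚ_[p] A]

lemma norm_one_add_pow_prime_pow_sub_one_le (hone : ‖(1 : A)‖ ≤ 1) {U : A} (hU : ‖U‖ ≤ 1)
    (s : ℕ) : ‖(1 + U) ^ p ^ s - 1‖ ≤ max ‖U ^ p ^ s‖ ((p : ℝ)⁻¹ * ‖U‖) := by
  obtain ⟨r, hr⟩ := (Commute.one_left (⟨U, hU⟩ : unitBallSubring hone)).exists_add_pow_prime_pow_eq
    (Fact.out : p.Prime) s
  have hexpand : (1 + U) ^ p ^ s = 1 ^ p ^ s + U ^ p ^ s + p * 1 * U * r := congrArg Subtype.val hr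
  have hsub : (1 + U) ^ p ^ s - 1 = U ^ p ^ s + (p : ℚ_[p]) • (U * r) := by
    rw [hexpand, one_pow, mul_one, mul_assoc, Nat.cast_smul_eq_nsmul, nsmul_eq_mul]
    abel
  rw [hsub]
  refine (IsUltrametricDist.norm_add_le_max _ _).trans (max_le_max le_rfl ?_)
  rw [norm_smul, Padic.norm_p]
  exact mul_le_mul_of_nonneg_left ((norm_mul_le _ _).trans
    (mul_le_of_le_one_right (norm_nonneg _) r.2)) (by positivity)

lemma exists_norm_one_add_pow_sub_one_le (hone : ‖(1 : A)‖ ≤ 1) {T : A}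
    (hT : ‖T‖ ≤ 1) {K : ℕ} (hTK : ‖T ^ K‖ ≤ (p : ℝ)⁻¹) (j : ℕ) :
    ∃ N, ‖(1 + T) ^ p ^ N - 1‖ ≤ (p : ℝ)⁻¹ ^ (j + 1) := by
  have hp := (Fact.out : p.Prime)
  induction j with
  | zero =>
    have hK : K ≤ p ^ K := (Nat.lt_pow_self hp.one_lt).le
    refine ⟨K, (norm_one_add_pow_prime_pow_sub_one_le hone hT K).trans ?_⟩
    rw [zero_add, pow_one]
    refine max_le ?_ (mul_le_of_le_one_right (by positivity) hT)
    rw [← Nat.sub_add_cancel hK, pow_add]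
    exact (norm_mul_le _ _).trans ((mul_le_of_le_one_left (norm_nonneg _)
      (pow_mem (show T ∈ unitBallSubring hone from hT) _)).trans hTK)
  | succ j ih =>
    obtain ⟨N, hN⟩ := ih
    have hstep := norm_one_add_pow_prime_pow_sub_one_le (p := p) hone
      (hN.trans (pow_le_one₀ (by positivity) inv_prime_le_one)) 1
    rw [add_sub_cancel, pow_one, ← pow_mul, ← pow_succ] at hstep
    refine ⟨N + 1, hstep.trans (max_le ?_ ?_)⟩
    · refine (norm_pow_le' _ hp.pos).trans ((pow_le_pow_left₀ (norm_nonneg _) hN p).trans ?_)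
      rw [← pow_mul]
      exact pow_le_pow_of_le_one (by positivity) inv_prime_le_one (by nlinarith [hp.two_le])
    · rw [pow_succ' _ (j + 1)]
      exact mul_le_mul_of_nonneg_left hN (by positivity)

lemma exists_analyticAt_one_add_pow [CompleteSpace A] (hone : ‖(1 : A)‖ ≤ 1) {T : A}
    (hT : ‖T‖ ≤ 1) {K : ℕ} (hTK : ‖T ^ K‖ ≤ (p : ℝ)⁻¹) :
    ∃ (N : ℕ) (e : ℚ_[p] → A), AnalyticAt ℚ_[p] e 0 ∧
      ∀ s : ℕ, p ^ N ∣ s → e s = (1 + T) ^ s := by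
  obtain ⟨N, hN⟩ := exists_norm_one_add_pow_sub_one_le (p := p) hone hT hTK 2
  have hpow : ∀ k, ‖((1 + T) ^ p ^ N - 1) ^ k‖ ≤ ((p : ℝ)⁻¹ ^ 3) ^ k := fun k => by
    rcases Nat.eq_zero_or_pos k with rfl | hk
    · simpa using hone
    · exact (norm_pow_le' _ hk).trans (pow_le_pow_left₀ (norm_nonneg _) hN k)
  exact ⟨N, fun x => padicPow ((1 + T) ^ p ^ N - 1) (((p : ℚ_[p]) ^ N)⁻¹ * x),
    analyticAt_padicPow_const_mul hpow _, fun _ hs => padicPow_inv_mul_of_dvd hpow hs⟩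

end Ultrametric

section Derivative

lemma norm_powCoeff_add_two_le {T : ℚ_[p]} (hT : ‖T‖ ≤ (p : ℝ)⁻¹ ^ 3) (k m : ℕ) :
    ‖powCoeff p T (k + 2) m‖ ≤ (p : ℝ)⁻¹ * ‖T‖ := by
  have hp := one_lt_prime_cast (p := p)
  have hcancel :
      (p : ℝ) ^ (k + 2) * ((p : ℝ)⁻¹ ^ 3) ^ (k + 1) = ((p : ℝ)⁻¹ ^ 2) ^ k * (p : ℝ)⁻¹ := by
    have hpk : (p : ℝ) ^ (k + 2) * (p : ℝ)⁻¹ ^ (k + 2) = 1 := by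
      rw [← mul_pow, mul_inv_cancel₀ (by positivity), one_pow]
    linear_combination ((p : ℝ)⁻¹ ^ 2) ^ k * (p : ℝ)⁻¹ * hpk
  calc ‖powCoeff p T (k + 2) m‖ ≤ (p : ℝ) ^ (k + 2) * (‖T‖ ^ (k + 1) * ‖T‖) := by
        rw [← pow_succ, ← norm_pow]
        exact norm_powCoeff_le_mul_norm_pow T (k + 2) m
    _ ≤ (p : ℝ) ^ (k + 2) * (((p : ℝ)⁻¹ ^ 3) ^ (k + 1) * ‖T‖) := by gcongr
    _ = ((p : ℝ)⁻¹ ^ 2) ^ k * ((p : ℝ)⁻¹ * ‖T‖) := by rw [← mul_assoc, hcancel, mul_assoc]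
    _ ≤ (p : ℝ)⁻¹ * ‖T‖ := mul_le_of_le_one_left (by positivity)
        (pow_le_one₀ (by positivity) (pow_le_one₀ (by positivity) inv_prime_le_one))

/-- The derivative is `log (1 + T)`, whose leading term `T` dominates the others. -/
lemma exists_hasStrictDerivAt_padicPow {T : ℚ_[p]} (hT : ‖T‖ ≤ (p : ℝ)⁻¹ ^ 3) (hT0 : T ≠ 0) :
    ∃ a ≠ 0, HasStrictDerivAt (padicPow T) a (0 : ℚ_[p]) := by
  have hpow : ∀ k, ‖T ^ k‖ ≤ ((p : ℝ)⁻¹ ^ 3) ^ k := fun k => by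
    rw [norm_pow]
    exact pow_le_pow_left₀ (norm_nonneg _) hT k
  refine ⟨_, ?_, (hasFPowerSeriesAt_padicPow hpow).hasStrictDerivAt⟩
  have hsplit : ∑' k, powCoeff p T k 1 = T + ∑' k, powCoeff p T (k + 2) 1 := by
    rw [← (summable_powCoeff hpow 1).sum_add_tsum_nat_add 2]
    simp [Finset.sum_range_succ, powCoeff, descPochhammer, Polynomial.coeff_one]
  have htail : ‖∑' k, powCoeff p T (k + 2) 1‖ < ‖T‖ :=
    (IsUltrametricDist.norm_tsum_le_of_forall_le fun k => norm_powCoeff_add_two_le hT k 1).trans_lt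
      (mul_lt_of_lt_one_left (norm_pos_iff.2 hT0) (inv_lt_one_of_one_lt₀ one_lt_prime_cast))
  simp only [powSeries, ContinuousMultilinearMap.mkPiRing_apply, Finset.prod_const_one, one_smul,
    hsplit]
  intro hzero
  rw [eq_neg_of_add_eq_zero_right hzero, norm_neg] at htail
  exact htail.false

lemma exists_analyticAt_hasStrictDerivAt_one_add_pow {T : ℚ_[p]} (hT : ‖T‖ ≤ (p : ℝ)⁻¹)
    (hne : ∀ N, (1 + T) ^ p ^ N ≠ 1) :
    ∃ (N : ℕ) (e : ℚ_[p] → ℚ_[p]), AnalyticAt ℚ_[p] e 0 ∧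
      (∃ a ≠ 0, HasStrictDerivAt e a 0) ∧ ∀ s : ℕ, p ^ N ∣ s → e s = (1 + T) ^ s := by
  obtain ⟨N, hN⟩ := exists_norm_one_add_pow_sub_one_le (p := p) (A := ℚ_[p]) norm_one.le
    (hT.trans inv_prime_le_one) (K := 1) (by rwa [pow_one]) 2
  have hpow : ∀ k, ‖((1 + T) ^ p ^ N - 1) ^ k‖ ≤ ((p : ℝ)⁻¹ ^ 3) ^ k := fun k => by
    rw [norm_pow]
    exact pow_le_pow_left₀ (norm_nonneg _) hN k
  obtain ⟨a, ha0, ha⟩ := exists_hasStrictDerivAt_padicPow hN (sub_ne_zero.2 (hne N))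
  have hpN : (p : ℚ_[p]) ^ N ≠ 0 := pow_ne_zero _ (natCast_prime_ne_zero p _)
  refine ⟨N, fun x => padicPow ((1 + T) ^ p ^ N - 1) (((p : ℚ_[p]) ^ N)⁻¹ * x),
    analyticAt_padicPow_const_mul hpow _, ⟨a * ((p : ℚ_[p]) ^ N)⁻¹,
      mul_ne_zero ha0 (inv_ne_zero hpN), ?_⟩, fun _ hs => padicPow_inv_mul_of_dvd hpow hs⟩
  refine HasStrictDerivAt.comp (0 : ℚ_[p]) (h₂ := padicPow ((1 + T) ^ p ^ N - 1)) ?_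
    (by simpa using (hasStrictDerivAt_id (0 : ℚ_[p])).const_mul ((p : ℚ_[p]) ^ N)⁻¹)
  rwa [mul_zero]

end Derivative

end PowAnalytic

section Generators

section Elementary

variable {R ι : Type*} [CommRing R] [Fintype ι] [DecidableEq ι]

lemma one_add_single_pow_of_ne {i j : ι} (hij : i ≠ j) (c : R) (s : ℕ) :
    (1 + Matrix.single i j c) ^ s = 1 + (s * c) • Matrix.single i j (1 : R) := by
  have hsq : Matrix.single i j c * Matrix.single i j c = 0 :=
    Matrix.single_mul_single_of_ne _ _ _ _ hij.symm _
  rw [show (s * c) • Matrix.single i j (1 : R) = s • Matrix.single i j c by simp]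
  induction s with
  | zero => simp
  | succ s ih =>
    rw [pow_succ, ih, mul_add, mul_one, add_mul, one_mul, smul_mul_assoc, hsq, smul_zero, add_zero,
      add_assoc, succ_nsmul]

lemma one_add_single_pow_self (i : ι) (c : R) (s : ℕ) :
    (1 + Matrix.single i i c) ^ s = 1 + ((1 + c) ^ s - 1) • Matrix.single i i (1 : R) := by
  have hc : Matrix.single i i c = c • Matrix.single i i (1 : R) := by simp
  induction s with
  | zero => simp
  | succ s ih =>
    rw [pow_succ, ih, hc, mul_add, mul_one, add_mul, one_mul, smul_mul_smul_comm,
      Matrix.single_mul_single_same, mul_one, add_assoc, ← add_smul, ← add_smul]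
    congr 2
    ring

end Elementary

variable {p : ℕ} [Fact p.Prime] {n : ℕ}

lemma generator_pow_val (ij : Fin n × Fin n) (s : ℕ) :
    ((generator p ij ^ s : GL (Fin n) ℚ_[p]) : Matrix (Fin n) (Fin n) ℚ_[p])
      = (1 + Matrix.single ij.1 ij.2 ((p : ℚ_[p]) ^ kappa p)) ^ s :=
  Units.val_pow_eq_pow_val _ _

lemma norm_prime_pow_kappa_le : ‖(p : ℚ_[p]) ^ kappa p‖ ≤ (p : ℝ)⁻¹ := by
  rw [norm_pow, Padic.norm_p]
  exact pow_le_of_le_one (by positivity) inv_prime_le_one (kappa_pos p).ne'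

lemma one_add_prime_pow_kappa_pow_ne_one (N : ℕ) :
    (1 + (p : ℚ_[p]) ^ kappa p) ^ p ^ N ≠ 1 := by
  have hp := (Fact.out : p.Prime)
  have hlt : 1 < 1 + p ^ kappa p := Nat.lt_add_of_pos_right (pow_pos hp.pos _)
  exact_mod_cast (Nat.one_lt_pow (pow_ne_zero N hp.ne_zero) hlt).ne'

lemma exists_generator_pow (ij : Fin n × Fin n) : ∃ (N : ℕ) (c : ℚ_[p] → ℚ_[p]),
    AnalyticAt ℚ_[p] c 0 ∧ c 0 = 0 ∧ (∃ a ≠ 0, HasStrictDerivAt c a 0) ∧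
      ∀ s : ℕ, p ^ N ∣ s →
        ((generator p ij ^ s : GL (Fin n) ℚ_[p]) : Matrix (Fin n) (Fin n) ℚ_[p])
          = 1 + c s • Matrix.single ij.1 ij.2 (1 : ℚ_[p]) := by
  obtain ⟨i, j⟩ := ij
  simp only [generator_pow_val]
  rcases eq_or_ne i j with rfl | hij
  · obtain ⟨N, e, he, ⟨a, ha0, ha⟩, hes⟩ := exists_analyticAt_hasStrictDerivAt_one_add_pow (p := p)
      norm_prime_pow_kappa_le one_add_prime_pow_kappa_pow_ne_one
    have he0 : e 0 = 1 := by simpa using hes 0 (dvd_zero _)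
    refine ⟨N, fun x => e x - 1, he.sub analyticAt_const, sub_eq_zero.2 he0,
      ⟨a, ha0, ha.sub_const 1⟩, fun s hs => ?_⟩
    rw [one_add_single_pow_self, ← hes s hs]
  · exact ⟨0, fun x => x * (p : ℚ_[p]) ^ kappa p, analyticAt_id.mul analyticAt_const, zero_mul _,
      ⟨_, pow_ne_zero _ (natCast_prime_ne_zero p _),
        by simpa using (hasStrictDerivAt_id (0 : ℚ_[p])).mul_const ((p : ℚ_[p]) ^ kappa p)⟩,
      fun s _ => one_add_single_pow_of_ne hij _ s⟩

end Generators

/-! ### The decay of `b^α v` for a locally analytic vector `v` -/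

section Differences

/-- The coefficient of `f k` in the `j`-th forward difference of `f` at `0`. -/
def diffCoeff (j k : ℕ) : ℤ := (-1) ^ (j - k) * (j.choose k : ℤ)

lemma sub_one_pow_eq_sum_diffCoeff {R : Type*} [Ring R] (S : R) (j : ℕ) :
    (S - 1) ^ j = ∑ k ∈ Finset.range (j + 1), diffCoeff j k • S ^ k := by
  rw [sub_eq_add_neg, (Commute.one_right S).neg_right.add_pow]
  refine Finset.sum_congr rfl fun k _ => ?_
  rw [diffCoeff, zsmul_eq_mul]
  push_cast
  rw [mul_assoc]
  exact ((((Commute.one_left S).neg_left.pow_left _).mul_left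
    (Nat.cast_commute _ S)).pow_right k).eq.symm

lemma sum_diffCoeff_mul_pow {R : Type*} [CommRing R] {j m : ℕ} (h : m < j) :
    ∑ k ∈ Finset.range (j + 1), (diffCoeff j k : R) * (k : R) ^ m = 0 := by
  have hdiff := fwdDiff_iter_eq_sum_shift (1 : R) (fun r => r ^ m) j 0
  rw [fwdDiff_iter_pow_eq_zero_of_lt h] at hdiff
  simpa [diffCoeff, eq_comm] using hdiff

section Multilinear

variable {R M N : Type*} [CommRing R] [AddCommGroup M] [Module R M] [AddCommGroup N] [Module R N]

lemma map_add_smul_eq_sum_piecewise {ι : Type*} [Fintype ι] [DecidableEq ι]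
    (q : MultilinearMap R (fun _ : ι => M) N) (y e : M) (c : R) :
    q (fun _ => y + c • e)
      = ∑ s : Finset ι, c ^ s.card • q (s.piecewise (fun _ => e) fun _ => y) := by
  rw [show (fun _ : ι => y + c • e) = (fun _ => c • e) + fun _ => y from
    funext fun _ => add_comm _ _, MultilinearMap.map_add_univ]
  refine Finset.sum_congr rfl fun s _ => ?_
  have hsmul := q.map_piecewise_smul (fun _ => c) (s.piecewise (fun _ => e) fun _ => y) s
  rw [Finset.prod_const] at hsmul
  rw [← hsmul]
  congr 1
  ext i
  by_cases hi : i ∈ s <;> simp [hi]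

lemma sum_diffCoeff_smul_map_add_smul {j m : ℕ} (h : m < j)
    (q : MultilinearMap R (fun _ : Fin m => M) N) (y e : M) :
    ∑ k ∈ Finset.range (j + 1), diffCoeff j k • q (fun _ => y + (k : R) • e) = 0 := by
  simp only [map_add_smul_eq_sum_piecewise, Finset.smul_sum]
  rw [Finset.sum_comm]
  refine Finset.sum_eq_zero fun s _ => ?_
  have hs : s.card < j := lt_of_le_of_lt (by simpa using s.card_le_univ) h
  simp only [← Int.cast_smul_eq_zsmul R, smul_smul]
  rw [← Finset.sum_smul, sum_diffCoeff_mul_pow hs, zero_smul]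

end Multilinear

variable {E : Type*} [NormedAddCommGroup E] [IsUltrametricDist E]

lemma norm_sum_diffCoeff_le (j : ℕ) {f : ℕ → E} {C : ℝ} (hC : 0 ≤ C)
    (hf : ∀ k, ‖f k‖ ≤ C) : ‖∑ k ∈ Finset.range (j + 1), diffCoeff j k • f k‖ ≤ C :=
  IsUltrametricDist.norm_sum_le_of_forall_le_of_nonneg hC fun k _ =>
    (IsUltrametricDist.norm_zsmul_le _ _).trans (hf k)

/-- The `j`-th difference kills the terms of degree `< j` of the power series of `F`, and the
remainder is geometrically small. -/
lemma exists_norm_diff_le {K W : Type*} [NontriviallyNormedField K] [NormedSpace K E]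
    [NormedAddCommGroup W] [NormedSpace K W] {F : W → E} {w₀ : W} (hF : AnalyticAt K F w₀) :
    ∃ δ > 0, ∃ θ ∈ Set.Ioo (0 : ℝ) 1, ∃ C > 0, ∀ y e : W,
      (∀ k : ℕ, ‖y + (k : K) • e‖ < δ) → ∀ j : ℕ,
      ‖∑ k ∈ Finset.range (j + 1), diffCoeff j k • F (w₀ + (y + (k : K) • e))‖ ≤ C * θ ^ j := by
  obtain ⟨q, r, hr⟩ := hF
  obtain ⟨δ, hδ0, hδr⟩ := ENNReal.lt_iff_exists_nnreal_btwn.1 hr.r_pos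
  obtain ⟨θ, hθ, C, hC, happrox⟩ := hr.uniform_geometric_approx hδr
  refine ⟨δ, by exact_mod_cast hδ0, θ, hθ, C, hC, fun y e hye j => ?_⟩
  have hpartial :
      ∑ k ∈ Finset.range (j + 1), diffCoeff j k • q.partialSum j (y + (k : K) • e) = 0 := by
    simp only [FormalMultilinearSeries.partialSum, Finset.smul_sum]
    rw [Finset.sum_comm]
    exact Finset.sum_eq_zero fun m hm =>
      sum_diffCoeff_smul_map_add_smul (Finset.mem_range.1 hm) (q m).toMultilinearMap y e
  rw [← sub_zero (∑ k ∈ Finset.range (j + 1), diffCoeff j k • F _), ← hpartial,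
    ← Finset.sum_sub_distrib]
  simp only [← smul_sub]
  exact norm_sum_diffCoeff_le j (mul_nonneg hC.le (pow_nonneg hθ.1.le j)) fun k =>
    happrox _ (by simpa using hye k) j

end Differences

section IntOps

variable {p : ℕ} [Fact p.Prime] {n : ℕ}

section Algebra

variable {L : Type u} [NormedField L] {E : Type v} [AddCommGroup E] [Module L E]

/-- The ring of operators generated by `H`, the image of the group ring `ℤ[H]`. -/
def intOps (ρ : Representation L (GL (Fin n) ℚ_[p]) E) : Subring (Module.End L E) :=
  Subring.closure (((H p n).toSubmonoid.map ρ : Submonoid (Module.End L E)) : Set (Module.End L E))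

variable {ρ : Representation L (GL (Fin n) ℚ_[p]) E}

lemma rho_mem_intOps {g : GL (Fin n) ℚ_[p]} (hg : g ∈ H p n) : ρ g ∈ intOps ρ :=
  Subring.subset_closure ⟨g, hg, rfl⟩

lemma intOps_induction {P : Module.End L E → Prop} (hρ : ∀ g ∈ H p n, P (ρ g)) (h0 : P 0)
    (hadd : ∀ A B, P A → P B → P (A + B)) (hneg : ∀ A, P A → P (-A)) {A : Module.End L E}
    (hA : A ∈ intOps ρ) : P A := by
  rw [intOps, Subring.mem_closure_iff, Submonoid.closure_eq] at hA
  refine AddSubgroup.closure_induction (p := fun A _ => P A) ?_ h0 (fun A B _ _ => hadd A B)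
    (fun A _ => hneg A) hA
  rintro _ ⟨g, hg, rfl⟩
  exact hρ g hg

lemma generator_sub_one_mem_intOps (ij : Fin n × Fin n) :
    ρ (generator p ij) - 1 ∈ intOps ρ :=
  sub_mem (rho_mem_intOps (generator_mem_H ij)) (one_mem _)

lemma prod_map_generator_sub_one_pow_mem_intOps (l : List (Fin n × Fin n))
    (α : Fin n × Fin n → ℕ) :
    (l.map fun ij => (ρ (generator p ij) - 1) ^ α ij).prod ∈ intOps ρ :=
  list_prod_mem fun _ hA => by
    obtain ⟨ij, -, rfl⟩ := List.mem_map.1 hA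
    exact pow_mem (generator_sub_one_mem_intOps ij) _

lemma bOp_mem_intOps (α : Fin n × Fin n → ℕ) : bOp ρ α ∈ intOps ρ :=
  prod_map_generator_sub_one_pow_mem_intOps _ α

lemma mem_finRange_product (ij : Fin n × Fin n) : ij ∈ List.finRange n ×ˢ List.finRange n :=
  List.mem_product.2 ⟨List.mem_finRange _, List.mem_finRange _⟩

lemma exists_bOp_eq_mul_pow_mul (α : Fin n × Fin n → ℕ) (ij : Fin n × Fin n) :
    ∃ A ∈ intOps ρ, ∃ B ∈ intOps ρ, bOp ρ α = A * (ρ (generator p ij) - 1) ^ α ij * B := by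
  obtain ⟨s, t, hst⟩ := List.append_of_mem (mem_finRange_product ij)
  refine ⟨_, prod_map_generator_sub_one_pow_mem_intOps s α,
    _, prod_map_generator_sub_one_pow_mem_intOps t α, ?_⟩
  rw [bOp, hst, List.map_append, List.prod_append, List.map_cons, List.prod_cons, mul_assoc]

end Algebra

variable {L : Type u} [NontriviallyNormedField L]
variable {E : Type v} [NormedAddCommGroup E] [NormedSpace L E] [IsUltrametricDist E]
  [CompleteSpace E] {ρ : Representation L (GL (Fin n) ℚ_[p]) E}

/-- By Banach–Steinhaus and the compactness of `H`. -/
lemma IsContinuousRep.exists_bound (hρ : IsContinuousRep ρ) :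
    ∃ R ≥ 1, ∀ A ∈ intOps ρ, ∀ e, ‖A e‖ ≤ R * ‖e‖ := by
  let T : H p n → E →L[L] E := fun g => ⟨ρ g, hρ.continuous_apply g⟩
  obtain ⟨R, hR⟩ := banach_steinhaus (g := T) fun e => by
    have horbit : Continuous fun g : GL (Fin n) ℚ_[p] => ρ g e :=
      hρ.comp (Continuous.prodMk_left e)
    obtain ⟨C, hC⟩ := isCompact_H.exists_bound_of_continuousOn horbit.continuousOn
    exact ⟨C, fun g => hC g g.2⟩
  refine ⟨max R 1, le_max_right _ _, fun A hA =>
    intOps_induction (P := fun A => ∀ e, ‖A e‖ ≤ max R 1 * ‖e‖) ?_ ?_ ?_ ?_ hA⟩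
  · exact fun g hg e => ((T ⟨g, hg⟩).le_opNorm e).trans
      (mul_le_mul_of_nonneg_right ((hR _).trans (le_max_left _ _)) (norm_nonneg _))
  · intro e
    rw [LinearMap.zero_apply, norm_zero]
    positivity
  · exact fun A B hA hB e =>
      (IsUltrametricDist.norm_add_le_max _ _).trans (max_le (hA e) (hB e))
  · exact fun A hA e => by simpa using hA e

end IntOps

section LocalDecay

variable {p : ℕ} [Fact p.Prime] {n : ℕ}

/-- The coordinates of `GL_n(ℚ_p)` in which the locally analytic vectors are defined. -/
def entries (g : GL (Fin n) ℚ_[p]) : Fin n → Fin n → ℚ_[p] := fun i j => g i j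

lemma isEmbedding_entries : IsEmbedding (entries : GL (Fin n) ℚ_[p] → Fin n → Fin n → ℚ_[p]) :=
  isEmbedding_GL_val

/-- Left multiplication by a matrix, in the coordinates `entries`. -/
def leftMul (A : Matrix (Fin n) (Fin n) ℚ_[p]) :
    (Fin n → Fin n → ℚ_[p]) →L[ℚ_[p]] (Fin n → Fin n → ℚ_[p]) :=
  LinearMap.toContinuousLinearMap ((Matrix.ofLinearEquiv ℚ_[p]).symm.toLinearMap ∘ₗ
    LinearMap.mulLeft ℚ_[p] A ∘ₗ (Matrix.ofLinearEquiv ℚ_[p]).toLinearMap)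

lemma leftMul_entries (g g' : GL (Fin n) ℚ_[p]) :
    leftMul (g : Matrix (Fin n) (Fin n) ℚ_[p]) (entries g') = entries (g * g') := rfl

lemma entries_generator_pow_mul {ij : Fin n × Fin n} {s : ℕ} {c : ℚ_[p]}
    (h : ((generator p ij ^ s : GL (Fin n) ℚ_[p]) : Matrix (Fin n) (Fin n) ℚ_[p])
      = 1 + c • Matrix.single ij.1 ij.2 (1 : ℚ_[p])) (g : GL (Fin n) ℚ_[p]) :
    entries (generator p ij ^ s * g)
      = entries g + c • leftMul (Matrix.single ij.1 ij.2 1) (entries g) := by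
  have hval : ((generator p ij ^ s * g : GL (Fin n) ℚ_[p]) : Matrix (Fin n) (Fin n) ℚ_[p])
      = g + c • (Matrix.single ij.1 ij.2 (1 : ℚ_[p]) * (g : Matrix (Fin n) (Fin n) ℚ_[p])) := by
    rw [Units.val_mul, h, add_mul, one_mul, smul_mul_assoc]
  exact hval

lemma norm_natCast_prime_pow_mul_le (N k : ℕ) :
    ‖((p ^ N * k : ℕ) : ℚ_[p])‖ ≤ (p : ℝ)⁻¹ ^ N := by
  rw [Nat.cast_mul, Nat.cast_pow, norm_mul, norm_pow, Padic.norm_p]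
  exact mul_le_of_le_one_right (by positivity) (by simpa using Padic.norm_int_le_one (p := p) k)

section Orbit

variable {E : Type v} [NormedAddCommGroup E] [NormedSpace ℚ_[p] E] {f : GL (Fin n) ℚ_[p] → E}
  {g₀ : GL (Fin n) ℚ_[p]} {F : (Fin n → Fin n → ℚ_[p]) → E}

lemma exists_analyticAt_generator_pow_mul (hF : AnalyticAt ℚ_[p] F (entries g₀))
    (hf : ∀ᶠ g in 𝓝 g₀, f g = F (entries g)) (ij : Fin n × Fin n) :
    ∃ (N : ℕ) (Ψ : ℚ_[p] × (Fin n → Fin n → ℚ_[p]) → E), AnalyticAt ℚ_[p] Ψ (0, entries g₀) ∧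
      ∀ᶠ z in 𝓝 (0, entries g₀), ∀ (s : ℕ) (g : GL (Fin n) ℚ_[p]), p ^ N ∣ s →
        z = ((s : ℚ_[p]), entries g) → Ψ z = f (generator p ij ^ s * g) := by
  obtain ⟨N, c, hc, hc0, -, hpow⟩ := exists_generator_pow (p := p) ij
  let row := leftMul (p := p) (Matrix.single ij.1 ij.2 1)
  let Φ : ℚ_[p] × (Fin n → Fin n → ℚ_[p]) → Fin n → Fin n → ℚ_[p] :=
    fun z => z.2 + c z.1 • row z.2
  have hΦ₀ : Φ (0, entries g₀) = entries g₀ := by simp [Φ, hc0]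
  have hΦ : AnalyticAt ℚ_[p] Φ (0, entries g₀) := by
    have hc' : AnalyticAt ℚ_[p] (fun z : ℚ_[p] × (Fin n → Fin n → ℚ_[p]) => c z.1)
        (0, entries g₀) := AnalyticAt.comp (g := c) hc analyticAt_fst
    exact analyticAt_snd.add (hc'.smul ((row.comp (ContinuousLinearMap.snd ℚ_[p] ℚ_[p]
      (Fin n → Fin n → ℚ_[p]))).analyticAt _))
  have hF' : AnalyticAt ℚ_[p] F (Φ (0, entries g₀)) := by rwa [hΦ₀]
  rw [isEmbedding_entries.nhds_eq_comap, eventually_comap, ← hΦ₀] at hf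
  refine ⟨N, F ∘ Φ, hF'.comp hΦ, (hΦ.continuousAt.eventually hf).mono ?_⟩
  rintro z hz s g hs rfl
  have hentries := entries_generator_pow_mul (hpow s hs) g
  rw [hz _ hentries, hentries]
  rfl

lemma exists_norm_diff_generator_pow_le [IsUltrametricDist E]
    (hF : AnalyticAt ℚ_[p] F (entries g₀)) (hf : ∀ᶠ g in 𝓝 g₀, f g = F (entries g))
    (ij : Fin n × Fin n) :
    ∃ N : ℕ, ∃ θ ∈ Set.Ioo (0 : ℝ) 1, ∃ C > 0, ∀ᶠ g in 𝓝 g₀, ∀ j,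
      ‖∑ k ∈ Finset.range (j + 1), diffCoeff j k • f (generator p ij ^ (p ^ N * k) * g)‖
        ≤ C * θ ^ j := by
  obtain ⟨N₀, Ψ, hΨ, hΨf⟩ := exists_analyticAt_generator_pow_mul hF hf ij
  obtain ⟨δ, hδ, θ, hθ, C, hC, hdiff⟩ := exists_norm_diff_le hΨ
  obtain ⟨δ', hδ', hball⟩ := Metric.eventually_nhds_iff.1 hΨf
  obtain ⟨N₁, hN₁⟩ : ∃ N₁ : ℕ, ((p : ℝ)⁻¹) ^ N₁ < min δ δ' :=
    exists_pow_lt_of_lt_one (lt_min hδ hδ') (inv_lt_one_of_one_lt₀ one_lt_prime_cast)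
  refine ⟨N₀ + N₁, θ, hθ, C, hC, ?_⟩
  filter_upwards [(isEmbedding_entries.continuous.tendsto g₀).eventually
    (Metric.ball_mem_nhds _ (lt_min hδ hδ'))] with g hg j
  have hpoint : ∀ k : ℕ, (0, entries g - entries g₀)
      + (k : ℚ_[p]) • ((p : ℚ_[p]) ^ (N₀ + N₁), (0 : Fin n → Fin n → ℚ_[p]))
      = (((p ^ (N₀ + N₁) * k : ℕ) : ℚ_[p]), entries g - entries g₀) := fun k => by
    simp [mul_comm]
  have hnorm : ∀ k : ℕ,
      ‖(((p ^ (N₀ + N₁) * k : ℕ) : ℚ_[p]), entries g - entries g₀)‖ < min δ δ' := fun k =>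
    max_lt_iff.2 ⟨(norm_natCast_prime_pow_mul_le _ _).trans_lt ((pow_le_pow_of_le_one
      (by positivity) inv_prime_le_one (Nat.le_add_left _ _)).trans_lt hN₁), by
        rwa [← dist_eq_norm]⟩
  have hvalue : ∀ k : ℕ,
      Ψ ((0, entries g₀) + (((p ^ (N₀ + N₁) * k : ℕ) : ℚ_[p]), entries g - entries g₀))
        = f (generator p ij ^ (p ^ (N₀ + N₁) * k) * g) := fun k =>
    hball (by simpa only [dist_eq_norm, add_sub_cancel_left] using
      (hnorm k).trans_le (min_le_right _ _)) _ g
      ((pow_dvd_pow p (Nat.le_add_right _ _)).mul_right k) (by simp)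
  have hj := hdiff (0, entries g - entries g₀) ((p : ℚ_[p]) ^ (N₀ + N₁), 0)
    (fun k => (hpoint k).symm ▸ (hnorm k).trans_le (min_le_left _ _)) j
  simpa only [hpoint, hvalue] using hj

end Orbit

variable {L : Type u} [NontriviallyNormedField L] [NormedAlgebra ℚ_[p] L]
variable {E : Type v} [NormedAddCommGroup E] [NormedSpace L E] [IsUltrametricDist E]
  {ρ : Representation L (GL (Fin n) ℚ_[p]) E}

lemma exists_local_decay {v : E} (hv : v ∈ analyticSubmodule ρ) (ij : Fin n × Fin n)
    (g₀ : GL (Fin n) ℚ_[p]) : ∃ N : ℕ, ∃ θ ∈ Set.Ioo (0 : ℝ) 1, ∃ C > 0, ∀ᶠ g in 𝓝 g₀, ∀ j,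
      ‖((ρ (generator p ij ^ p ^ N) - 1) ^ j) (ρ g v)‖ ≤ C * θ ^ j := by
  let _ : NormedSpace ℚ_[p] E := NormedSpace.restrictScalars ℚ_[p] L E
  obtain ⟨F, hF, hFv⟩ := hv g₀
  obtain ⟨N, θ, hθ, C, hC, h⟩ := exists_norm_diff_generator_pow_le hF hFv ij
  refine ⟨N, θ, hθ, C, hC, h.mono fun g hg j => ?_⟩
  convert hg j using 2
  rw [sub_one_pow_eq_sum_diffCoeff, LinearMap.sum_apply]
  refine Finset.sum_congr rfl fun k _ => ?_
  rw [← map_pow, ← pow_mul, map_mul]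
  rfl

end LocalDecay

section Decay

variable {p : ℕ} [Fact p.Prime] {n : ℕ}

lemma exists_pow_eq_of_mem_Ioo {θ : ℝ} (hθ : θ ∈ Set.Ioo (0 : ℝ) 1) {q : ℕ} (hq : q ≠ 0) :
    ∃ θ' ∈ Set.Ioo (0 : ℝ) 1, θ' ^ q = θ :=
  ⟨θ ^ ((q : ℝ)⁻¹), ⟨Real.rpow_pos_of_pos hθ.1 _, Real.rpow_lt_one hθ.1.le hθ.2 (by positivity)⟩,
    Real.rpow_inv_natCast_pow hθ.1.le hq⟩

lemma exists_sub_one_pow_prime_pow_eq {A : Type*} [Ring A] (S : A) (N : ℕ) :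
    ∃ U, Commute U (S ^ p ^ N - 1) ∧ (S - 1) ^ p ^ N = p * U + (S ^ p ^ N - 1) := by
  obtain ⟨r, hr⟩ := exists_add_pow_prime_pow_eq (Fact.out : p.Prime)
    (Polynomial.X - 1 : Polynomial ℤ) 1 N
  let φ : Polynomial ℤ →+* A := (Polynomial.aeval S : Polynomial ℤ →ₐ[ℤ] A)
  have hφX : φ Polynomial.X = S := Polynomial.aeval_X S
  refine ⟨φ (-((Polynomial.X - 1) * r)), ?_, ?_⟩
  · have h : Commute (-((Polynomial.X - 1) * r)) (Polynomial.X ^ p ^ N - 1) := Commute.all _ _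
    simpa only [map_sub, map_pow, hφX, map_one] using h.map φ
  · have h := congrArg φ hr
    simp only [sub_add_cancel, map_pow, hφX, map_add, map_sub, map_one, map_mul, map_natCast,
      mul_one, one_pow] at h
    rw [h, map_neg, map_mul, map_sub, map_one, hφX]
    noncomm_ring

section Norms

variable {L : Type u} [NontriviallyNormedField L] [NormedAlgebra ℚ_[p] L]
variable {E : Type v} [NormedAddCommGroup E] [NormedSpace L E] [IsUltrametricDist E]

lemma norm_natCast_prime_mul_add_pow_apply_le {U V : Module.End L E} (hUV : Commute U V)
    {R C μ : ℝ} (hR : 0 ≤ R) (hμ : (p : ℝ)⁻¹ ≤ μ) (hU : ∀ i e, ‖(U ^ i) e‖ ≤ R * ‖e‖) {e : E}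
    (hV : ∀ j, ‖(V ^ j) e‖ ≤ C * μ ^ j) (m : ℕ) :
    ‖(((p : Module.End L E) * U + V) ^ m) e‖ ≤ R * C * μ ^ m := by
  have hC : 0 ≤ C := by simpa using (norm_nonneg _).trans (hV 0)
  have hμ0 : 0 ≤ μ := (by positivity : (0 : ℝ) ≤ (p : ℝ)⁻¹).trans hμ
  have hcomm : Commute ((p : Module.End L E) * U) V := (Nat.cast_commute p V).mul_left hUV
  rw [hcomm.add_pow, LinearMap.sum_apply]
  refine IsUltrametricDist.norm_sum_le_of_forall_le_of_nonneg (by positivity) fun i hi => ?_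
  have hterm : (((p : Module.End L E) * U) ^ i * V ^ (m - i) * (m.choose i : Module.End L E)) e
      = m.choose i • (p : L) ^ i • (U ^ i) ((V ^ (m - i)) e) := by
    rw [((Nat.cast_commute p U).mul_pow i), ← Nat.cast_commute, ← nsmul_eq_mul, ← Nat.cast_pow,
      mul_assoc, ← nsmul_eq_mul, ← Nat.cast_pow, Nat.cast_smul_eq_nsmul]
    rfl
  calc ‖(((p : Module.End L E) * U) ^ i * V ^ (m - i) * (m.choose i : Module.End L E)) e‖
      ≤ ‖(p : L) ^ i • (U ^ i) ((V ^ (m - i)) e)‖ := by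
        rw [hterm]
        exact IsUltrametricDist.norm_nsmul_le _ _
    _ = (p : ℝ)⁻¹ ^ i * ‖(U ^ i) ((V ^ (m - i)) e)‖ := by
        rw [norm_smul, norm_pow, norm_natCast_prime]
    _ ≤ μ ^ i * (R * (C * μ ^ (m - i))) := by
        gcongr
        exact (hU i _).trans (mul_le_mul_of_nonneg_left (hV _) hR)
    _ = R * C * μ ^ m := by
        rw [← Nat.add_sub_cancel' (Nat.lt_succ_iff.1 (Finset.mem_range.1 hi)), pow_add,
          Nat.add_sub_cancel_left]
        ring

lemma exists_pow_decay {R : ℝ} (hR : 0 ≤ R) {A : Subring (Module.End L E)}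
    (hA : ∀ T ∈ A, ∀ e, ‖T e‖ ≤ R * ‖e‖) {S : Module.End L E} (hS : S ∈ A) (N : ℕ)
    {θ : ℝ} (hθ : θ ∈ Set.Ioo (0 : ℝ) 1) {C : ℝ} (hC : 0 ≤ C) :
    ∃ θ' ∈ Set.Ioo (0 : ℝ) 1, ∃ C' ≥ 0, ∀ e : E,
      (∀ j, ‖((S ^ p ^ N - 1) ^ j) e‖ ≤ C * θ ^ j) → ∀ k, ‖((S - 1) ^ k) e‖ ≤ C' * θ' ^ k := by
  have hpinv : (p : ℝ)⁻¹ < 1 := inv_lt_one_of_one_lt₀ one_lt_prime_cast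
  have hq : 0 < p ^ N := pow_pos (Fact.out : p.Prime).pos _
  obtain ⟨⟨U, hU⟩, hcomm, hpow⟩ := exists_sub_one_pow_prime_pow_eq (p := p) (⟨S, hS⟩ : A) N
  replace hpow : (S - 1) ^ p ^ N = p * U + (S ^ p ^ N - 1) := congrArg Subtype.val hpow
  set μ := max (p : ℝ)⁻¹ θ
  have hμ : 0 < μ := lt_max_of_lt_right hθ.1
  obtain ⟨θ', hθ', hθq⟩ := exists_pow_eq_of_mem_Ioo ⟨hμ, max_lt hpinv hθ.2⟩ hq.ne'
  refine ⟨θ', hθ', R * (R * C) / μ, by positivity, fun e he k => ?_⟩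
  have hmul : ‖((S - 1) ^ (p ^ N * (k / p ^ N))) e‖ ≤ R * C * μ ^ (k / p ^ N) := by
    rw [pow_mul, hpow]
    exact norm_natCast_prime_mul_add_pow_apply_le (hcomm.map A.subtype) hR (le_max_left _ _)
      (fun i => hA _ (pow_mem hU i)) (fun j => (he j).trans (mul_le_mul_of_nonneg_left
        (pow_le_pow_left₀ hθ.1.le (le_max_right _ _) j) hC)) _
  have hμθ : μ ≤ θ' ^ (k % p ^ N) :=
    hθq.symm.trans_le (pow_le_pow_of_le_one hθ'.1.le hθ'.2.le (Nat.mod_lt _ hq).le)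
  calc ‖((S - 1) ^ k) e‖
      = ‖((S - 1) ^ (k % p ^ N)) (((S - 1) ^ (p ^ N * (k / p ^ N))) e)‖ := by
        rw [← Module.End.mul_apply, ← pow_add, Nat.mod_add_div]
    _ ≤ R * (R * C * μ ^ (k / p ^ N)) :=
        (hA _ (pow_mem (sub_mem hS (one_mem _)) _) _).trans (mul_le_mul_of_nonneg_left hmul hR)
    _ = R * (R * C) / μ * (μ * μ ^ (k / p ^ N)) := by field_simp
    _ ≤ R * (R * C) / μ * (θ' ^ (k % p ^ N) * μ ^ (k / p ^ N)) := by gcongr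
    _ = R * (R * C) / μ * θ' ^ k := by rw [← hθq, ← pow_mul, ← pow_add, Nat.mod_add_div]

variable [CompleteSpace E] {ρ : Representation L (GL (Fin n) ℚ_[p]) E}

lemma exists_generator_decay_on_H (hρ : IsContinuousRep ρ) {v : E} (hv : v ∈ analyticSubmodule ρ)
    (ij : Fin n × Fin n) : ∃ θ ∈ Set.Ioo (0 : ℝ) 1, ∃ C ≥ 0,
      ∀ g ∈ (H p n : Set (GL (Fin n) ℚ_[p])), ∀ k,
        ‖((ρ (generator p ij) - 1) ^ k) (ρ g v)‖ ≤ C * θ ^ k := by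
  obtain ⟨R, hR, hbound⟩ := hρ.exists_bound
  refine isCompact_H.induction_on (p := fun s => ∃ θ ∈ Set.Ioo (0 : ℝ) 1, ∃ C ≥ 0, ∀ g ∈ s, ∀ k,
    ‖((ρ (generator p ij) - 1) ^ k) (ρ g v)‖ ≤ C * θ ^ k) ?_ ?_ ?_ ?_
  · exact ⟨2⁻¹, by norm_num, 0, le_rfl, fun g hg => hg.elim⟩
  · rintro s t hst ⟨θ, hθ, C, hC, h⟩
    exact ⟨θ, hθ, C, hC, fun g hg => h g (hst hg)⟩
  · rintro s t ⟨θ, hθ, C, hC, h⟩ ⟨θ', hθ', C', -, h'⟩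
    refine ⟨max θ θ', ⟨lt_max_of_lt_left hθ.1, max_lt hθ.2 hθ'.2⟩, max C C',
      le_max_of_le_left hC, ?_⟩
    rintro g (hg | hg) k
    · refine (h g hg k).trans ?_
      gcongr
      exacts [pow_nonneg hθ.1.le k, le_max_left _ _, hθ.1.le, le_max_left _ _]
    · refine (h' g hg k).trans ?_
      gcongr
      exacts [pow_nonneg hθ'.1.le k, le_max_right _ _, hθ'.1.le, le_max_right _ _]
  · intro g₀ _
    obtain ⟨N, θ, hθ, C, hC, h⟩ := exists_local_decay hv ij g₀
    obtain ⟨θ', hθ', C', hC', h'⟩ := exists_pow_decay (p := p) (zero_le_one.trans hR) hbound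
      (rho_mem_intOps (generator_mem_H ij)) N hθ hC.le
    exact ⟨_, mem_nhdsWithin_of_mem_nhds h, θ', hθ', C', hC',
      fun g hg => h' _ fun j => map_pow ρ (generator p ij) (p ^ N) ▸ hg j⟩

lemma exists_generator_decay (hρ : IsContinuousRep ρ) {v : E} (hv : v ∈ analyticSubmodule ρ)
    (ij : Fin n × Fin n) : ∃ θ ∈ Set.Ioo (0 : ℝ) 1, ∃ C ≥ 0, ∀ A ∈ intOps ρ, ∀ k,
      ‖((ρ (generator p ij) - 1) ^ k) (A v)‖ ≤ C * θ ^ k := by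
  obtain ⟨θ, hθ, C, hC, h⟩ := exists_generator_decay_on_H hρ hv ij
  refine ⟨θ, hθ, C, hC, fun A hA k =>
    intOps_induction (P := fun A => ‖((ρ (generator p ij) - 1) ^ k) (A v)‖ ≤ C * θ ^ k)
      (fun g hg => h g hg k) ?_ ?_ ?_ hA⟩
  · simpa using mul_nonneg hC (pow_nonneg hθ.1.le k)
  · intro A B hA hB
    rw [LinearMap.add_apply, map_add]
    exact (IsUltrametricDist.norm_add_le_max _ _).trans (max_le hA hB)
  · intro A hA
    rwa [LinearMap.neg_apply, map_neg, norm_neg]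

lemma degree_eq_zero_or_exists_le (α : Fin n × Fin n → ℕ) :
    degree α = 0 ∨ ∃ ij, degree α ≤ Fintype.card (Fin n × Fin n) * α ij := by
  rcases isEmpty_or_nonempty (Fin n × Fin n) with _ | _
  · exact Or.inl (Finset.sum_of_isEmpty _)
  · obtain ⟨ij, -, hij⟩ := Finset.exists_max_image Finset.univ α Finset.univ_nonempty
    exact Or.inr ⟨ij, Finset.sum_le_card_nsmul _ _ (α ij) fun i hi => hij i hi⟩

/-- Since `bOp ρ α` is a product `A * (h_ij - 1) ^ α_ij * B` with `A` and `B` in the group ring of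
`H`, it suffices to use the decay in the largest exponent `α_ij`. -/
lemma exists_bOp_decay (hρ : IsContinuousRep ρ) {v : E} (hv : v ∈ analyticSubmodule ρ) :
    ∃ θ ∈ Set.Ioo (0 : ℝ) 1, ∃ C, ∀ A ∈ intOps ρ, ∀ α, ‖bOp ρ α (A v)‖ ≤ C * θ ^ degree α := by
  obtain ⟨R, hR, hbound⟩ := hρ.exists_bound
  have hR0 : 0 ≤ R := zero_le_one.trans hR
  choose θ hθ C hC h using exists_generator_decay hρ hv
  obtain ⟨μ, hμ, hμ0⟩ : ∃ μ : ℝ, (∀ ij, θ ij < μ) ∧ μ ∈ Set.Ioo (0 : ℝ) 1 :=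
    ((eventually_all.2 fun ij => eventually_nhdsWithin_of_eventually_nhds
      (lt_mem_nhds (hθ ij).2)).and (Ioo_mem_nhdsLT (zero_lt_one (α := ℝ)))).exists
  obtain ⟨θ', hθ', hθq⟩ := exists_pow_eq_of_mem_Ioo hμ0
    (q := Fintype.card (Fin n × Fin n) + 1) (Nat.succ_ne_zero _)
  have hsum0 : 0 ≤ ∑ ij, C ij := Finset.sum_nonneg fun i _ => hC i
  refine ⟨θ', hθ', R * (∑ ij, C ij) + R * ‖v‖, fun A hA α => ?_⟩
  rcases degree_eq_zero_or_exists_le α with hα | ⟨ij, hdeg⟩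
  · rw [hα, pow_zero, mul_one]
    exact (hbound _ (mul_mem (bOp_mem_intOps α) hA) v).trans
      (le_add_of_nonneg_left (mul_nonneg hR0 hsum0))
  · obtain ⟨B, hB, B', hB', hBB'⟩ := exists_bOp_eq_mul_pow_mul (ρ := ρ) α ij
    have hθα : θ ij ^ α ij ≤ θ' ^ degree α :=
      calc θ ij ^ α ij ≤ μ ^ α ij := pow_le_pow_left₀ (hθ ij).1.le (hμ ij).le _
        _ = θ' ^ ((Fintype.card (Fin n × Fin n) + 1) * α ij) := by rw [← hθq, ← pow_mul]
        _ ≤ θ' ^ degree α := pow_le_pow_of_le_one hθ'.1.le hθ'.2.le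
            (hdeg.trans (Nat.mul_le_mul_right _ (Nat.le_succ _)))
    calc ‖bOp ρ α (A v)‖ = ‖B (((ρ (generator p ij) - 1) ^ α ij) ((B' * A) v))‖ := by
          rw [hBB']
          rfl
      _ ≤ R * (C ij * θ ij ^ α ij) :=
          (hbound B hB _).trans (mul_le_mul_of_nonneg_left (h ij _ (mul_mem hB' hA) _) hR0)
      _ ≤ R * ((∑ ij, C ij) * θ' ^ degree α) := by
          gcongr
          · exact pow_nonneg (hθ ij).1.le _
          · exact Finset.single_le_sum (fun i _ => hC i) (Finset.mem_univ ij)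
      _ ≤ (R * (∑ ij, C ij) + R * ‖v‖) * θ' ^ degree α := by
          rw [← mul_assoc]
          exact mul_le_mul_of_nonneg_right (le_add_of_nonneg_right (by positivity))
            (pow_nonneg hθ'.1.le _)

lemma tendsto_degree : Tendsto (degree (n := n)) cofinite atTop := by
  refine tendsto_atTop.2 fun k => eventually_cofinite.2 ?_
  refine (Set.finite_Iic (fun _ : Fin n × Fin n => k)).subset fun α hα ij => ?_
  exact (Finset.single_le_sum (fun _ _ => Nat.zero_le _) (Finset.mem_univ ij)).trans
    (not_le.1 hα).le

lemma tendsto_radius : Tendsto (radius p) atTop (𝓝 0) := by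
  have hpow : Tendsto (fun h : ℕ => (p : ℝ) ^ (h - 1)) atTop atTop :=
    (tendsto_pow_atTop_atTop_of_one_lt one_lt_prime_cast).comp (tendsto_sub_atTop_nat 1)
  exact (hpow.atTop_mul_const (sub_pos.2 (one_lt_prime_cast (p := p)))).inv_tendsto_atTop.congr
    fun h => (one_div _).symm

lemma eventually_exists_tendsto_weight_mul_norm_bOp_le (hρ : IsContinuousRep ρ) {v : E}
    (hv : v ∈ analyticSubmodule ρ) :
    ∀ᶠ h in atTop, ∃ b : (Fin n × Fin n → ℕ) → ℝ, Tendsto b cofinite (𝓝 0) ∧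
      ∀ A ∈ intOps ρ, ∀ α, (p : ℝ) ^ (radius p h * degree α) * ‖bOp ρ α (A v)‖ ≤ b α := by
  obtain ⟨θ, hθ, C, hdecay⟩ := exists_bOp_decay hρ hv
  have hp0 : (0 : ℝ) < p := one_pos.trans one_lt_prime_cast
  have hlim : Tendsto (fun h : ℕ => (p : ℝ) ^ radius p h * θ) atTop (𝓝 θ) := by
    simpa using ((Real.continuous_const_rpow hp0.ne').tendsto 0 |>.comp
      (tendsto_radius (p := p))).mul_const θ
  filter_upwards [hlim.eventually (gt_mem_nhds hθ.2)] with h hh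
  refine ⟨fun α => C * ((p : ℝ) ^ radius p h * θ) ^ degree α, ?_, fun A hA α => ?_⟩
  · simpa using ((tendsto_pow_atTop_nhds_zero_of_lt_one (mul_nonneg (by positivity) hθ.1.le)
      hh).comp (tendsto_degree (n := n))).const_mul C
  · calc (p : ℝ) ^ (radius p h * degree α) * ‖bOp ρ α (A v)‖
        ≤ (p : ℝ) ^ (radius p h * degree α) * (C * θ ^ degree α) := by
          gcongr
          exact hdecay A hA α
      _ = C * ((p : ℝ) ^ radius p h * θ) ^ degree α := by
          rw [mul_pow, Real.rpow_mul_natCast hp0.le]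
          ring

lemma eventually_mem_PiH (hρ : IsContinuousRep ρ) {v : E} (hv : v ∈ analyticSubmodule ρ) :
    ∀ᶠ h in atTop, (∀ g ∈ H p n, ρ g v ∈ PiH ρ h) ∧
      ∀ ε > 0, ∀ᶠ g in 𝓝 (1 : GL (Fin n) ℚ_[p]), normH ρ h (ρ g v - v) ≤ ε := by
  filter_upwards [eventually_exists_tendsto_weight_mul_norm_bOp_le hρ hv] with h ⟨b, hb, hle⟩
  refine ⟨fun g hg => squeeze_zero (fun α => by positivity) (hle _ (rho_mem_intOps hg)) hb,
    fun ε hε => ?_⟩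
  have hsmall : ∀ α ∈ {α | ¬ b α < ε}, ∀ᶠ g in 𝓝 (1 : GL (Fin n) ℚ_[p]),
      (p : ℝ) ^ (radius p h * degree α) * ‖bOp ρ α (ρ g v - v)‖ < ε := fun α _ => by
    have horbit : Continuous fun g : GL (Fin n) ℚ_[p] => ρ g v :=
      hρ.comp (Continuous.prodMk_left v)
    have hterm : Continuous fun g : GL (Fin n) ℚ_[p] =>
        (p : ℝ) ^ (radius p h * degree α) * ‖bOp ρ α (ρ g v - v)‖ :=
      ((hρ.continuous_bOp α).comp (horbit.sub continuous_const)).norm.const_mul _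
    exact (hterm.tendsto 1).eventually (gt_mem_nhds (by simpa using hε))
  filter_upwards [((eventually_cofinite.1 (hb.eventually (gt_mem_nhds hε))).eventually_all).2
    hsmall, isOpen_H.mem_nhds (one_mem (H p n))] with g hg hgH
  refine ciSup_le fun α => ?_
  by_cases hα : b α < ε
  · exact (hle (ρ g - 1) (sub_mem (rho_mem_intOps hgH) (one_mem _)) α).trans hα.le
  · exact (hg α hα).le

end Norms

end Decay

/-! ### The analyticity of the vectors of `Π^(h)` -/

section Mahler

open BoundedContinuousFunction

lemma list_prod_one_add_pow_mem_closure {ι R : Type*} [Semiring R] (u : ι → R) (x : ι → ℕ)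
    {l : List ι} (hl : l.Nodup) : (l.map fun i => (1 + u i) ^ x i).prod ∈
      AddSubmonoid.closure (Set.range fun α : ι → ℕ => (l.map fun i => u i ^ α i).prod) := by
  classical
  induction l with
  | nil => exact AddSubmonoid.subset_closure ⟨0, rfl⟩
  | cons i l ih =>
    rw [List.nodup_cons] at hl
    have hmul : ∀ k, ∀ a ∈ AddSubmonoid.closure
        (Set.range fun α : ι → ℕ => (l.map fun i => u i ^ α i).prod), u i ^ k * a ∈
        AddSubmonoid.closure
          (Set.range fun α : ι → ℕ => ((i :: l).map fun i => u i ^ α i).prod) := by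
      intro k a ha
      induction ha using AddSubmonoid.closure_induction with
      | zero => simp
      | add a b _ _ ha hb => exact mul_add (u i ^ k) a b ▸ add_mem ha hb
      | mem a ha =>
        obtain ⟨α, rfl⟩ := ha
        refine AddSubmonoid.subset_closure ⟨Function.update α i k, ?_⟩
        have hl' : ∀ j ∈ l, u j ^ Function.update α i k j = u j ^ α j := fun j hj => by
          rw [Function.update_of_ne (ne_of_mem_of_not_mem hj hl.1)]
        simp only [List.map_cons, List.prod_cons, Function.update_self, List.map_congr_left hl']
    rw [List.map_cons, List.prod_cons, add_comm, (Commute.one_right (u i)).add_pow, Finset.sum_mul]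
    refine sum_mem fun k _ => ?_
    rw [one_pow, mul_one, ← Nat.cast_comm, ← nsmul_eq_mul, smul_mul_assoc]
    exact nsmul_mem (hmul k _ (ih hl.2)) _

lemma apply_list_prod_one_add_pow_eq {ι A R B F G : Type*} [Semiring A] [Semiring R]
    [AddCommMonoid B] [FunLike F A B] [AddMonoidHomClass F A B] [FunLike G R B]
    [AddMonoidHomClass G R B] {f : F} {g : G} {t : ι → A} {u : ι → R} {l : List ι} (hl : l.Nodup)
    (hfg : ∀ α : ι → ℕ, f (l.map fun i => t i ^ α i).prod = g (l.map fun i => u i ^ α i).prod)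
    (x : ι → ℕ) :
    f (l.map fun i => (1 + t i) ^ x i).prod = g (l.map fun i => (1 + u i) ^ x i).prod := by
  let f' : A × R →+ B := (f : A →+ B).comp (AddMonoidHom.fst A R)
  let g' : A × R →+ B := (g : R →+ B).comp (AddMonoidHom.snd A R)
  have hprod : ∀ w : ι → A × R,
      (l.map w).prod = ((l.map fun i => (w i).1).prod, (l.map fun i => (w i).2).prod) := fun w =>
    Prod.ext ((map_list_prod (RingHom.fst A R) _).trans (by rw [List.map_map]; rfl))
      ((map_list_prod (RingHom.snd A R) _).trans (by rw [List.map_map]; rfl))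
  have hmon : Set.EqOn f' g' (Set.range fun α : ι → ℕ => (l.map fun i => (t i, u i) ^ α i).prod) :=
    Set.forall_mem_range.2 fun α => by
      rw [hprod]
      exact hfg α
  have h := AddMonoidHom.eqOn_closureM hmon
    (list_prod_one_add_pow_mem_closure (fun i => (t i, u i)) x hl)
  rwa [hprod] at h

lemma analyticAt_list_prod_apply {𝕜 ι A : Type*} [NontriviallyNormedField 𝕜] [Fintype ι]
    [NormedRing A] [NormedAlgebra 𝕜 A] {e : ι → 𝕜 → A} (he : ∀ i, AnalyticAt 𝕜 (e i) 0)
    (l : List ι) : AnalyticAt 𝕜 (fun x : ι → 𝕜 => (l.map fun i => e i (x i)).prod) 0 := by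
  induction l with
  | nil => exact analyticAt_const
  | cons i l ih =>
    simp only [List.map_cons, List.prod_cons]
    have hei : AnalyticAt 𝕜 (fun x : ι → 𝕜 => e i (x i)) 0 := AnalyticAt.comp (g := e i)
      (he i) ((ContinuousLinearMap.proj (R := 𝕜) (φ := fun _ : ι => 𝕜) i).analyticAt 0)
    exact hei.mul ih

instance isUltrametricDist_boundedContinuousFunction {X Y : Type*} [TopologicalSpace X]
    [PseudoMetricSpace Y] [IsUltrametricDist Y] : IsUltrametricDist (X →ᵇ Y) :=
  ⟨fun _ g _ => (dist_le (le_max_of_le_left dist_nonneg)).2 fun x =>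
    (dist_triangle_max _ (g x) _).trans (max_le_max (dist_coe_le_dist x) (dist_coe_le_dist x))⟩

instance isUltrametricDist_continuousLinearMap {𝕜 V W : Type*} [NontriviallyNormedField 𝕜]
    [SeminormedAddCommGroup V] [NormedSpace 𝕜 V] [SeminormedAddCommGroup W] [NormedSpace 𝕜 W]
    [IsUltrametricDist W] : IsUltrametricDist (V →L[𝕜] W) :=
  IsUltrametricDist.isUltrametricDist_of_forall_norm_add_le_max_norm fun A B =>
    ContinuousLinearMap.opNorm_le_bound _ (le_max_of_le_left (norm_nonneg A)) fun x => by
      rw [max_mul_of_nonneg _ _ (norm_nonneg x)]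
      exact (IsUltrametricDist.norm_add_le_max _ _).trans
        (max_le_max (A.le_opNorm x) (B.le_opNorm x))

variable {p : ℕ} [Fact p.Prime] {ι : Type*} [Fintype ι]
variable {E : Type*} [NormedAddCommGroup E] [NormedSpace ℚ_[p] E] {K : ℕ}

variable (p K) in
/-- The weight `p ^ ⌊|β| / K⌋` of the multi-index `β`, which the coefficients of a Mahler series
are divided by to make them bounded. -/
def shiftWeight (β : ι → ℕ) : ℚ_[p] := (p : ℚ_[p]) ^ ((∑ i, β i) / K)

lemma shiftWeight_ne_zero (β : ι → ℕ) : shiftWeight p K β ≠ 0 :=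
  pow_ne_zero _ (by exact_mod_cast (Fact.out : p.Prime).ne_zero)

lemma shiftWeight_zero : shiftWeight p K (0 : ι → ℕ) = 1 := by
  simp [shiftWeight]

lemma norm_shiftWeight (β : ι → ℕ) :
    ‖shiftWeight p K β‖ = (p : ℝ)⁻¹ ^ ((∑ i, β i) / K) := by
  rw [shiftWeight, norm_pow, Padic.norm_p]

lemma norm_shiftWeight_add_le (β σ : ι → ℕ) :
    ‖shiftWeight p K (β + σ)‖ ≤ ‖shiftWeight p K β‖ := by
  rw [norm_shiftWeight, norm_shiftWeight]
  exact pow_le_pow_of_le_one (by positivity) inv_prime_le_one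
    (Nat.div_le_div_right (Finset.sum_le_sum fun i _ => Nat.le_add_right _ _))

lemma norm_shiftWeight_add_nsmul_single [DecidableEq ι] (hK : 0 < K) (β : ι → ℕ) (i : ι) :
    ‖shiftWeight p K (β + K • Pi.single i 1)‖ = (p : ℝ)⁻¹ * ‖shiftWeight p K β‖ := by
  have hsum : ∑ j, (β + K • Pi.single i 1 : ι → ℕ) j = ∑ j, β j + K := by
    simp [Finset.sum_add_distrib, Pi.single_apply]
  rw [norm_shiftWeight, norm_shiftWeight, hsum, Nat.add_div_right _ hK, pow_succ']

lemma norm_inv_shiftWeight_smul_le (c : (ι → ℕ) →ᵇ E) (σ β : ι → ℕ) :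
    ‖(shiftWeight p K β)⁻¹ • shiftWeight p K (β + σ) • c (β + σ)‖
      ≤ ‖shiftWeight p K (β + σ)‖ / ‖shiftWeight p K β‖ * ‖c‖ := by
  rw [smul_smul, norm_smul, norm_mul, norm_inv, inv_mul_eq_div]
  exact mul_le_mul_of_nonneg_left (c.norm_coe_le_norm _) (by positivity)

lemma norm_shiftWeight_add_div_le_one (β σ : ι → ℕ) :
    ‖shiftWeight p K (β + σ)‖ / ‖shiftWeight p K β‖ ≤ 1 :=
  div_le_one_of_le₀ (norm_shiftWeight_add_le β σ) (norm_nonneg _)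

variable (p E K) in
/-- Translation by `σ` on families of coefficients which have been divided by `shiftWeight p K`. -/
def weightedShift (σ : ι → ℕ) : ((ι → ℕ) →ᵇ E) →L[ℚ_[p]] ((ι → ℕ) →ᵇ E) :=
  have hle : ∀ (c : (ι → ℕ) →ᵇ E) β,
      ‖(shiftWeight p K β)⁻¹ • shiftWeight p K (β + σ) • c (β + σ)‖ ≤ 1 * ‖c‖ := fun c β =>
    (norm_inv_shiftWeight_smul_le c σ β).trans
      (mul_le_mul_of_nonneg_right (norm_shiftWeight_add_div_le_one β σ) (norm_nonneg c))
  LinearMap.mkContinuous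
    { toFun := fun c => ofNormedAddCommGroup
        (fun β => (shiftWeight p K β)⁻¹ • shiftWeight p K (β + σ) • c (β + σ))
        continuous_of_discreteTopology (1 * ‖c‖) (hle c)
      map_add' := fun c d => by
        ext β
        simp
      map_smul' := fun a c => by
        ext β
        simp [smul_comm _ a] }
    1 fun c => (norm_le (mul_nonneg zero_le_one (norm_nonneg c))).2 (hle c)

lemma weightedShift_apply (σ : ι → ℕ) (c : (ι → ℕ) →ᵇ E) (β : ι → ℕ) :
    weightedShift p E K σ c β
      = (shiftWeight p K β)⁻¹ • shiftWeight p K (β + σ) • c (β + σ) := rfl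

lemma norm_weightedShift_le_one (σ : ι → ℕ) : ‖weightedShift p E K σ‖ ≤ 1 :=
  ContinuousLinearMap.opNorm_le_bound _ zero_le_one fun c =>
    (norm_le (by positivity)).2 fun β => (norm_inv_shiftWeight_smul_le c σ β).trans
      (mul_le_mul_of_nonneg_right (norm_shiftWeight_add_div_le_one β σ) (norm_nonneg c))

lemma weightedShift_zero : weightedShift p E K (0 : ι → ℕ) = 1 := by
  ext c β
  rw [weightedShift_apply, add_zero, smul_smul, inv_mul_cancel₀ (shiftWeight_ne_zero β), one_smul,
    one_apply_eq_self]

lemma weightedShift_add (σ τ : ι → ℕ) :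
    weightedShift p E K (σ + τ) = weightedShift p E K σ * weightedShift p E K τ := by
  ext c β
  rw [mul_apply_eq_comp, weightedShift_apply, weightedShift_apply,
    weightedShift_apply, smul_smul (shiftWeight p K (β + σ)),
    mul_inv_cancel₀ (shiftWeight_ne_zero _), one_smul, add_assoc]

variable (p E K) in
/-- The representation of the monoid of multi-indices by the weighted translations. -/
def weightedShiftHom :
    Multiplicative (ι → ℕ) →* (((ι → ℕ) →ᵇ E) →L[ℚ_[p]] ((ι → ℕ) →ᵇ E)) where
  toFun σ := weightedShift p E K σ.toAdd
  map_one' := weightedShift_zero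
  map_mul' σ τ := weightedShift_add σ.toAdd τ.toAdd

lemma weightedShift_pow (σ : ι → ℕ) (k : ℕ) :
    weightedShift p E K σ ^ k = weightedShift p E K (k • σ) :=
  (map_pow (weightedShiftHom p E K) (Multiplicative.ofAdd σ) k).symm

lemma list_prod_weightedShift_single_pow [DecidableEq ι] {l : List ι} (hl : l.Nodup)
    (hmem : ∀ i, i ∈ l) (α : ι → ℕ) :
    (l.map fun i => weightedShift p E K (Pi.single i 1) ^ α i).prod = weightedShift p E K α := by
  have hprod : (l.map fun i => Multiplicative.ofAdd (Pi.single i 1 : ι → ℕ) ^ α i).prod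
      = Multiplicative.ofAdd α := by
    rw [← List.prod_toFinset _ hl,
      Finset.eq_univ_iff_forall.2 fun i => List.mem_toFinset.2 (hmem i)]
    simp only [← ofAdd_nsmul, ← ofAdd_sum]
    congr 1
    ext j
    simp [Finset.sum_apply, Pi.single_apply]
  have h := congrArg (weightedShiftHom p E K) hprod
  rw [map_list_prod, List.map_map] at h
  simp only [Function.comp_def, map_pow] at h
  exact h

lemma norm_weightedShift_single_pow_le [DecidableEq ι] (hK : 0 < K) (i : ι) :
    ‖weightedShift p E K (Pi.single i 1) ^ K‖ ≤ (p : ℝ)⁻¹ := by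
  rw [weightedShift_pow]
  refine ContinuousLinearMap.opNorm_le_bound _ (by positivity) fun c =>
    (norm_le (by positivity)).2 fun β => (norm_inv_shiftWeight_smul_le c _ β).trans_eq ?_
  rw [norm_shiftWeight_add_nsmul_single hK,
    mul_div_cancel_right₀ _ (norm_ne_zero_iff.2 (shiftWeight_ne_zero β))]

/-- The coefficients `ψ (u ^ α)` of the Mahler series of `x ↦ ψ (∏ (1 + u_i) ^ x_i)` are realized by
commuting operators: `ψ (u ^ α) = (T ^ α c) 0`, where the `T_i` are weighted translations. As
`‖T_i ^ K‖ ≤ p⁻¹`, the power functions `x ↦ (1 + T_i) ^ x` are analytic near `0`. -/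
lemma exists_analyticAt_list_prod_one_add_pow [IsUltrametricDist E] [CompleteSpace E] (hK : 0 < K)
    {l : List ι} (hl : l.Nodup) (hmem : ∀ i, i ∈ l) {R : Type*} [Semiring R] {u : ι → R}
    {ψ : R →+ E} {C : ℝ}
    (hψ : ∀ α : ι → ℕ, (p : ℝ) ^ ((∑ i, α i) / K) * ‖ψ (l.map fun i => u i ^ α i).prod‖ ≤ C) :
    ∃ (N : ℕ) (S : (ι → ℚ_[p]) → E), AnalyticAt ℚ_[p] S 0 ∧ ∀ x : ι → ℕ, (∀ i, p ^ N ∣ x i) →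
      S (fun i => x i) = ψ (l.map fun i => (1 + u i) ^ x i).prod := by
  classical
  let W := (ι → ℕ) →ᵇ E
  let T : ι → W →L[ℚ_[p]] W := fun i => weightedShift p E K (Pi.single i 1)
  choose N e he hes using fun i => exists_analyticAt_one_add_pow (p := p)
    (ContinuousLinearMap.norm_id_le (𝕜 := ℚ_[p]) (E := W)) (norm_weightedShift_le_one _)
    (norm_weightedShift_single_pow_le hK i)
  let c : W := ofNormedAddCommGroup
    (fun α => (shiftWeight p K α)⁻¹ • ψ (l.map fun i => u i ^ α i).prod)
    continuous_of_discreteTopology C fun α => by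
      rw [norm_smul, norm_inv, norm_shiftWeight, ← inv_pow, inv_inv]
      exact hψ α
  let ev : (W →L[ℚ_[p]] W) →L[ℚ_[p]] E :=
    (evalCLM ℚ_[p] (0 : ι → ℕ)).comp (ContinuousLinearMap.apply ℚ_[p] W c)
  have hev : ∀ α, ev (weightedShift p E K α) = ψ (l.map fun i => u i ^ α i).prod := fun α => by
    change weightedShift p E K α c 0 = _
    rw [weightedShift_apply, zero_add, shiftWeight_zero, inv_one, one_smul]
    exact smul_inv_smul₀ (shiftWeight_ne_zero α) _
  refine ⟨∑ i, N i, fun x => ev (l.map fun i => e i (x i)).prod,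
    (ev.analyticAt _).comp (analyticAt_list_prod_apply he l), fun x hx => ?_⟩
  have hpow : (l.map fun i => e i (x i)) = l.map fun i => (1 + T i) ^ x i :=
    List.map_congr_left fun i _ => hes i (x i) ((pow_dvd_pow p
      (Finset.single_le_sum (fun _ _ => Nat.zero_le _) (Finset.mem_univ i))).trans (hx i))
  simp only [hpow]
  exact apply_list_prod_one_add_pow_eq hl (fun α =>
    (congrArg ev (list_prod_weightedShift_single_pow hl hmem α)).trans (hev α)) x

end Mahler

section Coordinates

lemma hasStrictFDerivAt_list_prod_apply {𝕜 ι A : Type*} [NontriviallyNormedField 𝕜] [Finite ι]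
    [NormedRing A] [NormedAlgebra 𝕜 A] {e : ι → 𝕜 → A} (h1 : ∀ i, e i 0 = 1) {D : ι → A}
    (he : ∀ i, HasStrictDerivAt (e i) (D i) 0) (l : List ι) :
    HasStrictFDerivAt (fun x : ι → 𝕜 => (l.map fun i => e i (x i)).prod)
      (l.map fun i => (ContinuousLinearMap.proj (R := 𝕜) (φ := fun _ : ι => 𝕜) i).smulRight
        (D i)).sum 0 := by
  have := Fintype.ofFinite ι
  induction l with
  | nil => exact hasStrictFDerivAt_const _ _
  | cons i l ih =>
    simp only [List.map_cons, List.prod_cons, List.sum_cons]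
    let π := ContinuousLinearMap.proj (R := 𝕜) (φ := fun _ : ι => 𝕜) i
    have hei : HasStrictFDerivAt (fun x : ι → 𝕜 => e i (x i)) (π.smulRight (D i)) 0 := by
      refine (HasStrictFDerivAt.comp (f := π) 0 (he i).hasStrictFDerivAt
        π.hasStrictFDerivAt).congr_fderiv ?_
      ext x
      simp
    have hprod : (l.map fun i => e i 0).prod = 1 :=
      List.prod_eq_one (List.forall_mem_map.2 fun i _ => h1 i)
    refine (hei.mul' ih).congr_fderiv ?_
    simp only [Pi.zero_apply]
    rw [h1, hprod, one_smul, MulOpposite.op_one, one_smul, add_comm]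

variable {p : ℕ} [Fact p.Prime] {n : ℕ}

lemma leftMul_entries_one (A : Matrix (Fin n) (Fin n) ℚ_[p]) :
    leftMul A (entries 1) = fun i j => A i j :=
  congrArg (fun B i j => B i j) (mul_one A)

/-- Left multiplication by the matrix `1 + c(t) E_ij`, as a function of `t`. -/
def coordFactor (c : ℚ_[p] → ℚ_[p]) (ij : Fin n × Fin n) (t : ℚ_[p]) :
    (Fin n → Fin n → ℚ_[p]) →L[ℚ_[p]] (Fin n → Fin n → ℚ_[p]) :=
  1 + c t • leftMul (Matrix.single ij.1 ij.2 1)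

lemma coordFactor_zero {c : ℚ_[p] → ℚ_[p]} (hc : c 0 = 0) (ij : Fin n × Fin n) :
    coordFactor c ij 0 = 1 := by
  rw [coordFactor, hc]
  exact (congrArg _ (zero_smul ℚ_[p] (leftMul (Matrix.single ij.1 ij.2 (1 : ℚ_[p]))))).trans
    (add_zero 1)

/-- The entries of the ordered product of the matrices `1 + c_ij(ξ_ij) E_ij`, as a function of the
coordinates `ξ_ij`. For the functions `c_ij` with `h_ij ^ s = 1 + c_ij(s) E_ij`, these are the
coordinates of the second kind on a neighbourhood of `1`. -/
def coordMap (c : Fin n × Fin n → ℚ_[p] → ℚ_[p]) (l : List (Fin n × Fin n))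
    (ξ : Fin n × Fin n → ℚ_[p]) : Fin n → Fin n → ℚ_[p] :=
  (l.map fun ij => coordFactor (c ij) ij (ξ ij)).prod (entries 1)

variable {c : Fin n × Fin n → ℚ_[p] → ℚ_[p]}

lemma analyticAt_coordMap (hc : ∀ ij, AnalyticAt ℚ_[p] (c ij) 0) (l : List (Fin n × Fin n)) :
    AnalyticAt ℚ_[p] (coordMap c l) 0 :=
  AnalyticAt.comp (g := fun A : (Fin n → Fin n → ℚ_[p]) →L[ℚ_[p]] _ => A (entries 1))
    ((ContinuousLinearMap.apply ℚ_[p] (Fin n → Fin n → ℚ_[p]) (entries 1)).analyticAt _)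
    (analyticAt_list_prod_apply (fun ij => analyticAt_const.add ((hc ij).smul analyticAt_const)) l)

lemma coordMap_natCast {x : Fin n × Fin n → ℕ} (l : List (Fin n × Fin n))
    (hc : ∀ ij, ((generator p ij ^ x ij : GL (Fin n) ℚ_[p]) : Matrix (Fin n) (Fin n) ℚ_[p])
      = 1 + c ij (x ij) • Matrix.single ij.1 ij.2 (1 : ℚ_[p])) :
    coordMap c l (fun ij => x ij) = entries (l.map fun ij => generator p ij ^ x ij).prod := by
  induction l with
  | nil => rfl
  | cons ij l ih =>
    rw [List.map_cons, List.prod_cons, entries_generator_pow_mul (hc ij), ← ih]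
    rfl

lemma coordMap_zero (hc : ∀ ij, c ij 0 = 0) (l : List (Fin n × Fin n)) :
    coordMap c l 0 = entries 1 := by
  have hprod : (l.map fun ij => coordFactor (c ij) ij 0).prod = 1 :=
    List.prod_eq_one (List.forall_mem_map.2 fun ij _ => coordFactor_zero (hc ij) ij)
  exact congrArg (fun A : (Fin n → Fin n → ℚ_[p]) →L[ℚ_[p]] _ => A (entries 1)) hprod

lemma exists_hasStrictFDerivAt_coordMap (hc : ∀ ij, c ij 0 = 0)
    (hca : ∀ ij, ∃ a ≠ 0, HasStrictDerivAt (c ij) a 0) {l : List (Fin n × Fin n)} (hl : l.Nodup)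
    (hmem : ∀ ij, ij ∈ l) :
    ∃ T : (Fin n × Fin n → ℚ_[p]) ≃L[ℚ_[p]] (Fin n → Fin n → ℚ_[p]),
      HasStrictFDerivAt (coordMap c l)
        (T : (Fin n × Fin n → ℚ_[p]) →L[ℚ_[p]] (Fin n → Fin n → ℚ_[p])) 0 := by
  choose a ha0 ha using hca
  let T : (Fin n × Fin n → ℚ_[p]) ≃ₗ[ℚ_[p]] (Fin n → Fin n → ℚ_[p]) :=
    (LinearEquiv.piCongrRight fun ij => LinearEquiv.smulOfNeZero ℚ_[p] ℚ_[p] (a ij) (ha0 ij)) ≪≫ₗ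
      LinearEquiv.curry ℚ_[p] ℚ_[p] (Fin n) (Fin n)
  have hprod := hasStrictFDerivAt_list_prod_apply (e := fun ij => coordFactor (c ij) ij)
    (fun ij => coordFactor_zero (hc ij) ij) (fun ij => ((ha ij).smul_const _).const_add 1) l
  refine ⟨T.toContinuousLinearEquiv,
    (hprod.clm_apply (hasStrictFDerivAt_const (entries 1) 0)).congr_fderiv ?_⟩
  have huniv : l.toFinset = Finset.univ :=
    Finset.eq_univ_iff_forall.2 fun ij => List.mem_toFinset.2 (hmem ij)
  rw [← List.sum_toFinset _ hl, huniv]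
  ext1 ξ
  funext i j
  change _ = a (i, j) * ξ (i, j)
  simp [leftMul_entries_one, Finset.sum_apply, Matrix.single_apply,
    Fintype.sum_prod_type, ite_and, mul_comm]

end Coordinates

section Converse

variable {p : ℕ} [Fact p.Prime] {n : ℕ}

lemma mem_closure_range_natCast_prime_pow_mul {ι : Type*} {N : ℕ} {ξ : ι → ℚ_[p]}
    (hξ : ∀ i, ‖ξ i‖ ≤ (p : ℝ)⁻¹ ^ N) :
    ξ ∈ closure (Set.range fun (k : ι → ℕ) i => ((p ^ N * k i : ℕ) : ℚ_[p])) := by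
  have hp0 : (p : ℚ_[p]) ^ N ≠ 0 :=
    pow_ne_zero _ (by exact_mod_cast (Fact.out : p.Prime).ne_zero)
  let z : ι → ℤ_[p] := fun i => ⟨((p : ℚ_[p]) ^ N)⁻¹ * ξ i, by
    rw [norm_mul, norm_inv, norm_pow, Padic.norm_p]
    exact inv_mul_le_one_of_le₀ (hξ i) (by positivity)⟩
  let κ : (ι → ℤ_[p]) → ι → ℚ_[p] := fun t i => (p : ℚ_[p]) ^ N * (t i : ℚ_[p])
  have hκ : Continuous κ := continuous_pi fun i =>
    (continuous_subtype_val.comp (continuous_apply i)).const_mul _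
  have hκz : κ z = ξ := funext fun i => mul_inv_cancel_left₀ hp0 _
  have hdense : DenseRange (Pi.map fun (_ : ι) (k : ℕ) => (k : ℤ_[p])) :=
    DenseRange.piMap fun _ => PadicInt.denseRange_natCast
  rw [← hκz]
  refine closure_mono ?_ (image_closure_subset_closure_image hκ ⟨z, hdense z, rfl⟩)
  rintro _ ⟨_, ⟨k, rfl⟩, rfl⟩
  exact ⟨k, funext fun i => by simp [κ]⟩

lemma eventually_apply_eq_of_natCast {ι X Y Γ : Type*} [Finite ι] [TopologicalSpace X]
    [TopologicalSpace Y] [T2Space Y] [TopologicalSpace Γ] {φ : Γ → X} (hφ : IsInducing φ)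
    {f : Γ → Y} (hf : Continuous f) {Ψ : (ι → ℚ_[p]) → X} {S : (ι → ℚ_[p]) → Y}
    (hΨ : ∀ᶠ ξ in 𝓝 0, ContinuousAt Ψ ξ) (hS : ∀ᶠ ξ in 𝓝 0, ContinuousAt S ξ) {N : ℕ}
    (hnat : ∀ x : ι → ℕ, (∀ i, p ^ N ∣ x i) →
      ∃ g, φ g = Ψ (fun i => x i) ∧ f g = S fun i => x i) :
    ∀ᶠ ξ in 𝓝 0, ∀ g, φ g = Ψ ξ → f g = S ξ := by
  have hsmall : ∀ᶠ ξ in 𝓝 (0 : ι → ℚ_[p]), ∀ i, ‖ξ i‖ ≤ (p : ℝ)⁻¹ ^ N :=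
    eventually_all.2 fun i => (continuous_apply i).norm.tendsto' 0 0 norm_zero |>.eventually
      (Iic_mem_nhds (by have := (Fact.out : p.Prime).pos; positivity))
  filter_upwards [hΨ, hS, hsmall] with ξ hΨξ hSξ hξ g hg
  have hne : (comap (fun (k : ι → ℕ) i => ((p ^ N * k i : ℕ) : ℚ_[p])) (𝓝 ξ)).NeBot :=
    comap_neBot_iff_frequently.2
      (mem_closure_iff_frequently.1 (mem_closure_range_natCast_prime_pow_mul hξ))
  choose γ hγ hfγ using fun k : ι → ℕ => hnat (fun i => p ^ N * k i) fun i => dvd_mul_right _ _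
  have hγg : Tendsto γ (comap (fun k i => ((p ^ N * k i : ℕ) : ℚ_[p])) (𝓝 ξ)) (𝓝 g) := by
    rw [hφ.tendsto_nhds_iff, hg]
    exact (hΨξ.tendsto.comp tendsto_comap).congr fun k => (hγ k).symm
  exact tendsto_nhds_unique ((hf.tendsto g).comp hγg)
    ((hSξ.tendsto.comp tendsto_comap).congr fun k => (hfγ k).symm)

lemma nodup_finRange_product : (List.finRange n ×ˢ List.finRange n).Nodup :=
  (List.nodup_finRange n).product (List.nodup_finRange n)

/-- The coordinates `ξ` can be recovered analytically from the matrix entries by the inverse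
function theorem, and the multi-indices of natural numbers are dense in the domain of `ξ`. -/
lemma exists_analyticAt_entries_one {E : Type*} [NormedAddCommGroup E] [NormedSpace ℚ_[p] E]
    [CompleteSpace E] {f : GL (Fin n) ℚ_[p] → E} (hf : Continuous f)
    {S : (Fin n × Fin n → ℚ_[p]) → E} (hS : AnalyticAt ℚ_[p] S 0) {N : ℕ}
    (hSf : ∀ x : Fin n × Fin n → ℕ, (∀ ij, p ^ N ∣ x ij) →
      S (fun ij => x ij)
        = f ((List.finRange n ×ˢ List.finRange n).map fun ij => generator p ij ^ x ij).prod) :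
    ∃ F : (Fin n → Fin n → ℚ_[p]) → E, AnalyticAt ℚ_[p] F (entries 1) ∧
      ∀ᶠ g in 𝓝 (1 : GL (Fin n) ℚ_[p]), f g = F (entries g) := by
  choose N' c hc hc0 hca hcx using exists_generator_pow (p := p) (n := n)
  set l := List.finRange n ×ˢ List.finRange n
  have hΨ := analyticAt_coordMap hc l
  have hΨ0 := coordMap_zero hc0 l
  obtain ⟨T, hT⟩ := exists_hasStrictFDerivAt_coordMap hc0 hca nodup_finRange_product
    mem_finRange_product
  have hfS := eventually_apply_eq_of_natCast isEmbedding_entries.isInducing hf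
    (hΨ.eventually_analyticAt.mono fun _ h => h.continuousAt)
    (hS.eventually_analyticAt.mono fun _ h => h.continuousAt) (N := N + ∑ ij, N' ij) fun x hx =>
      ⟨(l.map fun ij => generator p ij ^ x ij).prod,
        (coordMap_natCast l fun ij => hcx ij _ ((pow_dvd_pow p
          ((Finset.single_le_sum (fun _ _ => Nat.zero_le _) (Finset.mem_univ ij)).trans
            (Nat.le_add_left _ _))).trans (hx ij))).symm,
        (hSf x fun ij => (pow_dvd_pow p (Nat.le_add_right _ _)).trans (hx ij)).symm⟩
  let R := hT.toOpenPartialHomeomorph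
  have hR0 : 0 ∈ R.source := hT.mem_toOpenPartialHomeomorph_source
  have hR1 : R 0 = entries 1 := hΨ0
  have hsymm : R.symm (entries 1) = 0 := by rw [← hR1, R.left_inv hR0]
  have hRan : AnalyticAt ℚ_[p] R.symm (entries 1) := hR1 ▸
    R.analyticAt_symm' (i := T) hR0 hΨ hT.hasFDerivAt.fderiv
  refine ⟨S ∘ R.symm, AnalyticAt.comp (by rwa [hsymm]) hRan, ?_⟩
  have htarget : R.target ∈ 𝓝 (entries 1) :=
    R.open_target.mem_nhds (hR1 ▸ R.map_source hR0)
  filter_upwards [(isEmbedding_entries.continuous.tendsto 1).eventually htarget,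
    (isEmbedding_entries.continuous.tendsto 1).eventually
      ((hRan.continuousAt.tendsto.eventually (hsymm.symm ▸ hfS)))] with g hgt hg
  exact hg g (R.right_inv hgt).symm

lemma exists_pow_div_le_rpow_radius_mul (h : ℕ) : ∃ K : ℕ, 0 < K ∧ ∀ d : ℕ,
    (p : ℝ) ^ (d / K) ≤ (p : ℝ) ^ (radius p h * d) := by
  have hr : 0 < radius p h := radius_pos h
  refine ⟨⌈(radius p h)⁻¹⌉₊, Nat.ceil_pos.2 (inv_pos.2 hr), fun d => ?_⟩
  rw [← Real.rpow_natCast]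
  refine Real.rpow_le_rpow_of_exponent_le one_lt_prime_cast.le (Nat.cast_div_le.trans ?_)
  rw [div_eq_inv_mul]
  exact mul_le_mul_of_nonneg_right (inv_le_of_inv_le₀ hr (Nat.le_ceil _)) (Nat.cast_nonneg d)

variable {L : Type u} [NontriviallyNormedField L] [NormedAlgebra ℚ_[p] L]
variable {E : Type v} [NormedAddCommGroup E] [NormedSpace L E] [IsUltrametricDist E]
  [CompleteSpace E] {ρ : Representation L (GL (Fin n) ℚ_[p]) E}

lemma exists_analyticAt_rep_generator_pow_apply {h : ℕ} {v : E} (hv : v ∈ PiH ρ h) :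
    let _ : NormedSpace ℚ_[p] E := NormedSpace.restrictScalars ℚ_[p] L E
    ∃ (N : ℕ) (S : (Fin n × Fin n → ℚ_[p]) → E), AnalyticAt ℚ_[p] S 0 ∧
      ∀ x : Fin n × Fin n → ℕ, (∀ ij, p ^ N ∣ x ij) → S (fun ij => x ij)
        = ρ ((List.finRange n ×ˢ List.finRange n).map fun ij => generator p ij ^ x ij).prod v := by
  intro _
  obtain ⟨K, hK, hKle⟩ := exists_pow_div_le_rpow_radius_mul (p := p) h
  obtain ⟨N, S, hS, hSx⟩ := exists_analyticAt_list_prod_one_add_pow (p := p) hK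
    (nodup_finRange_product (n := n)) mem_finRange_product (u := fun ij => ρ (generator p ij) - 1)
    (ψ := (LinearMap.applyₗ v : Module.End L E →ₗ[L] E).toAddMonoidHom) fun α =>
      (mul_le_mul_of_nonneg_right (hKle _) (norm_nonneg _)).trans (le_normH hv α)
  refine ⟨N, S, hS, fun x hx => (hSx x hx).trans ?_⟩
  simp only [add_sub_cancel, map_list_prod ρ, List.map_map, Function.comp_def, map_pow]
  rfl

lemma mem_analyticSubmodule (hρ : IsContinuousRep ρ) {h : ℕ} {v : E} (hv : v ∈ PiH ρ h) :
    v ∈ analyticSubmodule ρ := by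
  let _ : NormedSpace ℚ_[p] E := NormedSpace.restrictScalars ℚ_[p] L E
  have : IsScalarTower ℚ_[p] L E := IsScalarTower.restrictScalars ℚ_[p] L E
  intro g₀
  obtain ⟨N, S, hS, hSx⟩ := exists_analyticAt_rep_generator_pow_apply hv
  obtain ⟨F, hF, hFg⟩ := exists_analyticAt_entries_one
    (f := fun g => ρ g v) (hρ.comp (Continuous.prodMk_left v)) hS hSx
  let T : E →L[ℚ_[p]] E :=
    (⟨ρ g₀, hρ.continuous_apply g₀⟩ : E →L[L] E).restrictScalars ℚ_[p]
  let Λ := leftMul ((g₀⁻¹ : GL (Fin n) ℚ_[p]) : Matrix (Fin n) (Fin n) ℚ_[p])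
  have hΛ : ∀ g, Λ (entries g) = entries (g₀⁻¹ * g) := leftMul_entries _
  have hF' : AnalyticAt ℚ_[p] F (Λ (entries g₀)) := by rwa [hΛ, inv_mul_cancel]
  refine ⟨fun X => T (F (Λ X)), (T.analyticAt _).comp (hF'.comp (Λ.analyticAt _)), ?_⟩
  have hmul : Tendsto (fun g => g₀⁻¹ * g) (𝓝 g₀) (𝓝 1) :=
    (continuous_const_mul g₀⁻¹).tendsto' _ _ (inv_mul_cancel g₀)
  filter_upwards [hmul.eventually hFg] with g hg
  change ρ g v = ρ g₀ (F (Λ (entries g)))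
  rw [hΛ, ← hg, ← Module.End.mul_apply, ← map_mul, mul_inv_cancel_left]

end Converse

/-! ### The topology of `Π^an` and the lattice `M` -/

section AnalyticVectors

variable {p : ℕ} [Fact p.Prime] {n : ℕ} {L : Type u} [NontriviallyNormedField L]
  [NormedAlgebra ℚ_[p] L] {E : Type v} [NormedAddCommGroup E] [NormedSpace L E]
  {ρ : Representation L (GL (Fin n) ℚ_[p]) E}

namespace AnalyticVectors

lemma incl_injective : Function.Injective (incl ρ) := Subtype.val_injective

lemma incl_mem (a : AnalyticVectors ρ) : incl ρ a ∈ analyticSubmodule ρ := Subtype.prop _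

lemma exists_incl_eq {e : E} (he : e ∈ analyticSubmodule ρ) : ∃ a, incl ρ a = e :=
  ⟨(⟨e, he⟩ : analyticSubmodule ρ), rfl⟩

lemma incl_analyticRep (g : GL (Fin n) ℚ_[p]) (a : AnalyticVectors ρ) :
    incl ρ (analyticRep ρ g a) = ρ g (incl ρ a) := rfl

end AnalyticVectors

section Topology

variable [IsUltrametricDist L]

lemma IsOpenInEachPiH.comap_smul {W : Submodule (OL L) (AnalyticVectors ρ)}
    (hW : IsOpenInEachPiH ρ W) (c : L) :
    IsOpenInEachPiH ρ (W.comap ((LinearMap.lsmul L _ c).restrictScalars (OL L))) := by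
  intro h hh
  obtain ⟨ε, hε, hball⟩ := hW h hh
  refine ⟨ε / (‖c‖ + 1), by positivity, fun a ha ha1 => hball _ ?_ ?_⟩
  · exact (map_smul (AnalyticVectors.incl ρ) c a).symm ▸ Submodule.smul_mem _ c ha
  · calc normH ρ h (AnalyticVectors.incl ρ (c • a))
        = ‖c‖ * normH ρ h (AnalyticVectors.incl ρ a) := by rw [map_smul, normH_smul]
      _ ≤ (‖c‖ + 1) * (ε / (‖c‖ + 1)) := by
          gcongr
          · exact normH_nonneg h _
          · linarith
      _ = ε := mul_div_cancel₀ _ (by positivity)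

namespace AnalyticVectors

lemma hasBasis_nhds (a : AnalyticVectors ρ) :
    (𝓝 a).HasBasis (IsOpenInEachPiH ρ) fun W => (a + ·) '' W := by
  refine ⟨fun U => ?_⟩
  rw [mem_nhds_iff]
  constructor
  · rintro ⟨O, hOU, hO, haO⟩
    obtain ⟨W, hW, hWO⟩ := hO a haO
    exact ⟨W, hW, Set.image_subset_iff.2 fun b hb => hOU (hWO b hb)⟩
  · rintro ⟨W, hW, hWU⟩
    refine ⟨_, hWU, ?_, 0, W.zero_mem, add_zero a⟩
    rintro _ ⟨b, hb, rfl⟩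
    exact ⟨W, hW, fun b' hb' => ⟨b + b', W.add_mem hb hb', (add_assoc a b b').symm⟩⟩

lemma hasBasis_nhds_zero :
    (𝓝 (0 : AnalyticVectors ρ)).HasBasis (IsOpenInEachPiH ρ) fun W => (W : Set _) := by
  simpa only [zero_add, Set.image_id'] using hasBasis_nhds (0 : AnalyticVectors ρ)

instance : IsTopologicalAddGroup (AnalyticVectors ρ) := by
  refine .of_comm_of_nhds_zero ?_ ?_ fun a =>
    (hasBasis_nhds a).eq_of_same_basis (hasBasis_nhds_zero.map (a + ·))
  · rw [(hasBasis_nhds_zero.prod_self).tendsto_iff hasBasis_nhds_zero]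
    exact fun W hW => ⟨W, hW, fun z hz => W.add_mem hz.1 hz.2⟩
  · rw [hasBasis_nhds_zero.tendsto_iff hasBasis_nhds_zero]
    exact fun W hW => ⟨W, hW, fun a ha => W.neg_mem ha⟩

instance : ContinuousConstSMul L (AnalyticVectors ρ) where
  continuous_const_smul c := by
    refine continuous_of_continuousAt_zero (LinearMap.lsmul L (AnalyticVectors ρ) c) ?_
    rw [ContinuousAt, map_zero, hasBasis_nhds_zero.tendsto_iff hasBasis_nhds_zero]
    exact fun W hW => ⟨_, hW.comap_smul c, fun a ha => ha⟩

lemma isVonNBounded_unitBall {h : ℕ} (hh : 1 ≤ h) : Bornology.IsVonNBounded L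
    {b : AnalyticVectors ρ | incl ρ b ∈ PiH ρ h ∧ normH ρ h (incl ρ b) ≤ 1} := by
  rw [hasBasis_nhds_zero.isVonNBounded_iff]
  intro W hW
  obtain ⟨ε, hε, hball⟩ := hW h hh
  rw [absorbs_iff_eventually_nhds_zero W.zero_mem]
  filter_upwards [Metric.closedBall_mem_nhds (0 : L) hε] with c hc b hb
  rw [mem_closedBall_zero_iff] at hc
  refine hball _ ((map_smul (incl ρ) c b).symm ▸ Submodule.smul_mem _ c hb.1) ?_
  rw [map_smul, normH_smul]
  exact (mul_le_of_le_one_right (norm_nonneg c) hb.2).trans hc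

end AnalyticVectors

lemma IsOpenInEachPiH.isOpen {W : Submodule (OL L) (AnalyticVectors ρ)}
    (hW : IsOpenInEachPiH ρ W) : IsOpen (W : Set (AnalyticVectors ρ)) :=
  fun _ ha => ⟨W, hW, fun _ hb => W.add_mem ha hb⟩

lemma analyticRep_mem_latticeM {h : ℕ} {b : AnalyticVectors ρ}
    (hb : AnalyticVectors.incl ρ b ∈ PiH ρ h) (hb1 : normH ρ h (AnalyticVectors.incl ρ b) ≤ 1)
    (g : GL (Fin n) ℚ_[p]) : analyticRep ρ g b ∈ latticeM ρ h :=
  Submodule.subset_span ⟨g, b, hb, hb1, rfl⟩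

end Topology

variable [IsUltrametricDist E] [CompleteSpace E]

lemma mem_analyticSubmodule_iff (hρ : IsContinuousRep ρ) (e : E) :
    e ∈ analyticSubmodule ρ ↔ ∃ h ≥ 1, e ∈ PiH ρ h := by
  refine ⟨fun he => ?_, fun ⟨h, _, he⟩ => mem_analyticSubmodule hρ he⟩
  obtain ⟨h, ⟨hmem, -⟩, hh⟩ := ((eventually_mem_PiH hρ he).and (eventually_ge_atTop 1)).exists
  exact ⟨h, hh, by simpa using hmem 1 (one_mem _)⟩

variable [IsUltrametricDist L]

lemma tendsto_analyticRep_apply (hρ : IsContinuousRep ρ) (a : AnalyticVectors ρ) :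
    Tendsto (fun g => analyticRep ρ g a) (𝓝 1) (𝓝 a) := by
  rw [← tendsto_sub_nhds_zero_iff, AnalyticVectors.hasBasis_nhds_zero.tendsto_right_iff]
  intro W hW
  obtain ⟨h, ⟨hmem, hnorm⟩, hh⟩ :=
    ((eventually_mem_PiH hρ a.incl_mem).and (eventually_ge_atTop 1)).exists
  have ha : AnalyticVectors.incl ρ a ∈ PiH ρ h := by simpa using hmem 1 (one_mem _)
  obtain ⟨ε, hε, hball⟩ := hW h hh
  filter_upwards [hnorm ε hε, isOpen_H.mem_nhds (one_mem (H p n))] with g hg hgH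
  refine hball _ ?_ ?_ <;> rw [map_sub, AnalyticVectors.incl_analyticRep]
  exacts [Submodule.sub_mem _ (hmem g hgH) ha, hg]

lemma IsOpenInEachPiH.span_eq_top (hρ : IsContinuousRep ρ)
    {W : Submodule (OL L) (AnalyticVectors ρ)} (hW : IsOpenInEachPiH ρ W) :
    Submodule.span L (W : Set (AnalyticVectors ρ)) = ⊤ := by
  refine Submodule.eq_top_iff'.2 fun a => ?_
  obtain ⟨h, hh, ha⟩ := (mem_analyticSubmodule_iff hρ _).1 a.incl_mem
  obtain ⟨ε, hε, hball⟩ := hW h hh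
  have hlim : Tendsto (fun k : ℕ => normH ρ h (AnalyticVectors.incl ρ ((p : L) ^ k • a)))
      atTop (𝓝 0) := by
    simpa [normH_smul] using
      (tendsto_natCast_prime_pow p L).norm.mul_const (normH ρ h (AnalyticVectors.incl ρ a))
  obtain ⟨k, hk⟩ := (hlim.eventually (ge_mem_nhds hε)).exists
  have hmem : (p : L) ^ k • a ∈ W :=
    hball _ ((map_smul (AnalyticVectors.incl ρ) _ a).symm ▸ Submodule.smul_mem _ _ ha) hk
  rw [← inv_smul_smul₀ (pow_ne_zero k (natCast_prime_ne_zero p L)) a]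
  exact Submodule.smul_mem _ _ (Submodule.subset_span hmem)

lemma isOpenInEachPiH_latticeM (hρ : IsContinuousRep ρ) {m : ℕ} (hm : IsCoherentFrom ρ m) {h : ℕ}
    (hh : m ≤ h) : IsOpenInEachPiH ρ (latticeM ρ h) := by
  intro h' _
  rcases le_total h' h with hle | hle
  · refine ⟨1, one_pos, fun a ha ha1 => ?_⟩
    simpa using analyticRep_mem_latticeM (PiH_mono hle ha) ((normH_anti hle ha).trans ha1) 1
  · obtain ⟨k, rfl⟩ := Nat.exists_eq_add_of_le hle
    obtain ⟨ε, hε, hball⟩ := hm.exists_ball_subset hρ hh k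
      (A := (latticeM ρ h).toAddSubgroup.map (AnalyticVectors.incl ρ).toAddMonoidHom) (by
        intro g e he he1
        obtain ⟨b, rfl⟩ := AnalyticVectors.exists_incl_eq (mem_analyticSubmodule hρ he)
        exact ⟨analyticRep ρ g b, analyticRep_mem_latticeM he he1 g, rfl⟩)
    refine ⟨ε, hε, fun a ha ha1 => ?_⟩
    obtain ⟨b, hb, hba⟩ := hball _ ha ha1
    rwa [← AnalyticVectors.incl_injective hba]

theorem exists_isUniversalUnitaryCompletion_latticeM (hρ : IsContinuousRep ρ) {m : ℕ}
    (hm : IsCoherentFrom ρ m) {h : ℕ} (hh : m ≤ h) :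
    ∃ ι : AnalyticVectors ρ →L[L] LatticeCompletion p (latticeM ρ h),
      (∀ a : latticeM ρ h, ι a = LatticeCompletion.int p (latticeM ρ h)
        (AdicCompletion.of (idealP p L) (latticeM ρ h) a)) ∧
      IsUniversalUnitaryCompletion.{u, v, w} (analyticRep ρ)
        (latticeCompletionRep p (latticeM ρ h) (analyticRep ρ) (latticeM_stable ρ h)) ι := by
  have hW := isOpenInEachPiH_latticeM hρ hm hh
  have hM := hW.span_eq_top hρ
  refine ⟨LatticeCompletion.ofSpaceL hM (hW.isOpen.mem_nhds (zero_mem _)),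
    LatticeCompletion.ofSpace_coe hM, ?_⟩
  refine LatticeCompletion.isUniversalUnitaryCompletion_ofSpaceL (latticeM_stable ρ h)
    (tendsto_analyticRep_apply hρ) hM _
    (AnalyticVectors.isVonNBounded_unitBall (hm.1.trans hh)) (Submodule.span_mono ?_)
  rintro _ ⟨g, b, hb, hb1, rfl⟩
  exact ⟨g, b, ⟨hb, hb1⟩, rfl⟩

end AnalyticVectors

end

end UnitaryCompletion

open UnitaryCompletion in
theorem mainTheorem12_general
    {p : ℕ} [Fact p.Prime] {n : ℕ}
    {L : Type u} [NontriviallyNormedField L] [IsUltrametricDist L] [NormedAlgebra ℚ_[p] L]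
    {E : Type v} [NormedAddCommGroup E] [NormedSpace L E] [IsUltrametricDist E] [CompleteSpace E]
    (ρ : Representation L (GL (Fin n) ℚ_[p]) E) (hρ : IsContinuousRep ρ)
    (hcoh : IsCoherent ρ) :
    (∀ e : E, e ∈ analyticSubmodule ρ ↔ ∃ h ≥ 1, e ∈ PiH ρ h) ∧
    HasUniversalUnitaryCompletion.{u, v, w} (analyticRep ρ) ∧
    ∀ m : ℕ, IsCoherentFrom ρ m → ∀ h ≥ m,
      IsOpen (latticeM ρ h : Set (AnalyticVectors ρ)) ∧
      Submodule.span L (latticeM ρ h : Set (AnalyticVectors ρ)) = ⊤ ∧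
      ∃ ι : AnalyticVectors ρ →L[L] LatticeCompletion p (latticeM ρ h),
        (∀ a : latticeM ρ h, ι a = LatticeCompletion.int p (latticeM ρ h)
          (AdicCompletion.of (idealP p L) (latticeM ρ h) a)) ∧
        IsUniversalUnitaryCompletion.{u, v, w} (analyticRep ρ)
          (latticeCompletionRep p (latticeM ρ h) (analyticRep ρ) (latticeM_stable ρ h)) ι := by
  refine ⟨mem_analyticSubmodule_iff hρ, ?_, fun m hm h hh => ?_⟩
  · obtain ⟨m, hm⟩ := hcoh
    obtain ⟨ι, -, hι⟩ := exists_isUniversalUnitaryCompletion_latticeM.{u, v, w} hρ hm le_rfl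
    exact ⟨_, _, _, _, _, ι, hι⟩
  · have hopen := isOpenInEachPiH_latticeM hρ hm hh
    exact ⟨hopen.isOpen, hopen.span_eq_top hρ,
      exists_isUniversalUnitaryCompletion_latticeM hρ hm hh⟩

open UnitaryCompletion in
theorem mainTheorem12
    {p : ℕ} [Fact p.Prime] {n : ℕ}
    {L : Type u} [NontriviallyNormedField L] [IsUltrametricDist L] [NormedAlgebra ℚ_[p] L]
    [FiniteDimensional ℚ_[p] L]
    {E : Type v} [NormedAddCommGroup E] [NormedSpace L E] [IsUltrametricDist E] [CompleteSpace E]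
    (ρ : Representation L (GL (Fin n) ℚ_[p]) E) (hρ : IsContinuousRep ρ)
    (hadm : IsAdmissible hρ) (hcentral : HasCentralCharacter ρ) (hcoh : IsCoherent ρ) :
    (∀ e : E, e ∈ analyticSubmodule ρ ↔ ∃ h ≥ 1, e ∈ PiH ρ h) ∧
    HasUniversalUnitaryCompletion.{u, v, w} (analyticRep ρ) ∧
    ∀ m : ℕ, IsCoherentFrom ρ m → ∀ h ≥ m,
      IsOpen (latticeM ρ h : Set (AnalyticVectors ρ)) ∧
      Submodule.span L (latticeM ρ h : Set (AnalyticVectors ρ)) = ⊤ ∧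
      ∃ ι : AnalyticVectors ρ →L[L] LatticeCompletion p (latticeM ρ h),
        (∀ a : latticeM ρ h, ι a = LatticeCompletion.int p (latticeM ρ h)
          (AdicCompletion.of (idealP p L) (latticeM ρ h) a)) ∧
        IsUniversalUnitaryCompletion.{u, v, w} (analyticRep ρ)
          (latticeCompletionRep p (latticeM ρ h) (analyticRep ρ) (latticeM_stable ρ h)) ι :=
  mainTheorem12_general ρ hρ hcoh
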